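/- **Setting.** For $n\in\mathbb N\cup\{0\}$ let $\Sigma_n$ be the space of $u\in L^2(\mathbb R^3,\mathbb R^{2N})$ with $\|u\|_{\Sigma_n}^2=\sum_{|\alpha|\le n}(\|x^\alpha u\|_{L^2}^2+\|\partial_x^\alpha u\|_{L^2}^2)<\infty$, and let $\Sigma_{-n}$ be its dual with respect to the $L^2$ inner product $\langle\ ,\ \rangle$. Let $J$ be an invertible antisymmetric $2N\times 2N$ matrix, and let $\Diamond_1,\dots,\Diamond_{n_0}$ be selfadjoint operators in $L^2$ which commute with $J$ and with each other, with $\Diamond_\ell:\Sigma_{n+d_\ell}\to\Sigma_{n}$ for all $n\ge 0$; put $\mathbf d=\sup_\ell d_\ell$ and $\Pi_\ell(u)=\frac12\langle\Diamond_\ell u,u\rangle$, $\Pi=(\Pi_1,\dots,\Pi_{n_0})$. Let $e^{J\tau\cdot\Diamond}$, $\tau\in\mathbb R^{n_0}$, be the strongly continuous group in $L^2$ with generators $J\Diamond_j$; assume that it maps each $\Sigma_n$, $n\ge0$, into itself with norm bounded uniformly for $\tau$ in bounded sets. Let $\mathcal O\subset\mathbb R^{n_0}$ be open and $p\mapsto\Phi_p$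 a $C^\infty$ map from $\mathcal O$ to the Schwartz space $\bigcap_n\Sigma_n$ with $\Pi(\Phi_p)=p$ and $\langle J^{-1}\partial_{p_j}\Phi_p,\partial_{p_k}\Phi_p\rangle=0$ for all $j,k$. Set $$P_{N_g}(p)X=\sum_j\big(-J\Diamond_j\Phi_p\,\langle X,J^{-1}\partial_{p_j}\Phi_p\rangle+\partial_{p_j}\Phi_p\,\langle X,\Diamond_j\Phi_p\rangle\big),\qquad P(p)=1-P_{N_g}(p),$$ the projection onto $N_g(\mathcal H_p)=\mathrm{span}\{J\Diamond_j\Phi_p,\partial_{p_j}\Phi_p\}$, whose kernel is the orthogonal $N_g^\perp(\mathcal H_p^*)$ of $N_g(\mathcal H_p^*)=\mathrm{span}\{\Diamond_j\Phi_p,J^{-1}\partial_{p_j}\Phi_p\}$. Fix $p_0\in\mathcal O$, put $X^{s}=\Sigma_s\cap N_g^\perp(\mathcal H_{p_0}^*)$ for $s\in\mathbb Z$, and let $\widetilde{\mathbf P}^s=\{(\tau,\Pi,R)\}=\mathbb R^{n_0}\times\mathbb R^{n_0}\times X^s$. For $k\ge0$, $\varepsilon>0$, $s\ge\mathbf d$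 set $$\mathcal U^{s}_{\varepsilon,k}=\{(\tau,\Pi,R)\in\widetilde{\mathbf P}^{s}:\ \Pi=p_0,\ \|R\|_{\Sigma_{-k}}+|\Pi(R)|\le\varepsilon\}.$$ A function $u=e^{J\tau\cdot\Diamond}(\Phi_p+P(p)R)$ with $p\in\mathcal O$ and $\Pi(u)=\Pi$ is said to have coordinates $(\tau,\Pi,R)$. **Hypotheses.** Let $r,M,M_0,l,k$ be nonnegative integers with $1\le l\le M$, $M_0\ge1$, $(l+1)\mathbf d\le r$, $0\le k\le r-(l+1)\mathbf d$, and let $i\in\{0,1\}$. Consider the system $$\dot\tau_j=T_j(t,\Pi,\Pi(R),R),\quad \dot\Pi_j=0,\quad \dot R=\sum_j\mathcal A_j(t,\Pi,\Pi(R),R)\,J\Diamond_jR+\mathcal D(t,\Pi,\Pi(R),R).$$ Assume that for an open neighbourhood $\mathcal U_{-r}$ of $0$ in $\mathbb R^{n_0}\times X^{-r}$ the following holds at $\Pi=p_0$ (dropping $\Pi$ from the notation): $T,\mathcal A\in C^M((-3,3)\times\mathcal U_{-r},\mathbb R^{n_0})$ and $\mathcal D\in C^M((-3,3)\times\mathcal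 U_{-r},\Sigma_r)$; there is a constant $C_r$ such that on $(-3,3)\times\mathcal U_{-r}$ $$|\mathcal A(t,\varrho,R)|\le C_r\|R\|_{\Sigma_{-r}}^{M_0+1},\qquad \|\mathcal D(t,\varrho,R)\|_{\Sigma_r}\le C_r(|\varrho|+\|R\|_{\Sigma_{-r}})^i\|R\|_{\Sigma_{-r}}^{M_0};$$ and $P_{N_g}(p_0)\big(\sum_j\mathcal A_jJ\Diamond_jR+\mathcal D\big)=0$, with coefficients evaluated at $(t,\Pi(R),R)$, for all $t\in(-3,3)$ and $R\in X^{\mathbf d}$ with $(\Pi(R),R)\in\mathcal U_{-r}$. **Conclusion.** There are $\varepsilon_0>0$ and $\mathfrak F^t=(\mathfrak F^t_\tau,p_0,\mathfrak F^t_R)$ such that: 1. *(Flow.)* For every $z_0\in\mathcal U^{\mathbf d}_{\varepsilon_0,k}$ the curve $t\mapsto\mathfrak F^t(z_0)$ is the unique solution of the system on $[-2,2]$ with value $z_0$ at $t=0$ (solutions are continuous with values in $\widetilde{\mathbf P}^{\mathbf d}$, with $R$ differentiable in $L^2$ and $(\Pi(R),R)\in\mathcal U_{-r}$). 2. *(Form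 of the flow.)* There are open neighbourhoods $B_1$ of $0$ in $\mathbb R^{n_0}$ and $B_2$ of $0$ in $\Sigma_{-k}$, maps $q\in C^l((-2,2)\times B_1\times B_2,\mathbb R^{n_0})$ and $\mathbf S\in C^l((-2,2)\times B_1\times B_2,\Sigma_{r-(l+1)\mathbf d})$ and a constant $C$, such that $(\Pi(R),R)\in B_1\times B_2$ for all $(\tau,p_0,R)\in\mathcal U^{\mathbf d}_{\varepsilon_0,k}$ and, for these and $|t|<2$, $$\mathfrak F^t_R=e^{Jq(t,\Pi(R),R)\cdot\Diamond}\big(R+\mathbf S(t,\Pi(R),R)\big).$$ On $(-2,2)\times B_1\times B_2$, with $\|R\|_*:=\|R\|_{\Sigma_{(l+1)\mathbf d-r}}$, $$|q(t,\varrho,R)|\le C\|R\|_*^{M_0+1},\qquad \|\mathbf S(t,\varrho,R)\|_{\Sigma_{r-(l+1)\mathbf d}}\le C(|\varrho|+\|R\|_*)^i\|R\|_*^{M_0},$$ and $\mathbf S=\mathbf S_1+\mathbf S_2$, where $\mathbf S_1(t,\Pi(R),R)=\int_0^t\mathcal D(t',\Pi(R(t')),R(t'))\,dt'$ with $R(t')=\mathfrak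 F^{t'}_R$ (for $(\tau,p_0,R)\in\mathcal U^{\mathbf d}_{\varepsilon_0,k}$), and, for every $0\le s\le r-\mathbf d$, $\|\mathbf S_2(t,\varrho,R)\|_{\Sigma_s}\le C\|R\|_*^{2M_0+1}(|\varrho|+\|R\|_*)^i$. 3. *(Regularity and invariance.)* Let $s,s'\ge0$ be integers with $s+l\mathbf d\le s'\le r-(l+1)\mathbf d$. For all sufficiently small $\varepsilon_1>0$ we have $\mathfrak F^t\in C^l((-2,2)\times\mathcal U^{s'}_{\varepsilon_1,k},\widetilde{\mathbf P}^{s})$, and there is $\varepsilon_2>0$ such that $\mathfrak F^t(\mathcal U^{s'}_{\varepsilon_2,k})\subset\mathcal U^{s'}_{\varepsilon_1,k}$ for all $|t|\le2$. 4. *(Symmetry.)* $\mathfrak F^t$ commutes with the group: for $|t|\le2$, $(\tau,p_0,R)\in\mathcal U^{\mathbf d}_{\varepsilon_0,k}$ and $\sigma\in\mathbb R^{n_0}$, $\mathfrak F^t(\sigma+\tau,p_0,R)$ is obtained from $\mathfrak F^t(\tau,p_0,R)$ by adding $\sigma$ to the $\tau$ component; consequently, if $u$ has coordinates $z=(\tau,p_0,R)$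 and $u'$ has coordinates $\mathfrak F^t(z)$, then $e^{J\sigma\cdot\Diamond}u$ has coordinates $z_\sigma=(\sigma+\tau,p_0,R)$ and $e^{J\sigma\cdot\Diamond}u'$ has coordinates $\mathfrak F^t(z_\sigma)$. -/

import Mathlib

open Set MeasureTheory Topology SchwartzMap
open scoped ContDiff LineDeriv InnerProductSpace

noncomputable section

namespace DarbouxFlow

/-! ### The scale of spaces `Σ_n(ℝ³, ℝ^{2N})` -/

abbrev E3 : Type := EuclideanSpace ℝ (Fin 3)

/-- The target space `ℝ^{2N}` with its Euclidean norm. -/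
abbrev V (N : ℕ) : Type := EuclideanSpace ℝ (Fin (2 * N))

/-- The real Hilbert space `L²(ℝ³, ℝ^{2N})`. -/
abbrev L2 (N : ℕ) : Type := Lp (V N) 2 (volume : Measure E3)

/-- The parameter space `ℝ^{n₀}` with its Euclidean norm. -/
abbrev Rn (n₀ : ℕ) : Type := EuclideanSpace ℝ (Fin n₀)

/-- The `j`-th vector of the standard basis. -/
abbrev stdVec {n : ℕ} (j : Fin n) : EuclideanSpace ℝ (Fin n) := EuclideanSpace.single j 1

/-- Multi-indices `α ∈ ℕ³` with `|α| ≤ n`. -/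
abbrev MIdx (n : ℕ) : Type := {α : Fin 3 → Fin (n + 1) // ∑ i, (α i : ℕ) ≤ n}

/-- The multi-index zero. -/
def zeroIdx (n : ℕ) : MIdx n := ⟨fun _ => 0, by simp⟩

/-- Multi-indices of length at most `m` have length at most `n` if `m ≤ n`. -/
def castIdx {m n : ℕ} (h : m ≤ n) (α : MIdx m) : MIdx n :=
  ⟨fun i => Fin.castLE (Nat.succ_le_succ h) (α.1 i), by simpa using α.2.trans h⟩

/-- The partial derivative `∂^α φ` of a Schwartz function. -/
def multiDeriv {N : ℕ} (α : Fin 3 → ℕ) (φ : 𝓢(E3, V N)) : 𝓢(E3, V N) :=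
  (fun ψ : 𝓢(E3, V N) => ∂_{(stdVec 0 : E3)} ψ)^[α 0]
    ((fun ψ : 𝓢(E3, V N) => ∂_{(stdVec 1 : E3)} ψ)^[α 1]
      ((fun ψ : 𝓢(E3, V N) => ∂_{(stdVec 2 : E3)} ψ)^[α 2] φ))

/-- `f = x^α u` almost everywhere. -/
def IsMonomialMul {N : ℕ} (α : Fin 3 → ℕ) (u f : L2 N) : Prop :=
  ∀ᵐ x : E3, f x = (∏ i, x i ^ α i) • u x

/-- `g ∈ L²` is the weak derivative `∂^α u`. -/
def IsWeakDeriv {N : ℕ} (α : Fin 3 → ℕ) (u g : L2 N) : Prop :=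
  ∀ φ : 𝓢(E3, V N),
    ∫ x, ⟪g x, φ x⟫_ℝ = (-1) ^ (∑ i, α i) * ∫ x, ⟪u x, multiDeriv α φ x⟫_ℝ

/-- Families of `L²` functions, two for each multi-index of length at most `n`, with the norm
`(∑_{|α| ≤ n} (‖f_α‖² + ‖g_α‖²))^{1/2}`. -/
abbrev Tuples (N n : ℕ) : Type := PiLp 2 (fun _ : MIdx n ⊕ MIdx n => L2 N)

lemma IsMonomialMul.zero {N : ℕ} (α : Fin 3 → ℕ) : IsMonomialMul α (0 : L2 N) 0 := by
  unfold IsMonomialMul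
  filter_upwards [Lp.coeFn_zero (V N) 2 (volume : Measure E3)] with x hx
  rw [hx]
  simp

lemma IsMonomialMul.add {N : ℕ} {α : Fin 3 → ℕ} {u u' f f' : L2 N}
    (h : IsMonomialMul α u f) (h' : IsMonomialMul α u' f') :
    IsMonomialMul α (u + u') (f + f') := by
  unfold IsMonomialMul at *
  filter_upwards [h, h', Lp.coeFn_add u u', Lp.coeFn_add f f'] with x h1 h2 h3 h4
  rw [h3, h4, Pi.add_apply, Pi.add_apply, h1, h2, smul_add]

lemma IsMonomialMul.smul {N : ℕ} {α : Fin 3 → ℕ} {u f : L2 N} (c : ℝ)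
    (h : IsMonomialMul α u f) : IsMonomialMul α (c • u) (c • f) := by
  unfold IsMonomialMul at *
  filter_upwards [h, Lp.coeFn_smul c u, Lp.coeFn_smul c f] with x h1 h3 h4
  rw [h3, h4, Pi.smul_apply, Pi.smul_apply, h1, smul_comm]

lemma integral_inner_schwartz {N : ℕ} (u : L2 N) (φ : 𝓢(E3, V N)) :
    ∫ x, ⟪u x, φ x⟫_ℝ = ⟪u, φ.toLp 2 volume⟫_ℝ := by
  rw [L2.inner_def]
  refine integral_congr_ae ?_
  filter_upwards [φ.coeFn_toLp 2 (volume : Measure E3)] with x hx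
  rw [hx]

lemma isWeakDeriv_iff {N : ℕ} (α : Fin 3 → ℕ) (u g : L2 N) :
    IsWeakDeriv α u g ↔ ∀ φ : 𝓢(E3, V N),
      ⟪g, φ.toLp 2 volume⟫_ℝ
        = (-1) ^ (∑ i, α i) * ⟪u, (multiDeriv α φ).toLp 2 volume⟫_ℝ := by
  simp only [IsWeakDeriv, integral_inner_schwartz]

/-- The families `((x^α u)_α, (∂^α u)_α)` with entries in `L²`, for `u ∈ L²`; the function `u` itself
is the entry `x^0 u`. -/
def sgSubmodule (N n : ℕ) : Submodule ℝ (Tuples N n) where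
  carrier := {w | ∀ α : MIdx n,
    IsMonomialMul (fun i => (α.1 i : ℕ)) (w (Sum.inl (zeroIdx n))) (w (Sum.inl α)) ∧
    IsWeakDeriv (fun i => (α.1 i : ℕ)) (w (Sum.inl (zeroIdx n))) (w (Sum.inr α))}
  zero_mem' := fun α => ⟨IsMonomialMul.zero _, by
    rw [isWeakDeriv_iff]; intro φ; simp⟩
  add_mem' := fun {a b} ha hb α => ⟨(ha α).1.add (hb α).1, by
    have h1 := (ha α).2
    have h2 := (hb α).2
    rw [isWeakDeriv_iff] at h1 h2 ⊢
    intro φ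
    simp only [PiLp.add_apply, inner_add_left, h1 φ, h2 φ, mul_add]⟩
  smul_mem' := fun c a ha α => ⟨(ha α).1.smul c, by
    have h1 := (ha α).2
    rw [isWeakDeriv_iff] at h1 ⊢
    intro φ
    simp only [PiLp.smul_apply, real_inner_smul_left, h1 φ]
    ring⟩

/-- The space `Σ_n`, `n ∈ ℕ`: the `u ∈ L²` all of whose `x^α u` and weak derivatives `∂^α u` with
`|α| ≤ n` are in `L²`, with the norm `‖u‖² = ∑_{|α| ≤ n} (‖x^α u‖² + ‖∂^α u‖²)`. -/
def Sg (N n : ℕ) : Type := sgSubmodule N n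

instance (N n : ℕ) : NormedAddCommGroup (Sg N n) :=
  inferInstanceAs (NormedAddCommGroup (sgSubmodule N n))

instance (N n : ℕ) : NormedSpace ℝ (Sg N n) :=
  inferInstanceAs (NormedSpace ℝ (sgSubmodule N n))

/-- An element of `Σ_n` as a family. -/
def toTuples {N n : ℕ} : Sg N n →L[ℝ] Tuples N n := (sgSubmodule N n).subtypeL

/-- The inclusion `Σ_n ⊆ L²`. -/
def fn {N n : ℕ} : Sg N n →L[ℝ] L2 N :=
  (PiLp.proj 2 (fun _ : MIdx n ⊕ MIdx n => L2 N) (Sum.inl (zeroIdx n))).comp toTuples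

/-- The space `Σ_{-n}`, `n ∈ ℕ`: the dual of `Σ_n` with respect to the `L²` pairing. -/
abbrev Sd (N n : ℕ) : Type := StrongDual ℝ (Sg N n)

/-- Restriction of families to shorter multi-indices. -/
def tuplesRestrict {N m n : ℕ} (h : m ≤ n) : Tuples N n →L[ℝ] Tuples N m :=
  ((PiLp.continuousLinearEquiv 2 ℝ (fun _ : MIdx m ⊕ MIdx m => L2 N)).symm :
      (MIdx m ⊕ MIdx m → L2 N) →L[ℝ] Tuples N m).comp
    (ContinuousLinearMap.pi fun a =>
      PiLp.proj 2 (fun _ : MIdx n ⊕ MIdx n => L2 N) (Sum.map (castIdx h) (castIdx h) a))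

/-- The inclusion `Σ_n ⊆ Σ_m` for `m ≤ n`. -/
def sgIncl {N m n : ℕ} (h : m ≤ n) : Sg N n →L[ℝ] Sg N m :=
  ((tuplesRestrict h).comp (sgSubmodule N n).subtypeL).codRestrict (sgSubmodule N m)
    (fun w α => w.2 (castIdx h α))

/-- The inclusion `Σ_{-m} ⊆ Σ_{-n}` for `m ≤ n`. -/
def sdIncl {N m n : ℕ} (h : m ≤ n) (R : Sd N m) : Sd N n := R.comp (sgIncl h)

/-- The inclusion `L² ⊆ Σ_{-n}`: `f` acts on `Σ_n` by `w ↦ ⟨f, w⟩`. -/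
def toSd {N : ℕ} (n : ℕ) (f : L2 N) : Sd N n := (innerSL ℝ f).comp fn

/-! ### The symmetries -/

/-- A matrix acting pointwise on `L²`. -/
def matOp {N : ℕ} (J : Matrix (Fin (2 * N)) (Fin (2 * N)) ℝ) : L2 N →L[ℝ] L2 N :=
  (Matrix.toEuclideanCLM (𝕜 := ℝ) J).compLpL 2 volume

open Classical in
/-- The value of a partially defined operator (zero outside its domain). -/
def app {N : ℕ} (T : L2 N →ₗ.[ℝ] L2 N) (u : L2 N) : L2 N :=
  if h : u ∈ T.domain then T ⟨u, h⟩ else 0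

/-- `J` is an invertible antisymmetric matrix, `◇_1, …, ◇_{n₀}` are selfadjoint operators in `L²`
which map `Σ_{n + d_ℓ}` into `Σ_n`, commute with `J` and with each other, and
`G τ = e^{Jτ·◇}` is the strongly continuous `n₀`-parameter group in `L²` whose generators are the
operators `J◇_j`; it acts on every `Σ_n` with bounds that are locally uniform in `τ`. -/
structure IsSymmetrySetup {N n₀ : ℕ} (J : Matrix (Fin (2 * N)) (Fin (2 * N)) ℝ)
    (Dia : Fin n₀ → (L2 N →ₗ.[ℝ] L2 N)) (ord : Fin n₀ → ℕ)
    (G : Rn n₀ → (L2 N →L[ℝ] L2 N)) : Prop where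
  antisymm : J.transpose = -J
  invertible : IsUnit J.det
  selfAdjoint : ∀ j, IsSelfAdjoint (Dia j)
  maps : ∀ j n, ∀ u : Sg N (n + ord j), fn u ∈ (Dia j).domain ∧
    ∃ v : Sg N n, fn v = app (Dia j) (fn u)
  comm_J : ∀ j, ∀ u ∈ (Dia j).domain, matOp J u ∈ (Dia j).domain ∧
    app (Dia j) (matOp J u) = matOp J (app (Dia j) u)
  comm : ∀ j k, ∀ u : Sg N (ord j + ord k),
    app (Dia j) (app (Dia k) (fn u)) = app (Dia k) (app (Dia j) (fn u))
  group_zero : G 0 = 1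
  group_add : ∀ σ τ, G (σ + τ) = (G σ).comp (G τ)
  group_cont : ∀ u, Continuous fun τ => G τ u
  generator : ∀ j u v, HasDerivAt (fun t : ℝ => G (t • stdVec j) u) v 0 ↔
    u ∈ (Dia j).domain ∧ matOp J (app (Dia j) u) = v
  group_bound : ∀ n : ℕ, ∀ c : ℝ, 0 < c → ∃ C : ℝ, ∀ τ : Rn n₀, ‖τ‖ ≤ c → ∀ u : Sg N n,
    ∃ v : Sg N n, fn v = G τ (fn u) ∧ ‖v‖ ≤ C * ‖u‖

/-- The order `𝐝 = sup_ℓ d_ℓ`. -/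
def maxOrd {n₀ : ℕ} (ord : Fin n₀ → ℕ) : ℕ := Finset.univ.sup ord

/-- `Π(u)`, with components `Π_j(u) = ½ ⟨◇_j u, u⟩`. -/
def momentum {N n₀ : ℕ} (Dia : Fin n₀ → (L2 N →ₗ.[ℝ] L2 N)) (u : L2 N) : Rn n₀ :=
  WithLp.toLp 2 fun j => (1 / 2 : ℝ) * ⟪app (Dia j) u, u⟫_ℝ

/-! ### The solitary waves and the projections -/

/-- The derivative `∂_{p_j} Φ_p`. -/
def pderiv {N n₀ : ℕ} (Φ : Rn n₀ → L2 N) (p : Rn n₀) (j : Fin n₀) : L2 N :=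
  fderiv ℝ Φ p (stdVec j)

/-- `p ↦ Φ_p` is a `C^∞` map from the open set `O` to the Schwartz space `⋂_n Σ_n`, with
`Π(Φ_p) = p` and `Ω(∂_{p_j}Φ_p, ∂_{p_k}Φ_p) = 0` for `Ω = ⟨J⁻¹ · , · ⟩`. -/
structure IsSolitonFamily {N n₀ : ℕ} (J : Matrix (Fin (2 * N)) (Fin (2 * N)) ℝ)
    (Dia : Fin n₀ → (L2 N →ₗ.[ℝ] L2 N)) (O : Set (Rn n₀)) (Φ : Rn n₀ → L2 N) : Prop where
  isOpen : IsOpen O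
  smooth : ∀ n : ℕ, ∃ Φn : Rn n₀ → Sg N n, ContDiffOn ℝ ∞ Φn O ∧ ∀ p ∈ O, fn (Φn p) = Φ p
  momentum_eq : ∀ p ∈ O, momentum Dia (Φ p) = p
  isotropic : ∀ p ∈ O, ∀ j k, ⟪matOp J⁻¹ (pderiv Φ p j), pderiv Φ p k⟫_ℝ = 0

/-- The projection
`P_{N_g}(p) X = ∑_j (-J◇_jΦ_p ⟨X, J⁻¹∂_{p_j}Φ_p⟩ + ∂_{p_j}Φ_p ⟨X, ◇_jΦ_p⟩)` onto
`N_g(𝓗_p) = span {J◇_jΦ_p, ∂_{p_j}Φ_p}`. -/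
def projNg {N n₀ : ℕ} (J : Matrix (Fin (2 * N)) (Fin (2 * N)) ℝ)
    (Dia : Fin n₀ → (L2 N →ₗ.[ℝ] L2 N)) (Φ : Rn n₀ → L2 N) (p : Rn n₀) (X : L2 N) : L2 N :=
  ∑ j, (-(⟪X, matOp J⁻¹ (pderiv Φ p j)⟫_ℝ • matOp J (app (Dia j) (Φ p)))
    + ⟪X, app (Dia j) (Φ p)⟫_ℝ • pderiv Φ p j)

/-- `N_g(𝓗_p^*) = span {◇_jΦ_p, J⁻¹∂_{p_j}Φ_p}`. -/
def NgStar {N n₀ : ℕ} (J : Matrix (Fin (2 * N)) (Fin (2 * N)) ℝ)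
    (Dia : Fin n₀ → (L2 N →ₗ.[ℝ] L2 N)) (Φ : Rn n₀ → L2 N) (p : Rn n₀) : Submodule ℝ (L2 N) :=
  Submodule.span ℝ
    (range (fun j => app (Dia j) (Φ p)) ∪ range (fun j => matOp J⁻¹ (pderiv Φ p j)))

/-- `Σ_n ∩ K^⊥`. -/
def perp {N : ℕ} (K : Submodule ℝ (L2 N)) (n : ℕ) : Submodule ℝ (Sg N n) where
  carrier := {u | ∀ ψ ∈ K, ⟪fn u, ψ⟫_ℝ = 0}
  zero_mem' := by intro ψ _; simp
  add_mem' := by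
    intro a b ha hb ψ hψ
    rw [map_add, inner_add_left, ha ψ hψ, hb ψ hψ, add_zero]
  smul_mem' := by
    intro c a ha ψ hψ
    rw [map_smul, real_inner_smul_left, ha ψ hψ, mul_zero]

/-- `Σ_{-n} ∩ K^⊥`: the elements of `Σ_{-n}` which vanish on the elements of `Σ_n` in `K`. -/
def perpNeg {N : ℕ} (K : Submodule ℝ (L2 N)) (n : ℕ) : Submodule ℝ (Sd N n) where
  carrier := {U | ∀ w : Sg N n, fn w ∈ K → U w = 0}
  zero_mem' := by intro w _; simp
  add_mem' := by
    intro a b ha hb w hw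
    simp [ha w hw, hb w hw]
  smul_mem' := by
    intro c a ha w hw
    simp [ha w hw]

/-- The inclusion `Σ_s ∩ K^⊥ ⊆ Σ_{-n} ∩ K^⊥`. -/
def toPerpNeg {N s : ℕ} {K : Submodule ℝ (L2 N)} (n : ℕ) (R : perp K s) : perpNeg K n :=
  ⟨toSd n (fn R.1), fun w hw => by simpa [toSd] using R.2 (fn w) hw⟩

/-! ### The system and its domains -/

/-- The phase space `{(τ, Π, R)} = ℝ^{n₀} × ℝ^{n₀} × (Σ_s ∩ K^⊥)`. -/
abbrev Phase {N : ℕ} (n₀ : ℕ) (K : Submodule ℝ (L2 N)) (s : ℕ) : Type :=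
  Rn n₀ × Rn n₀ × perp K s

/-- Points of two phase spaces `(τ, Π, R)` with the same `τ`, `Π` and the same function `R`. -/
def SamePoint {N n₀ : ℕ} {K : Submodule ℝ (L2 N)} {s s' : ℕ}
    (z : Phase n₀ K s) (z' : Phase n₀ K s') : Prop :=
  z.1 = z'.1 ∧ z.2.1 = z'.2.1 ∧ fn z.2.2.1 = fn z'.2.2.1

/-- `𝒰^s_{ε,k}`: the points `(τ, Π, R)` of regularity `s` with `Π = p₀` and
`‖R‖_{Σ_{-k}} + |Π(R)| ≤ ε`. -/
def domU {N n₀ : ℕ} (Dia : Fin n₀ → (L2 N →ₗ.[ℝ] L2 N)) (K : Submodule ℝ (L2 N)) (p₀ : Rn n₀)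
    (s k : ℕ) (ε : ℝ) : Set (Phase n₀ K s) :=
  {z | z.2.1 = p₀ ∧ ‖toSd k (fn z.2.2.1)‖ + ‖momentum Dia (fn z.2.2.1)‖ ≤ ε}

/-- The field `∑_j 𝒜_j J◇_jR + 𝒟` at time `t`, the arguments of `𝒜` and `𝒟` being
`(t, Π, Π(R), R)`. -/
def fieldR {N n₀ s r : ℕ} {K : Submodule ℝ (L2 N)}
    (J : Matrix (Fin (2 * N)) (Fin (2 * N)) ℝ) (Dia : Fin n₀ → (L2 N →ₗ.[ℝ] L2 N))
    (A : ℝ → Rn n₀ → Rn n₀ → perpNeg K r → Rn n₀)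
    (D : ℝ → Rn n₀ → Rn n₀ → perpNeg K r → Sg N r)
    (t : ℝ) (P : Rn n₀) (R : perp K s) : L2 N :=
  ∑ j, A t P (momentum Dia (fn R.1)) (toPerpNeg r R) j • matOp J (app (Dia j) (fn R.1))
    + fn (D t P (momentum Dia (fn R.1)) (toPerpNeg r R))

/-- A solution on `[-2, 2]` of the system `τ̇ = T`, `Π̇ = 0`, `Ṙ = ∑_j 𝒜_j J◇_jR + 𝒟` with initial
datum `z₀`, where `R` is continuous in `Σ_s` and differentiable in `L²`, and `(Π(R), R)` stays in
the set `U` where the coefficients are controlled. -/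
structure IsSolution {N n₀ s r : ℕ} {K : Submodule ℝ (L2 N)}
    (J : Matrix (Fin (2 * N)) (Fin (2 * N)) ℝ) (Dia : Fin n₀ → (L2 N →ₗ.[ℝ] L2 N))
    (T A : ℝ → Rn n₀ → Rn n₀ → perpNeg K r → Rn n₀)
    (D : ℝ → Rn n₀ → Rn n₀ → perpNeg K r → Sg N r)
    (U : Set (Rn n₀ × perpNeg K r))
    (z₀ : Phase n₀ K s) (z : ℝ → Phase n₀ K s) : Prop where
  init : z 0 = z₀
  mem : ∀ t ∈ Icc (-2 : ℝ) 2, (momentum Dia (fn (z t).2.2.1), toPerpNeg r (z t).2.2) ∈ U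
  cont : ContinuousOn z (Icc (-2) 2)
  deriv_tau : ∀ t ∈ Icc (-2 : ℝ) 2, HasDerivWithinAt (fun t => (z t).1)
    (T t (z t).2.1 (momentum Dia (fn (z t).2.2.1)) (toPerpNeg r (z t).2.2)) (Icc (-2) 2) t
  deriv_Pi : ∀ t ∈ Icc (-2 : ℝ) 2, HasDerivWithinAt (fun t => (z t).2.1) 0 (Icc (-2) 2) t
  deriv_R : ∀ t ∈ Icc (-2 : ℝ) 2, HasDerivWithinAt (fun t => fn (z t).2.2.1)
    (fieldR J Dia A D t (z t).2.1 (z t).2.2) (Icc (-2) 2) t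

/-- The function `U = e^{Jτ·◇}(Φ_p + P(p)R)` with spectral coordinates `(τ, p, R)`, where
`P(p) = 1 - P_{N_g}(p)`. -/
def point {N n₀ s : ℕ} {K : Submodule ℝ (L2 N)} (J : Matrix (Fin (2 * N)) (Fin (2 * N)) ℝ)
    (Dia : Fin n₀ → (L2 N →ₗ.[ℝ] L2 N)) (G : Rn n₀ → (L2 N →L[ℝ] L2 N)) (Φ : Rn n₀ → L2 N)
    (τ p : Rn n₀) (R : perp K s) : L2 N :=
  G τ (Φ p + (fn R.1 - projNg J Dia Φ p (fn R.1)))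

/-- `u` is a function with coordinates `z = (τ, Π, R)`: `u = e^{Jτ·◇}(Φ_p + P(p)R)` for a `p ∈ O`,
and `Π(u) = Π`. -/
def HasCoords {N n₀ s : ℕ} {K : Submodule ℝ (L2 N)} (J : Matrix (Fin (2 * N)) (Fin (2 * N)) ℝ)
    (Dia : Fin n₀ → (L2 N →ₗ.[ℝ] L2 N)) (G : Rn n₀ → (L2 N →L[ℝ] L2 N)) (O : Set (Rn n₀))
    (Φ : Rn n₀ → L2 N) (u : L2 N) (z : Phase n₀ K s) : Prop :=
  (∃ p ∈ O, u = point J Dia G Φ z.1 p z.2.2) ∧ momentum Dia u = z.2.1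

end DarbouxFlow

end

open DarbouxFlow

/-!
The group `e^{Jq·◇}` is isometric in `L²` and commutes with `J`, with the `◇_j` and with itself.  In
the moving frame `R = e^{Jq·◇}(R₀ + S)` with `q' = 𝒜` the unbounded term `∑ 𝒜_j J◇_j R` therefore
disappears, and the system becomes
`τ' = T`, `q' = 𝒜`, `S' = e^{-Jq·◇} 𝒟`, with zero initial value.
The coefficients are evaluated at `(Π(R), R)`, which has to be read as a function of `(q, S)` and of
the datum `(Π(R₀), R₀)`, where `R₀` may be any element of `Σ_{-m}`, `m = r - (l + 1)d`.

Two facts make this possible (`DarbouxFlow.IsSymmetrySetup.exists_arguments`).  By invariance and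
bilinearity, `Π(R) = Π(R₀) + ⟨R₀, ◇S⟩ + Π(S)`, so that `Π(R)` is a smooth function of the
independent variable `ϱ = Π(R₀)` and of `R₀ ∈ Σ_{-m}`, `S ∈ Σ_{m+d}`.  And the group, acting on
`Σ_{-m}` by duality, is of class `C^l` into `Σ_{-r}`, since each derivative in `q` costs `d` orders
and the continuity in operator norm another `d` (`contDiff_gI_op`, `contDiff_gI_uncurry`).  As the
coefficients are only given on the orthogonal of `N_g(ℋ*_{p₀})`, the functional is first projected
there; the projection `P(p₀)` extends to `Σ_{-r}` because `Φ` takes values in the Schwartz space.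

The reduced system is then an ordinary differential equation in a Banach space with a `C^l` field
and parameters `(ϱ, R₀)`.  Its solution map `solMap` is `C^l` on an open set
(`contDiffOn_flowCurve`: the implicit equation `z - ∫ g(z) = z₀` in the space of curves has an
invertible linearization, `1` minus a Volterra operator).  At the datum `0` the solution is
`(∫ T(t, 0, 0) dt, 0, 0)` and exists on `(-3, 3)`; by openness and compactness the solutions for
small data exist on `[-2, 2]`, where Grönwall's inequality gives the bounds
(`exists_bounds_solMap`, `exists_reduced_flow`).

It remains to return to the original system.  For `R₀` in the orthogonal of `N_g(ℋ*_{p₀})` the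
component `P_{N_g}(p₀)R` satisfies a linear homogeneous equation in a finite-dimensional space, by
the tangency hypothesis, hence vanishes; so the projection is superfluous along the flow
(`solution_of_reduced`).  Conversely the moving frame turns any solution of the original system into
a solution of the reduced one, whence uniqueness (`reduced_of_solution`).  The decomposition of `S`
is `S = ∫ 𝒟 + ∫ (e^{-Jq·◇} - 1)𝒟`, where the second term gains the factor `|q|` at the cost of `d`
orders (`fn_eq_integral_add_integral`, `exists_norm_integral_gI_sub_le`), and the regularity of the
flow between the spaces `Σ_{s'}` and `Σ_s` is again that of `e^{Jq·◇}` (`contDiffOn_frameFlow`).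
-/


noncomputable section

namespace DarbouxFlow

open Filter

/-! ### Strong continuity and differentiability of families of operators -/

section Abstract

variable {H : Type*} [NormedAddCommGroup H] [InnerProductSpace ℝ H] [CompleteSpace H]

/-- The weak integral `∫_0^ε T_s x ds` of a weakly continuous locally bounded family, provided by
the Riesz representation. -/
lemma exists_weak_integral (T : ℝ → H →L[ℝ] H) {C : ℝ} (hC : ∀ t, |t| ≤ 1 → ‖T t‖ ≤ C)
    (hw : ∀ x y, Continuous fun t => ⟪T t x, y⟫_ℝ) (x : H) {ε : ℝ} (h0 : 0 ≤ ε) (h1 : ε ≤ 1) :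
    ∃ X : H, ∀ y, ⟪X, y⟫_ℝ = ∫ s in (0 : ℝ)..ε, ⟪T s x, y⟫_ℝ := by
  let L : H →ₗ[ℝ] ℝ :=
    { toFun := fun y => ∫ s in (0 : ℝ)..ε, ⟪T s x, y⟫_ℝ
      map_add' := fun y z => by
        simp only [inner_add_right]
        exact intervalIntegral.integral_add ((hw x y).intervalIntegrable _ _)
          ((hw x z).intervalIntegrable _ _)
      map_smul' := fun c y => by
        simp only [inner_smul_right, RingHom.id_apply, smul_eq_mul]
        exact intervalIntegral.integral_const_mul _ _ }
  have hL : ∀ y, ‖L y‖ ≤ (C * ‖x‖) * ‖y‖ := by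
    intro y
    have : ‖L y‖ ≤ (C * ‖x‖ * ‖y‖) * |ε - 0| := by
      refine intervalIntegral.norm_integral_le_of_norm_le_const fun s hs => ?_
      rw [uIoc_of_le h0] at hs
      have hs1 : |s| ≤ 1 := by rw [abs_of_pos hs.1]; exact hs.2.trans h1
      refine (norm_inner_le_norm _ _).trans ?_
      gcongr
      exact (T s).le_of_opNorm_le (hC s hs1) x
    refine this.trans ?_
    have hC0 : 0 ≤ C := (norm_nonneg _).trans (hC 0 (by simp))
    rw [sub_zero, abs_of_nonneg h0]
    exact mul_le_of_le_one_right (by positivity) h1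
  refine ⟨(InnerProductSpace.toDual ℝ H).symm (L.mkContinuous _ hL), fun y => ?_⟩
  rw [InnerProductSpace.toDual_symm_apply]
  rfl

/-- A weakly continuous, locally bounded one-parameter group on a Hilbert space is strongly
continuous at `0`: the weak averages `∫_0^ε T_s x ds` are vectors of strong continuity, and the
orthogonal complement of these vectors is trivial. -/
lemma tendsto_group_zero (T : ℝ → H →L[ℝ] H) (h0 : T 0 = 1)
    (hadd : ∀ s t, T (s + t) = (T s).comp (T t)) {C : ℝ} (hC : ∀ t, |t| ≤ 1 → ‖T t‖ ≤ C)
    (hw : ∀ x y, Continuous fun t => ⟪T t x, y⟫_ℝ) (x : H) :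
    Tendsto (fun t => T t x) (𝓝 0) (𝓝 x) := by
  have hC0 : 0 ≤ C := (norm_nonneg _).trans (hC 0 (by simp))
  have hnear : ∀ᶠ t : ℝ in 𝓝 0, |t| ≤ 1 / 2 := by
    have : Tendsto (fun t : ℝ => |t|) (𝓝 0) (𝓝 |0|) := continuous_abs.tendsto 0
    rw [abs_zero] at this
    exact this.eventually (eventually_le_nhds (by norm_num))
  let E : Submodule ℝ H :=
    { carrier := {x | Tendsto (fun t => T t x) (𝓝 0) (𝓝 x)}
      zero_mem' := by simp
      add_mem' := fun {a b} ha hb => by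
        simp only [mem_ofPred_eq, map_add] at *
        exact ha.add hb
      smul_mem' := fun c a ha => by
        simp only [mem_ofPred_eq, map_smul] at *
        exact ha.const_smul c }
  have hEcl : IsClosed (E : Set H) := by
    refine isClosed_of_closure_subset fun y hy => ?_
    change Tendsto (fun t => T t y) (𝓝 0) (𝓝 y)
    rw [Metric.tendsto_nhds]
    intro ε hε
    obtain ⟨z, hz, hyz⟩ := Metric.mem_closure_iff.1 hy (ε / (C + 2)) (by positivity)
    have hz' := (Metric.tendsto_nhds.1 (show Tendsto (fun t => T t z) (𝓝 0) (𝓝 z) from hz))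
      (ε / (C + 2)) (by positivity)
    filter_upwards [hz', hnear] with t ht ht1
    have h1 : dist (T t y) (T t z) ≤ C * dist y z := by
      rw [dist_eq_norm, dist_eq_norm, ← map_sub]
      exact (T t).le_of_opNorm_le (hC t (ht1.trans (by norm_num))) _
    calc dist (T t y) y ≤ dist (T t y) (T t z) + dist (T t z) z + dist z y :=
          dist_triangle4 _ _ _ _
      _ < C * (ε / (C + 2)) + ε / (C + 2) + ε / (C + 2) := by
          rw [dist_comm z y]
          have : C * dist y z ≤ C * (ε / (C + 2)) := by gcongr
          linarith
      _ = ε := by field_simp; ring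
  have hav : ∀ ε : ℝ, 0 ≤ ε → ε ≤ 1 / 2 → ∀ X : H,
      (∀ y, ⟪X, y⟫_ℝ = ∫ s in (0 : ℝ)..ε, ⟪T s x, y⟫_ℝ) → X ∈ E := by
    intro ε hε hε1 X hX
    change Tendsto (fun t => T t X) (𝓝 0) (𝓝 X)
    have key : ∀ h : ℝ, |h| ≤ 1 / 2 → ‖T h X - X‖ ≤ 2 * (C * ‖x‖) * |h| := by
      intro h hh
      have hin : ∀ y, ⟪T h X - X, y⟫_ℝ ≤ (2 * (C * ‖x‖) * |h|) * ‖y‖ := by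
        intro y
        have e1 : ⟪T h X, y⟫_ℝ = ∫ s in h..(ε + h), ⟪T s x, y⟫_ℝ := by
          rw [← ContinuousLinearMap.adjoint_inner_right, hX]
          have : ∀ s, ⟪T s x, ContinuousLinearMap.adjoint (T h) y⟫_ℝ = ⟪T (s + h) x, y⟫_ℝ := by
            intro s
            rw [ContinuousLinearMap.adjoint_inner_right, add_comm s h, hadd]
            rfl
          simp only [this]
          rw [intervalIntegral.integral_comp_add_right (fun s => ⟪T s x, y⟫_ℝ) h, zero_add]
        have hint : ∀ a b, IntervalIntegrable (fun s => ⟪T s x, y⟫_ℝ) volume a b :=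
          fun a b => (hw x y).intervalIntegrable a b
        have e2 : ⟪T h X - X, y⟫_ℝ
            = (∫ s in ε..(ε + h), ⟪T s x, y⟫_ℝ) - ∫ s in (0 : ℝ)..h, ⟪T s x, y⟫_ℝ := by
          rw [inner_sub_left, e1, hX,
            intervalIntegral.integral_interval_sub_interval_comm (hint _ _) (hint _ _) (hint _ _),
            intervalIntegral.integral_symm 0 h, intervalIntegral.integral_symm ε (ε + h)]
          ring
        have hb : ∀ a : ℝ, |a| ≤ 1 / 2 →
            ‖∫ s in a..(a + h), ⟪T s x, y⟫_ℝ‖ ≤ (C * ‖x‖ * ‖y‖) * |h| := by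
          intro a ha
          have := intervalIntegral.norm_integral_le_of_norm_le_const
            (f := fun s => ⟪T s x, y⟫_ℝ) (a := a) (b := a + h) (C := C * ‖x‖ * ‖y‖) ?_
          · simpa using this
          intro s hs
          have hs1 : |s| ≤ 1 := by
            have h3 := uIoc_subset_uIcc hs
            rw [mem_uIcc] at h3
            rw [abs_le] at *
            constructor <;> rcases h3 with h3 | h3 <;> linarith [h3.1, h3.2]
          refine (norm_inner_le_norm _ _).trans ?_
          gcongr
          exact (T s).le_of_opNorm_le (hC s hs1) x
        have b1 := hb ε (by rwa [abs_of_nonneg hε])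
        have b2 := hb 0 (by norm_num)
        rw [zero_add] at b2
        rw [Real.norm_eq_abs] at b1 b2
        rw [e2]
        have := abs_le.1 b1
        have := abs_le.1 b2
        nlinarith
      have := hin (T h X - X)
      rw [real_inner_self_eq_norm_mul_norm] at this
      by_contra! hlt
      have hpos : 0 < ‖T h X - X‖ := lt_of_le_of_lt (by positivity) hlt
      nlinarith
    have hlim : Tendsto (fun h : ℝ => 2 * (C * ‖x‖) * |h|) (𝓝 0) (𝓝 0) := by
      have : Continuous fun h : ℝ => 2 * (C * ‖x‖) * |h| := by fun_prop
      simpa using this.tendsto 0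
    rw [tendsto_iff_norm_sub_tendsto_zero]
    refine squeeze_zero' (Eventually.of_forall fun _ => norm_nonneg _) ?_ hlim
    filter_upwards [hnear] with h hh using key h hh
  have horth : ∀ z ∈ Eᗮ, ⟪x, z⟫_ℝ = 0 := by
    intro z hz
    have hder : HasDerivAt (fun ε => ∫ s in (0 : ℝ)..ε, ⟪T s x, z⟫_ℝ) ⟪T 0 x, z⟫_ℝ 0 :=
      intervalIntegral.integral_hasDerivAt_right ((hw x z).intervalIntegrable _ _)
        ((hw x z).stronglyMeasurableAtFilter _ _) (hw x z).continuousAt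
    have hzero : ∀ ε ∈ Icc (0 : ℝ) (1 / 2), (∫ s in (0 : ℝ)..ε, ⟪T s x, z⟫_ℝ) = 0 := by
      intro ε hε
      obtain ⟨X, hX⟩ := exists_weak_integral T hC hw x hε.1 (hε.2.trans (by norm_num))
      rw [← hX]
      exact (Submodule.mem_orthogonal _ _).1 hz X (hav ε hε.1 hε.2 X hX)
    have h2 : HasDerivWithinAt (fun ε => ∫ s in (0 : ℝ)..ε, ⟪T s x, z⟫_ℝ) 0
        (Icc (0 : ℝ) (1 / 2)) 0 :=
      (hasDerivWithinAt_const (0 : ℝ) (Icc (0 : ℝ) (1 / 2)) (0 : ℝ)).congr hzero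
        (hzero 0 (by norm_num))
    have hu : UniqueDiffWithinAt ℝ (Icc (0 : ℝ) (1 / 2)) 0 :=
      uniqueDiffOn_Icc (by norm_num) 0 (by norm_num)
    have := hu.eq_deriv _ hder.hasDerivWithinAt h2
    rwa [h0] at this
  have : CompleteSpace E := hEcl.completeSpace_coe
  have : x ∈ Eᗮᗮ := (Submodule.mem_orthogonal' _ _).2 horth
  rw [Submodule.orthogonal_orthogonal] at this
  exact this

end Abstract

section Calculus

variable {E F G' : Type*} [NormedAddCommGroup E] [NormedSpace ℝ E]
  [NormedAddCommGroup F] [NormedSpace ℝ F] [NormedAddCommGroup G'] [NormedSpace ℝ G']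

/-- A map whose derivatives along all lines are given by a continuous family of linear maps is
Fréchet differentiable. -/
lemma hasFDerivAt_of_hasDerivAt_lines {f : E → F} {f' : E → E →L[ℝ] F} (hf' : Continuous f')
    (hline : ∀ q h, ∀ t : ℝ, HasDerivAt (fun t : ℝ => f (q + t • h)) (f' (q + t • h) h) t)
    (q : E) : HasFDerivAt f (f' q) q := by
  rw [hasFDerivAt_iff_isLittleO, Asymptotics.isLittleO_iff]
  intro c hc
  obtain ⟨δ, hδ, hball⟩ := Metric.continuousAt_iff.1 hf'.continuousAt c hc
  filter_upwards [Metric.ball_mem_nhds q hδ] with y hy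
  have hder : ∀ t ∈ Icc (0 : ℝ) 1, HasDerivWithinAt
      (fun t : ℝ => f (q + t • (y - q)) - t • f' q (y - q))
      (f' (q + t • (y - q)) (y - q) - f' q (y - q)) (Icc 0 1) t := by
    intro t _
    have h1 := hline q (y - q) t
    have h2 : HasDerivAt (fun t : ℝ => t • f' q (y - q)) ((1 : ℝ) • f' q (y - q)) t :=
      (hasDerivAt_id t).smul_const _
    rw [one_smul] at h2
    exact (h1.sub h2).hasDerivWithinAt
  have hbd : ∀ t ∈ Ico (0 : ℝ) 1,
      ‖f' (q + t • (y - q)) (y - q) - f' q (y - q)‖ ≤ c * ‖y - q‖ := by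
    intro t ht
    have hmem : dist (q + t • (y - q)) q < δ := by
      rw [dist_eq_norm, add_sub_cancel_left, norm_smul, Real.norm_eq_abs, abs_of_nonneg ht.1]
      have : ‖y - q‖ < δ := by simpa [dist_eq_norm] using hy
      have h1 := norm_nonneg (y - q)
      nlinarith [ht.2]
    rw [← sub_apply]
    refine ContinuousLinearMap.le_of_opNorm_le _ ?_ _
    have := hball hmem
    rw [dist_eq_norm] at this
    exact this.le
  have := norm_image_sub_le_of_norm_deriv_le_segment' hder hbd 1 (right_mem_Icc.2 zero_le_one)
  simpa [sub_sub, add_comm] using this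

/-- Differentiability in operator norm from pointwise differentiability, when the candidate for
the derivative is continuous in operator norm. -/
lemma hasFDerivAt_clm_of_pointwise {A : E → F →L[ℝ] G'} {A' : E → E →L[ℝ] F →L[ℝ] G'}
    (hA' : Continuous A')
    (hpt : ∀ x q, HasFDerivAt (fun q => A q x) ((A' q).flip x) q) (q : E) :
    HasFDerivAt A (A' q) q := by
  rw [hasFDerivAt_iff_isLittleO, Asymptotics.isLittleO_iff]
  intro c hc
  have hlim : Tendsto (fun z => ‖A' z - A' q‖) (𝓝 q) (𝓝 0) := by
    have h0 : Continuous fun z => ‖A' z - A' q‖ :=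
      Continuous.norm (E := E →L[ℝ] F →L[ℝ] G') (hA'.sub continuous_const)
    have h1 : ‖A' q - A' q‖ = 0 := by
      rw [sub_self]
      exact norm_zero (E := E →L[ℝ] F →L[ℝ] G')
    have h2 := h0.tendsto q
    rwa [h1] at h2
  obtain ⟨δ, hδ, hball⟩ := Metric.eventually_nhds_iff.1 (hlim.eventually_lt_const hc)
  filter_upwards [Metric.ball_mem_nhds q hδ] with y hy
  refine ContinuousLinearMap.opNorm_le_bound _ (by positivity) fun x => ?_
  have hder : ∀ z ∈ Metric.ball q δ, HasFDerivWithinAt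
      (fun z => A z x - (A' q).flip x z) ((A' z).flip x - (A' q).flip x) (Metric.ball q δ) z :=
    fun z _ => ((hpt x z).sub ((A' q).flip x).hasFDerivAt).hasFDerivWithinAt
  have hbd : ∀ z ∈ Metric.ball q δ, ‖(A' z).flip x - (A' q).flip x‖ ≤ c * ‖x‖ := by
    intro z hz
    refine ContinuousLinearMap.opNorm_le_bound _ (by positivity) fun h => ?_
    have h1 : ‖A' z - A' q‖ ≤ c := (hball hz).le
    have : ((A' z).flip x - (A' q).flip x) h = (A' z - A' q) h x := by simp
    rw [this]
    calc ‖(A' z - A' q) h x‖ ≤ ‖(A' z - A' q) h‖ * ‖x‖ := ContinuousLinearMap.le_opNorm _ _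
      _ ≤ (c * ‖h‖) * ‖x‖ := by
          gcongr
          exact ContinuousLinearMap.le_of_opNorm_le _ h1 _
      _ = c * ‖x‖ * ‖h‖ := by ring
  have := (convex_ball q δ).norm_image_sub_le_of_norm_hasFDerivWithin_le hder hbd
    (Metric.mem_ball_self hδ) hy
  have e : (A y - A q - A' q (y - q)) x
      = A y x - (A' q).flip x y - (A q x - (A' q).flip x q) := by
    simp only [sub_apply, ContinuousLinearMap.flip_apply, map_sub]
    abel
  rw [e]
  linarith

/-- The derivative of `(q, x) ↦ A q x` when `A` is only continuous in operator norm, but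
differentiable at the base vector. -/
lemma hasFDerivAt_apply_of_continuousAt {A : E → F →L[ℝ] G'} {q : E} {x : F}
    {a : E →L[ℝ] G'} (hA : ContinuousAt A q) (hx : HasFDerivAt (fun q => A q x) a q) :
    HasFDerivAt (fun z : E × F => A z.1 z.2)
      (a.comp (ContinuousLinearMap.fst ℝ E F) + (A q).comp (ContinuousLinearMap.snd ℝ E F))
      (q, x) := by
  have h1 : HasFDerivAt (fun z : E × F => A z.1 x) (a.comp (ContinuousLinearMap.fst ℝ E F))
      (q, x) := HasFDerivAt.comp (g := fun q => A q x) (q, x) hx hasFDerivAt_fst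
  have h2 : HasFDerivAt (fun z : E × F => A z.1 (z.2 - x))
      ((A q).comp (ContinuousLinearMap.snd ℝ E F)) (q, x) := by
    rw [hasFDerivAt_iff_isLittleO, Asymptotics.isLittleO_iff]
    intro c hc
    have hA2 : ContinuousAt (fun z : E × F => A z.1) (q, x) :=
      ContinuousAt.comp (g := A) (f := fun z : E × F => z.1) hA continuousAt_fst
    obtain ⟨δ, hδ, hball⟩ := Metric.continuousAt_iff.1 hA2 c hc
    filter_upwards [Metric.ball_mem_nhds (q, x) hδ] with z hz
    have h3 := (hball hz).le
    rw [dist_eq_norm] at h3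
    have : A z.1 (z.2 - x) - A (q, x).1 ((q, x).2 - x)
        - ((A q).comp (ContinuousLinearMap.snd ℝ E F)) (z - (q, x))
        = (A z.1 - A q) (z.2 - x) := by simp
    rw [this]
    refine (ContinuousLinearMap.le_of_opNorm_le _ h3 _).trans ?_
    gcongr
    exact norm_snd_le (z - (q, x))
  refine (h1.add h2).congr_of_eventuallyEq (Eventually.of_forall fun z => ?_)
  simp

end Calculus

set_option linter.unusedSectionVars false

/-! ### Superposition operators on spaces of curves -/

section Nemytskii

open unitInterval

universe u

variable {Z F : Type u} [NormedAddCommGroup Z] [NormedSpace ℝ Z]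
  [NormedAddCommGroup F] [NormedSpace ℝ F]

/-- The curves `[0, 1] → Z` with values in `Ω`. -/
def curvesIn (Ω : Set Z) : Set C(I, Z) := {z | ∀ s, z s ∈ Ω}

lemma isOpen_curvesIn {Ω : Set Z} (hΩ : IsOpen Ω) : IsOpen (curvesIn Ω) := by
  have := ContinuousMap.isOpen_setOfPred_mapsTo (X := I) (Y := Z) isCompact_univ hΩ
  simpa [curvesIn, MapsTo] using this

open Classical in
/-- The superposition operator `z ↦ g ∘ z` (zero where `g ∘ z` is not continuous). -/
def superpose (g : Z → F) (z : C(I, Z)) : C(I, F) :=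
  if h : Continuous fun s => g (z s) then ⟨fun s => g (z s), h⟩ else 0

lemma superpose_apply {g : Z → F} {Ω : Set Z} (hg : ContinuousOn g Ω) {z : C(I, Z)}
    (hz : z ∈ curvesIn Ω) (s : I) : superpose g z s = g (z s) := by
  have h : Continuous fun s => g (z s) := hg.comp_continuous z.continuous hz
  simp [superpose, h]

lemma continuousOn_superpose {g : Z → F} {Ω : Set Z} (hΩ : IsOpen Ω) (hg : ContinuousOn g Ω) :
    ContinuousOn (superpose g) (curvesIn Ω) := by
  intro z hz
  refine ContinuousAt.continuousWithinAt ?_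
  rw [ContinuousAt, Metric.tendsto_nhds]
  intro ε hε
  have hK : IsCompact (range z) := isCompact_range z.continuous
  have hU := hK.uniformContinuousAt_of_continuousAt g
    (fun a ha => by
      obtain ⟨s, rfl⟩ := ha
      exact hg.continuousAt (hΩ.mem_nhds (hz s)))
    (Metric.dist_mem_uniformity (half_pos hε))
  obtain ⟨δ, hδ, hsub⟩ := Metric.mem_uniformity_dist.1 hU
  filter_upwards [Metric.ball_mem_nhds z hδ, (isOpen_curvesIn hΩ).mem_nhds hz] with w hw hwΩ
  refine lt_of_le_of_lt ?_ (half_lt_self hε)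
  rw [ContinuousMap.dist_le (half_pos hε).le]
  intro s
  rw [superpose_apply hg hz, superpose_apply hg hwΩ, dist_comm]
  have h1 : dist (z s) (w s) < δ := by
    rw [dist_comm]
    exact (ContinuousMap.dist_apply_le_dist s).trans_lt hw
  exact (hsub h1 (mem_range_self s)).le

/-- The pointwise application of a curve of operators to a curve of vectors. -/
def curveApply : C(I, Z →L[ℝ] F) →L[ℝ] C(I, Z) →L[ℝ] C(I, F) :=
  LinearMap.mkContinuous₂
    (LinearMap.mk₂ ℝ (fun (A : C(I, Z →L[ℝ] F)) (z : C(I, Z)) =>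
        (⟨fun s => A s (z s), by fun_prop⟩ : C(I, F)))
      (fun _ _ _ => by ext; simp) (fun _ _ _ => by ext; simp)
      (fun _ _ _ => by ext; simp) (fun _ _ _ => by ext; simp)) 1
    (fun A z => by
      rw [ContinuousMap.norm_le _ (by positivity)]
      intro s
      rw [one_mul]
      calc ‖A s (z s)‖ ≤ ‖A s‖ * ‖z s‖ := (A s).le_opNorm _
        _ ≤ ‖A‖ * ‖z‖ := by
          gcongr
          · exact A.norm_coe_le_norm s
          · exact z.norm_coe_le_norm s)

@[simp] lemma curveApply_apply (A : C(I, Z →L[ℝ] F)) (z : C(I, Z)) (s : I) :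
    curveApply A z s = A s (z s) := rfl

lemma hasFDerivAt_superpose {g : Z → F} {Ω : Set Z} (hΩ : IsOpen Ω)
    (hg : DifferentiableOn ℝ g Ω) (hg' : ContinuousOn (fderiv ℝ g) Ω) {z : C(I, Z)}
    (hz : z ∈ curvesIn Ω) :
    HasFDerivAt (superpose g) (curveApply (superpose (fderiv ℝ g) z)) z := by
  rw [hasFDerivAt_iff_isLittleO, Asymptotics.isLittleO_iff]
  intro c hc
  have hcont := (continuousOn_superpose hΩ hg').continuousAt ((isOpen_curvesIn hΩ).mem_nhds hz)
  obtain ⟨δ, hδ, hball⟩ := Metric.continuousAt_iff.1 hcont c hc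
  obtain ⟨δ', hδ', hΩball⟩ := Metric.isOpen_iff.1 (isOpen_curvesIn hΩ) z hz
  filter_upwards [Metric.ball_mem_nhds z (lt_min hδ hδ')] with w hw
  rw [Metric.mem_ball, lt_min_iff] at hw
  rw [ContinuousMap.norm_le _ (by positivity)]
  intro s
  have hwΩ : w ∈ curvesIn Ω := hΩball hw.2
  -- the mean value inequality on the segment from `z s` to `w s`, each point of which is the
  -- value at `s` of a curve of `Ω` close to `z`
  have hseg : ∀ x ∈ segment ℝ (z s) (w s), ∃ v : C(I, Z), v ∈ curvesIn Ω ∧ dist v z < δ ∧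
      v s = x := by
    intro x hx
    rw [segment_eq_image'] at hx
    obtain ⟨θ, hθ, rfl⟩ := hx
    have hd : dist (z + θ • (w - z)) z ≤ dist w z := by
      rw [dist_eq_norm, add_sub_cancel_left, norm_smul, Real.norm_eq_abs, abs_of_nonneg hθ.1,
        dist_eq_norm]
      exact mul_le_of_le_one_left (norm_nonneg _) hθ.2
    exact ⟨z + θ • (w - z), hΩball (hd.trans_lt hw.2), hd.trans_lt hw.1, by simp⟩
  have hmv := (convex_segment (𝕜 := ℝ) (z s) (w s)).norm_image_sub_le_of_norm_hasFDerivWithin_le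
    (f := fun x => g x - fderiv ℝ g (z s) x) (f' := fun x => fderiv ℝ g x - fderiv ℝ g (z s))
    (C := c) (x := z s) (y := w s) ?_ ?_ (left_mem_segment _ _ _) (right_mem_segment _ _ _)
  · simp only [ContinuousMap.sub_apply, curveApply_apply]
    rw [superpose_apply hg.continuousOn hwΩ, superpose_apply hg.continuousOn hz,
      superpose_apply hg' hz]
    have h1 : ‖w s - z s‖ ≤ ‖w - z‖ := (w - z).norm_coe_le_norm s
    have e : g (w s) - g (z s) - fderiv ℝ g (z s) (w s - z s)
        = g (w s) - fderiv ℝ g (z s) (w s) - (g (z s) - fderiv ℝ g (z s) (z s)) := by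
      rw [map_sub]; abel
    rw [e]
    exact hmv.trans (by gcongr)
  · intro x hx
    obtain ⟨v, hv, -, rfl⟩ := hseg x hx
    exact (((hg _ (hv s)).differentiableAt (hΩ.mem_nhds (hv s))).hasFDerivAt.sub
      (fderiv ℝ g (z s)).hasFDerivAt).hasFDerivWithinAt
  · intro x hx
    obtain ⟨v, hv, hvδ, rfl⟩ := hseg x hx
    have h1 := (ContinuousMap.dist_apply_le_dist (f := superpose (fderiv ℝ g) v)
      (g := superpose (fderiv ℝ g) z) s).trans (hball hvδ).le
    rwa [superpose_apply hg' hv, superpose_apply hg' hz, dist_eq_norm] at h1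

/-- The superposition operator of a `C^k` map is `C^k`. -/
lemma contDiffOn_superpose (k : ℕ) : ∀ {F : Type u} [NormedAddCommGroup F] [NormedSpace ℝ F]
    {g : Z → F} {Ω : Set Z}, IsOpen Ω → ContDiffOn ℝ k g Ω →
    ContDiffOn ℝ k (superpose g) (curvesIn Ω) := by
  induction k with
  | zero =>
    intro F _ _ g Ω hΩ hg
    rw [Nat.cast_zero, contDiffOn_zero] at *
    exact continuousOn_superpose hΩ hg
  | succ k ih =>
    intro F _ _ g Ω hΩ hg
    rw [Nat.cast_add, Nat.cast_one] at *
    rw [contDiffOn_succ_iff_fderiv_of_isOpen hΩ] at hg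
    rw [contDiffOn_succ_iff_fderiv_of_isOpen (isOpen_curvesIn hΩ)]
    have hd : ∀ z ∈ curvesIn Ω,
        HasFDerivAt (superpose g) (curveApply (superpose (fderiv ℝ g) z)) z :=
      fun z hz => hasFDerivAt_superpose hΩ hg.1 hg.2.2.continuousOn hz
    refine ⟨fun z hz => (hd z hz).differentiableAt.differentiableWithinAt, fun h => ?_, ?_⟩
    · exact absurd h (by simp)
    · refine ContDiffOn.congr ?_ (fun z hz => (hd z hz).fderiv)
      exact (ContinuousLinearMap.contDiff (E := C(I, Z →L[ℝ] F))
        (F := C(I, Z) →L[ℝ] C(I, F)) curveApply).comp_contDiffOn (ih hΩ hg.2.2)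

end Nemytskii

/-! ### Volterra operators -/

section Volterra

open unitInterval

universe u

variable {F : Type u} [NormedAddCommGroup F] [NormedSpace ℝ F]

/-- A curve on `[0, 1]`, extended to `ℝ` by constants. -/
def extendCurve (y : C(I, F)) (s : ℝ) : F := y (projIcc 0 1 zero_le_one s)

lemma continuous_extendCurve (y : C(I, F)) : Continuous (extendCurve y) :=
  y.continuous.comp continuous_projIcc

lemma extendCurve_of_mem (y : C(I, F)) {s : ℝ} (hs : s ∈ Icc (0 : ℝ) 1) :
    extendCurve y s = y ⟨s, hs⟩ := by
  rw [extendCurve, projIcc_of_mem _ hs]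

lemma norm_extendCurve_le (y : C(I, F)) (s : ℝ) : ‖extendCurve y s‖ ≤ ‖y‖ :=
  y.norm_coe_le_norm _

/-- The operator `y ↦ (s ↦ ∫_0^s y)`. -/
def primitive [CompleteSpace F] : C(I, F) →L[ℝ] C(I, F) :=
  LinearMap.mkContinuous
    { toFun := fun y => ⟨fun s => ∫ v in (0 : ℝ)..s, extendCurve y v,
        (intervalIntegral.continuous_primitive
          (fun a b => (continuous_extendCurve y).intervalIntegrable a b) 0).comp
          continuous_subtype_val⟩
      map_add' := fun y z => by
        ext s
        exact intervalIntegral.integral_add ((continuous_extendCurve y).intervalIntegrable _ _)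
          ((continuous_extendCurve z).intervalIntegrable _ _)
      map_smul' := fun c y => by
        ext s
        exact intervalIntegral.integral_smul c _ } 1
    (fun y => by
      rw [ContinuousMap.norm_le _ (by positivity)]
      intro s
      have := intervalIntegral.norm_integral_le_of_norm_le_const (a := 0) (b := (s : ℝ))
        (f := extendCurve y) (C := ‖y‖) (fun v _ => norm_extendCurve_le y v)
      refine this.trans ?_
      rw [sub_zero, abs_of_nonneg s.2.1, one_mul]
      exact mul_le_of_le_one_right (norm_nonneg _) s.2.2)

lemma primitive_apply [CompleteSpace F] (y : C(I, F)) (s : I) :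
    primitive y s = ∫ v in (0 : ℝ)..s, extendCurve y v := rfl

/-- `1 - K` is invertible for a Volterra operator `K y (s) = ∫_0^s L y`, since
`‖K^n‖ ≤ ‖L‖^n / n!`. -/
lemma isUnit_one_sub_volterra [CompleteSpace F] (L : C(I, F →L[ℝ] F)) :
    IsUnit (1 - primitive.comp (curveApply L) : C(I, F) →L[ℝ] C(I, F)) := by
  set K : C(I, F) →L[ℝ] C(I, F) := primitive.comp (curveApply L) with hK
  have hpow : ∀ (n : ℕ) (y : C(I, F)) (s : I),
      ‖(K ^ n) y s‖ ≤ ‖L‖ ^ n * ‖y‖ * ((s : ℝ) ^ n / n.factorial) := by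
    intro n
    induction n with
    | zero => intro y s; simpa using y.norm_coe_le_norm s
    | succ n ih =>
      intro y s
      have e : (K ^ (n + 1)) y s
          = ∫ v in (0 : ℝ)..s, extendCurve (curveApply L ((K ^ n) y)) v := by
        rw [pow_succ', mul_apply_eq_comp]
        rfl
      rw [e]
      have hb : ∀ v ∈ Ioc (0 : ℝ) s, ‖extendCurve (curveApply L ((K ^ n) y)) v‖
          ≤ ‖L‖ ^ (n + 1) * ‖y‖ * (v ^ n / n.factorial) := by
        intro v hv
        have hv1 : v ∈ Icc (0 : ℝ) 1 := ⟨hv.1.le, hv.2.trans s.2.2⟩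
        rw [extendCurve_of_mem _ hv1, curveApply_apply]
        refine (ContinuousLinearMap.le_opNorm _ _).trans ?_
        calc ‖L ⟨v, hv1⟩‖ * ‖(K ^ n) y ⟨v, hv1⟩‖
            ≤ ‖L‖ * (‖L‖ ^ n * ‖y‖ * (v ^ n / n.factorial)) := by
              gcongr
              · exact L.norm_coe_le_norm _
              · exact ih y ⟨v, hv1⟩
          _ = _ := by ring
      refine (intervalIntegral.norm_integral_le_of_norm_le s.2.1
        (Eventually.of_forall hb) (Continuous.intervalIntegrable (by fun_prop) _ _)).trans ?_
      rw [intervalIntegral.integral_const_mul, intervalIntegral.integral_div, integral_pow]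
      rw [Nat.factorial_succ]
      push_cast
      rw [zero_pow (Nat.succ_ne_zero n), sub_zero, div_div]
  have hnorm : ∀ n : ℕ, ‖K ^ n‖ ≤ ‖L‖ ^ n / n.factorial := by
    intro n
    refine ContinuousLinearMap.opNorm_le_bound _ (by positivity) fun y => ?_
    rw [ContinuousMap.norm_le _ (by positivity)]
    intro s
    refine (hpow n y s).trans ?_
    have : (s : ℝ) ^ n ≤ 1 := pow_le_one₀ s.2.1 s.2.2
    calc ‖L‖ ^ n * ‖y‖ * ((s : ℝ) ^ n / n.factorial) ≤ ‖L‖ ^ n * ‖y‖ * (1 / n.factorial) := by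
          gcongr
      _ = _ := by ring
  obtain ⟨n, hn⟩ := ((FloorSemiring.tendsto_pow_div_factorial_atTop ‖L‖).eventually_lt_const
    one_pos).exists
  have hu : IsUnit (1 - K ^ n) :=
    isUnit_one_sub_of_norm_lt_one (R := C(I, F) →L[ℝ] C(I, F)) ((hnorm n).trans_lt hn)
  have hcomm : Commute (1 - K) (∑ i ∈ Finset.range n, K ^ i) := by
    refine Commute.sum_right _ _ _ fun i _ => ?_
    exact (Commute.one_left _).sub_left (Commute.self_pow K i)
  rw [← mul_neg_geom_sum] at hu
  exact (hcomm.isUnit_mul_iff.1 hu).1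

end Volterra

/-! ### Smooth dependence of solutions of differential equations on data and parameters -/

section Flow

open unitInterval

universe u

variable {Z : Type u} [NormedAddCommGroup Z] [NormedSpace ℝ Z] [CompleteSpace Z]

/-- `z` is the solution on `[0, 1]` of `z' = g(z)`, `z(0) = z₀`, with values in `Ω`. -/
def IsFlowCurve (g : Z → Z) (Ω : Set Z) (z₀ : Z) (z : C(I, Z)) : Prop :=
  z ∈ curvesIn Ω ∧ z - primitive (superpose g z) = ContinuousMap.const I z₀

lemma extendCurve_superpose {g : Z → Z} {Ω : Set Z} (hg : ContinuousOn g Ω) {z : C(I, Z)}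
    (hz : z ∈ curvesIn Ω) (s : ℝ) :
    extendCurve (superpose g z) s = g (extendCurve z s) :=
  superpose_apply hg hz _

lemma IsFlowCurve.apply {g : Z → Z} {Ω : Set Z} (hg : ContinuousOn g Ω) {z₀ : Z} {z : C(I, Z)}
    (hz : IsFlowCurve g Ω z₀ z) (s : I) :
    z s = z₀ + ∫ v in (0 : ℝ)..s, g (extendCurve z v) := by
  have h := congrArg (fun y : C(I, Z) => y s) hz.2
  simp only [ContinuousMap.sub_apply, primitive_apply, ContinuousMap.const_apply,
    extendCurve_superpose hg hz.1] at h
  exact sub_eq_iff_eq_add.1 h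

lemma IsFlowCurve.zero {g : Z → Z} {Ω : Set Z} (hg : ContinuousOn g Ω) {z₀ : Z} {z : C(I, Z)}
    (hz : IsFlowCurve g Ω z₀ z) : extendCurve z 0 = z₀ := by
  rw [extendCurve_of_mem z (left_mem_Icc.2 zero_le_one), hz.apply hg]
  simp

lemma IsFlowCurve.hasDerivWithinAt {g : Z → Z} {Ω : Set Z} (hg : ContinuousOn g Ω) {z₀ : Z}
    {z : C(I, Z)} (hz : IsFlowCurve g Ω z₀ z) {s : ℝ} (hs : s ∈ Icc (0 : ℝ) 1) :
    HasDerivWithinAt (extendCurve z) (g (extendCurve z s)) (Icc 0 1) s := by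
  have hc : Continuous fun v => g (extendCurve z v) :=
    hg.comp_continuous (continuous_extendCurve z) fun v => hz.1 _
  have h1 : HasDerivAt (fun s => z₀ + ∫ v in (0 : ℝ)..s, g (extendCurve z v))
      (g (extendCurve z s)) s :=
    (intervalIntegral.integral_hasDerivAt_right (hc.intervalIntegrable _ _)
      (hc.stronglyMeasurableAtFilter _ _) hc.continuousAt).const_add _
  refine h1.hasDerivWithinAt.congr (fun v hv => ?_) ?_
  · rw [extendCurve_of_mem z hv, hz.apply hg]
  · rw [extendCurve_of_mem z hs, hz.apply hg]

/-- A differentiable solution on `[0, 1]` is a flow curve. -/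
lemma exists_isFlowCurve {g : Z → Z} {Ω : Set Z} (hg : ContinuousOn g Ω) {y : ℝ → Z}
    (hΩ : ∀ s ∈ Icc (0 : ℝ) 1, y s ∈ Ω)
    (hy : ∀ s ∈ Icc (0 : ℝ) 1, HasDerivWithinAt y (g (y s)) (Icc 0 1) s) :
    ∃ z, IsFlowCurve g Ω (y 0) z ∧ ∀ s : I, z s = y s := by
  have hcont : ContinuousOn y (Icc 0 1) := fun s hs => (hy s hs).continuousWithinAt
  let z : C(I, Z) := ⟨fun s => y s, hcont.comp_continuous continuous_subtype_val fun s => s.2⟩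
  have hz : z ∈ curvesIn Ω := fun s => hΩ s s.2
  refine ⟨z, ⟨hz, ?_⟩, fun s => rfl⟩
  ext s
  have hc : Continuous fun v => g (extendCurve z v) :=
    hg.comp_continuous (continuous_extendCurve z) fun v => hz _
  have hI := intervalIntegral.integral_eq_sub_of_hasDeriv_right_of_le (a := 0) (b := (s : ℝ))
    (f := y) (f' := fun v => g (extendCurve z v)) s.2.1
    (hcont.mono (Icc_subset_Icc_right s.2.2)) ?_ (hc.intervalIntegrable _ _)
  · simp only [ContinuousMap.sub_apply, primitive_apply, ContinuousMap.const_apply,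
      extendCurve_superpose hg hz]
    rw [hI]
    change y s - _ = _
    abel
  · intro v hv
    have hv1 : v ∈ Ioo (0 : ℝ) 1 := ⟨hv.1, hv.2.trans_le s.2.2⟩
    have e : extendCurve z v = y v := extendCurve_of_mem z (Ioo_subset_Icc_self hv1)
    change HasDerivWithinAt y (g (extendCurve z v)) _ _
    rw [e]
    exact ((hy v (Ioo_subset_Icc_self hv1)).hasDerivAt
      (Icc_mem_nhds hv1.1 hv1.2)).hasDerivWithinAt

/-- A `C¹` map on an open set is Lipschitz on its compact subsets. -/
lemma exists_lipschitzOnWith_of_contDiffOn {g : Z → Z} {Ω : Set Z} (hΩ : IsOpen Ω)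
    (hg : ContDiffOn ℝ 1 g Ω) {K : Set Z} (hK : IsCompact K) (hKΩ : K ⊆ Ω) :
    ∃ C, LipschitzOnWith C g K := by
  refine LocallyLipschitzOn.exists_lipschitzOnWith_of_compact hK fun x hx => ?_
  have : ContDiffAt ℝ 1 g x := (hg x (hKΩ hx)).contDiffAt (hΩ.mem_nhds (hKΩ hx))
  obtain ⟨C, t, ht, hl⟩ := this.exists_lipschitzOnWith
  exact ⟨C, t, mem_nhdsWithin_of_mem_nhds ht, hl⟩

lemma IsFlowCurve.unique {g : Z → Z} {Ω : Set Z} (hΩ : IsOpen Ω) (hg : ContDiffOn ℝ 1 g Ω)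
    {z₀ : Z} {z w : C(I, Z)} (hz : IsFlowCurve g Ω z₀ z) (hw : IsFlowCurve g Ω z₀ w) :
    z = w := by
  have hgc := hg.continuousOn
  obtain ⟨C, hC⟩ := exists_lipschitzOnWith_of_contDiffOn hΩ hg
    ((isCompact_range z.continuous).union (isCompact_range w.continuous))
    (union_subset (range_subset_iff.2 hz.1) (range_subset_iff.2 hw.1))
  have hright : ∀ {y : C(I, Z)}, IsFlowCurve g Ω z₀ y → ∀ t ∈ Ico (0 : ℝ) 1,
      HasDerivWithinAt (extendCurve y) (g (extendCurve y t)) (Ici t) t := fun hy t ht =>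
    (hy.hasDerivWithinAt hgc (Ico_subset_Icc_self ht)).mono_of_mem_nhdsWithin
      (mem_of_superset (Icc_mem_nhdsGE ht.2) (Icc_subset_Icc_left ht.1))
  have := ODE_solution_unique_of_mem_Icc_right (v := fun _ => g)
    (s := fun _ => range z ∪ range w) (K := C) (f := extendCurve z) (g := extendCurve w)
    (a := 0) (b := 1) (fun _ _ => hC)
    (continuous_extendCurve z).continuousOn (hright hz)
    (fun t _ => Or.inl (mem_range_self _)) (continuous_extendCurve w).continuousOn (hright hw)
    (fun t _ => Or.inr (mem_range_self _)) (by rw [hz.zero hgc, hw.zero hgc])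
  ext s
  have h := this s.2
  rwa [extendCurve_of_mem z s.2, extendCurve_of_mem w s.2] at h

/-- The initial values for which the solution exists on `[0, 1]`. -/
def flowDomain (g : Z → Z) (Ω : Set Z) : Set Z := {z₀ | ∃ z, IsFlowCurve g Ω z₀ z}

open Classical in
/-- The solution on `[0, 1]` as a function of the initial value. -/
def flowCurve (g : Z → Z) (Ω : Set Z) (z₀ : Z) : C(I, Z) :=
  if h : ∃ z, IsFlowCurve g Ω z₀ z then h.choose else 0

lemma isFlowCurve_flowCurve {g : Z → Z} {Ω : Set Z} {z₀ : Z} (h : z₀ ∈ flowDomain g Ω) :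
    IsFlowCurve g Ω z₀ (flowCurve g Ω z₀) := by
  have h' : ∃ z, IsFlowCurve g Ω z₀ z := h
  rw [flowCurve, dif_pos h']
  exact h'.choose_spec

/-- Smooth dependence on the initial value: flow curves are the solutions of
`z - ∫_0^· g(z) = z₀` in the space of curves, where the inverse function theorem applies since
the linearization is `1` minus a Volterra operator. -/
lemma contDiffOn_flowCurve {g : Z → Z} {Ω : Set Z} (hΩ : IsOpen Ω) {l : ℕ} (hl : 1 ≤ l)
    (hg : ContDiffOn ℝ l g Ω) :
    IsOpen (flowDomain g Ω) ∧ ContDiffOn ℝ l (flowCurve g Ω) (flowDomain g Ω) := by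
  have hl' : (1 : WithTop ℕ∞) ≤ l := by exact_mod_cast hl
  have hg1 : ContDiffOn ℝ 1 g Ω := hg.of_le hl'
  have key : ∀ z₀ ∈ flowDomain g Ω, flowDomain g Ω ∈ 𝓝 z₀ ∧
      ContDiffAt ℝ l (flowCurve g Ω) z₀ := by
    rintro z₀ ⟨z, hz⟩
    let Ψ : C(I, Z) → C(I, Z) := fun y => y - primitive (superpose g y)
    have hsup : ContDiffAt ℝ l (superpose g) z :=
      (contDiffOn_superpose l hΩ hg z hz.1).contDiffAt ((isOpen_curvesIn hΩ).mem_nhds hz.1)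
    have hΨ : ContDiffAt ℝ l Ψ z :=
      contDiffAt_id.sub ((ContinuousLinearMap.contDiff (primitive (F := Z))).contDiffAt.comp z hsup)
    have hg' : ContinuousOn (fderiv ℝ g) Ω := hg1.continuousOn_fderiv_of_isOpen hΩ le_rfl
    have hd := hasFDerivAt_superpose hΩ (hg1.differentiableOn one_ne_zero) hg' hz.1
    obtain ⟨e, he⟩ := isUnit_one_sub_volterra (superpose (fderiv ℝ g) z)
    have hΨ' : HasFDerivAt Ψ
        ((ContinuousLinearEquiv.ofUnit e : C(I, Z) ≃L[ℝ] C(I, Z)) : C(I, Z) →L[ℝ] C(I, Z)) z := by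
      have h1 : HasFDerivAt Ψ (1 - primitive.comp (curveApply (superpose (fderiv ℝ g) z)) :
          C(I, Z) →L[ℝ] C(I, Z)) z :=
        (hasFDerivAt_id z).sub ((primitive (F := Z)).hasFDerivAt.comp z hd)
      rw [← he] at h1
      exact h1
    have hl0 : (l : WithTop ℕ∞) ≠ 0 := by
      have : l ≠ 0 := by omega
      exact_mod_cast this
    let θ := hΨ.localInverse hΨ' hl0
    have hΨz : Ψ z = ContinuousMap.const I z₀ := hz.2
    have hθ : ContDiffAt ℝ l θ (ContinuousMap.const I z₀) := by
      rw [← hΨz]; exact hΨ.to_localInverse hΨ' hl0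
    have hθz : θ (ContinuousMap.const I z₀) = z := by
      rw [← hΨz]; exact hΨ.localInverse_apply_image hΨ' hl0
    have hconst : ContDiff ℝ l fun z₀ : Z => (ContinuousMap.const I z₀ : C(I, Z)) :=
      (ContinuousLinearMap.const (R := ℝ) (M := Z) I).contDiff
    have hcomp : ContDiffAt ℝ l (fun z₀ => θ (ContinuousMap.const I z₀)) z₀ :=
      ContDiffAt.comp z₀ hθ hconst.contDiffAt
    have hright : ∀ᶠ z₁ in 𝓝 z₀,
        Ψ (θ (ContinuousMap.const I z₁)) = ContinuousMap.const I z₁ := by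
      have h1 := (hΨ.hasStrictFDerivAt' hΨ' hl0).eventually_right_inverse
      rw [hΨz] at h1
      exact hconst.continuous.continuousAt.eventually h1
    have hcurve : ∀ᶠ z₁ in 𝓝 z₀, θ (ContinuousMap.const I z₁) ∈ curvesIn Ω := by
      refine hcomp.continuousAt.eventually ((isOpen_curvesIn hΩ).mem_nhds ?_)
      change θ (ContinuousMap.const I z₀) ∈ curvesIn Ω
      rw [hθz]
      exact hz.1
    have hsol : ∀ᶠ z₁ in 𝓝 z₀, IsFlowCurve g Ω z₁ (θ (ContinuousMap.const I z₁)) := by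
      filter_upwards [hright, hcurve] with z₁ h1 h2 using ⟨h2, h1⟩
    refine ⟨?_, ?_⟩
    · filter_upwards [hsol] with z₁ h1 using ⟨_, h1⟩
    · refine hcomp.congr_of_eventuallyEq ?_
      filter_upwards [hsol] with z₁ h1
      exact (isFlowCurve_flowCurve ⟨_, h1⟩).unique hΩ hg1 h1
  exact ⟨isOpen_iff_mem_nhds.2 fun z hz => (key z hz).1,
    fun z hz => (key z hz).2.contDiffWithinAt⟩

end Flow

section ParamFlow

open unitInterval

variable {X Λ : Type} [NormedAddCommGroup X] [NormedSpace ℝ X] [CompleteSpace X]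
  [NormedAddCommGroup Λ] [NormedSpace ℝ Λ] [CompleteSpace Λ]

/-- The autonomous system `t' = 0`, `θ' = t`, `x' = t f(θ, x, λ)`, `λ' = 0` on the time interval
`[0, 1]` whose time-one map is the solution of `x' = f(θ, x, λ)` at time `t`. -/
def suspension (f : ℝ × X × Λ → X) (z : ℝ × ℝ × X × Λ) : ℝ × ℝ × X × Λ :=
  (0, z.1, z.1 • f z.2, 0)

lemma contDiffOn_suspension {f : ℝ × X × Λ → X} {Ω : Set (ℝ × X × Λ)} {l : ℕ}
    (hf : ContDiffOn ℝ l f Ω) : ContDiffOn ℝ l (suspension f) (Prod.snd ⁻¹' Ω) := by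
  have h1 : ContDiffOn ℝ l (fun z : ℝ × ℝ × X × Λ => f z.2) (Prod.snd ⁻¹' Ω) :=
    hf.comp contDiff_snd.contDiffOn (mapsTo_preimage _ _)
  have h2 : ContDiffOn ℝ l (fun z : ℝ × ℝ × X × Λ => z.1) (Prod.snd ⁻¹' Ω) :=
    contDiff_fst.contDiffOn
  exact contDiffOn_const.prodMk (h2.prodMk ((h2.smul h1).prodMk contDiffOn_const))

/-- The domain of the solution map `solMap`. -/
def solDomain (f : ℝ × X × Λ → X) (Ω : Set (ℝ × X × Λ)) : Set (ℝ × Λ) :=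
  {p | (p.1, 0, 0, p.2) ∈ flowDomain (suspension f) (Prod.snd ⁻¹' Ω)}

/-- The value at time `t` of the solution of `x' = f(t, x, λ)`, `x(0) = 0`. -/
def solMap (f : ℝ × X × Λ → X) (Ω : Set (ℝ × X × Λ)) (p : ℝ × Λ) : X :=
  (flowCurve (suspension f) (Prod.snd ⁻¹' Ω) (p.1, 0, 0, p.2) 1).2.2.1

variable {f : ℝ × X × Λ → X} {Ω : Set (ℝ × X × Λ)} {l : ℕ}

lemma isOpen_solDomain (hΩ : IsOpen Ω) (hl : 1 ≤ l) (hf : ContDiffOn ℝ l f Ω) :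
    IsOpen (solDomain f Ω) :=
  (contDiffOn_flowCurve (hΩ.preimage continuous_snd) hl (contDiffOn_suspension hf)).1.preimage
    (by fun_prop)

lemma contDiffOn_solMap (hΩ : IsOpen Ω) (hl : 1 ≤ l) (hf : ContDiffOn ℝ l f Ω) :
    ContDiffOn ℝ l (solMap f Ω) (solDomain f Ω) := by
  have h1 := (contDiffOn_flowCurve (hΩ.preimage continuous_snd) hl (contDiffOn_suspension hf)).2
  have h2 : ContDiff ℝ l fun p : ℝ × Λ => ((p.1, 0, 0, p.2) : ℝ × ℝ × X × Λ) := by fun_prop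
  have h3 : ContDiff ℝ l fun y : C(I, ℝ × ℝ × X × Λ) => (y 1).2.2.1 := by
    have : ContDiff ℝ l fun y : C(I, ℝ × ℝ × X × Λ) => y 1 :=
      ContinuousLinearMap.contDiff
        (ContinuousMap.evalCLM ℝ (1 : I) : C(I, ℝ × ℝ × X × Λ) →L[ℝ] ℝ × ℝ × X × Λ)
    exact this.snd.snd.fst
  exact h3.comp_contDiffOn (h1.comp h2.contDiffOn fun p hp => hp)

lemma solMap_of_rescaled (hΩ : IsOpen Ω) (hf : ContDiffOn ℝ 1 f Ω) {t : ℝ} {lam : Λ} {y : ℝ → X}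
    (h0 : y 0 = 0) (hmem : ∀ s ∈ Icc (0 : ℝ) 1, (s * t, y s, lam) ∈ Ω)
    (hy : ∀ s ∈ Icc (0 : ℝ) 1, HasDerivWithinAt y (t • f (s * t, y s, lam)) (Icc 0 1) s) :
    (t, lam) ∈ solDomain f Ω ∧ solMap f Ω (t, lam) = y 1 := by
  have hg : ContDiffOn ℝ 1 (suspension f) (Prod.snd ⁻¹' Ω) :=
    contDiffOn_suspension (l := 1) (by exact_mod_cast hf)
  obtain ⟨z, hz, hzy⟩ := exists_isFlowCurve (g := suspension f) (Ω := Prod.snd ⁻¹' Ω)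
    (y := fun s => (t, s * t, y s, lam)) hg.continuousOn hmem (by
      intro s hs
      refine (hasDerivWithinAt_const s (Icc (0 : ℝ) 1) t).prodMk (HasDerivWithinAt.prodMk ?_
        ((hy s hs).prodMk (hasDerivWithinAt_const s (Icc (0 : ℝ) 1) lam)))
      simpa using (hasDerivWithinAt_id s (Icc (0 : ℝ) 1)).mul_const t)
  simp only [zero_mul, h0] at hz
  refine ⟨⟨z, hz⟩, ?_⟩
  have := (isFlowCurve_flowCurve ⟨z, hz⟩).unique (hΩ.preimage continuous_snd) hg hz
  change (flowCurve (suspension f) (Prod.snd ⁻¹' Ω) (t, 0, 0, lam) 1).2.2.1 = y 1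
  rw [this, hzy]
  simp

lemma exists_rescaled (hf : ContDiffOn ℝ 1 f Ω) {t : ℝ} {lam : Λ}
    (h : (t, lam) ∈ solDomain f Ω) :
    ∃ y : ℝ → X, y 0 = 0 ∧ (∀ s ∈ Icc (0 : ℝ) 1, (s * t, y s, lam) ∈ Ω) ∧
      (∀ s ∈ Icc (0 : ℝ) 1, HasDerivWithinAt y (t • f (s * t, y s, lam)) (Icc 0 1) s) ∧
      y 1 = solMap f Ω (t, lam) := by
  have hg : ContDiffOn ℝ 1 (suspension f) (Prod.snd ⁻¹' Ω) :=
    contDiffOn_suspension (l := 1) (by exact_mod_cast hf)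
  have hz := isFlowCurve_flowCurve h
  set z := flowCurve (suspension f) (Prod.snd ⁻¹' Ω) ((t, lam).1, 0, 0, (t, lam).2) with hzdef
  let w : ℝ → ℝ × ℝ × X × Λ := extendCurve z
  have hw0 : w 0 = (t, 0, 0, lam) := hz.zero hg.continuousOn
  have hd : ∀ s ∈ Icc (0 : ℝ) 1, HasDerivWithinAt w (suspension f (w s)) (Icc 0 1) s :=
    fun s hs => hz.hasDerivWithinAt hg.continuousOn hs
  have hmem : ∀ s, (w s).2 ∈ Ω := fun s => hz.1 _
  have hconst : ∀ {W : Type} [NormedAddCommGroup W] [NormedSpace ℝ W] (u : ℝ → W),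
      (∀ s ∈ Icc (0 : ℝ) 1, HasDerivWithinAt u 0 (Icc 0 1) s) →
      ∀ s ∈ Icc (0 : ℝ) 1, u s = u 0 := by
    intro W _ _ u hu s hs
    refine constant_of_has_deriv_right_zero (fun s hs => (hu s hs).continuousWithinAt)
      (fun s hs => ?_) s hs
    exact (hu s (Ico_subset_Icc_self hs)).mono_of_mem_nhdsWithin
      (mem_of_superset (Icc_mem_nhdsGE hs.2) (Icc_subset_Icc_left hs.1))
  have h1 : ∀ s ∈ Icc (0 : ℝ) 1, (w s).1 = t := by
    intro s hs
    rw [hconst (fun s => (w s).1) (fun s hs => (hd s hs).fst) s hs, hw0]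
  have h4 : ∀ s ∈ Icc (0 : ℝ) 1, (w s).2.2.2 = lam := by
    intro s hs
    rw [hconst (fun s => (w s).2.2.2) (fun s hs => (hd s hs).snd.snd.snd) s hs, hw0]
  have h2 : ∀ s ∈ Icc (0 : ℝ) 1, (w s).2.1 = s * t := by
    intro s hs
    have := hconst (fun s => (w s).2.1 - s * t) (fun s hs => by
      have e1 : HasDerivWithinAt (fun s => (w s).2.1) t (Icc (0 : ℝ) 1) s := by
        have := (hd s hs).snd.fst
        simp only [suspension, h1 s hs] at this
        exact this
      have e2 : HasDerivWithinAt (fun s => s * t) t (Icc (0 : ℝ) 1) s := by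
        simpa using (hasDerivWithinAt_id s (Icc (0 : ℝ) 1)).mul_const t
      have e3 := e1.sub e2
      rw [sub_self] at e3
      exact e3) s hs
    simp only [hw0, zero_mul, sub_zero] at this
    exact sub_eq_zero.1 this
  have heq : ∀ s ∈ Icc (0 : ℝ) 1, (w s).2 = (s * t, (w s).2.2.1, lam) := fun s hs =>
    Prod.ext (h2 s hs) (Prod.ext rfl (h4 s hs))
  refine ⟨fun s => (w s).2.2.1, by simp [hw0], fun s hs => ?_, fun s hs => ?_, ?_⟩
  · rw [← heq s hs]; exact hmem s
  · have := (hd s hs).snd.snd.fst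
    simp only [suspension, h1 s hs] at this
    rw [← heq s hs]
    exact this
  · change (extendCurve z 1).2.2.1 = _
    rw [extendCurve_of_mem z (right_mem_Icc.2 zero_le_one)]
    rfl

/-- The domain of the solution map is star-shaped in time, and its rescaled solutions are values
of the solution map. -/
lemma solDomain_star (hΩ : IsOpen Ω) (hf : ContDiffOn ℝ 1 f Ω) {t : ℝ} {lam : Λ}
    (h : (t, lam) ∈ solDomain f Ω) {s : ℝ} (hs : s ∈ Icc (0 : ℝ) 1) :
    (s * t, lam) ∈ solDomain f Ω ∧ (s * t, solMap f Ω (s * t, lam), lam) ∈ Ω ∧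
    HasDerivWithinAt (fun s => solMap f Ω (s * t, lam))
      (t • f (s * t, solMap f Ω (s * t, lam), lam)) (Icc 0 1) s := by
  obtain ⟨y, hy0, hyΩ, hyd, hy1⟩ := exists_rescaled hf h
  have key : ∀ s ∈ Icc (0 : ℝ) 1,
      (s * t, lam) ∈ solDomain f Ω ∧ solMap f Ω (s * t, lam) = y s := by
    intro s hs
    have hsv : ∀ v ∈ Icc (0 : ℝ) 1, s * v ∈ Icc (0 : ℝ) 1 := fun v hv =>
      ⟨mul_nonneg hs.1 hv.1, mul_le_one₀ hs.2 hv.1 hv.2⟩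
    have := solMap_of_rescaled hΩ hf (t := s * t) (lam := lam) (y := fun v => y (s * v))
      (by simpa using hy0)
      (fun v hv => by
        have := hyΩ _ (hsv v hv)
        rwa [show v * (s * t) = s * v * t by ring])
      (fun v hv => by
        have h1 := hyd _ (hsv v hv)
        have h2 : HasDerivWithinAt (fun v => s * v) s (Icc (0 : ℝ) 1) v := by
          simpa using (hasDerivWithinAt_id v (Icc (0 : ℝ) 1)).const_mul s
        have h3 := HasDerivWithinAt.scomp v h1 h2 hsv
        rw [smul_smul] at h3
        rwa [show v * (s * t) = s * v * t by ring])
    simpa using this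
  refine ⟨(key s hs).1, ?_, ?_⟩
  · rw [(key s hs).2]; exact hyΩ s hs
  · rw [(key s hs).2]
    exact (hyd s hs).congr (fun v hv => (key v hv).2) (key s hs).2

lemma solMap_zero (hΩ : IsOpen Ω) (hf : ContDiffOn ℝ 1 f Ω) {lam : Λ} (h : (0, 0, lam) ∈ Ω) :
    (0, lam) ∈ solDomain f Ω ∧ solMap f Ω (0, lam) = 0 :=
  solMap_of_rescaled hΩ hf (y := fun _ => 0) rfl
    (fun s _ => by simpa using h)
    (fun s _ => by simpa using hasDerivWithinAt_const s (Icc (0 : ℝ) 1) (0 : X))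

lemma solMap_mem (hΩ : IsOpen Ω) (hf : ContDiffOn ℝ 1 f Ω) {t : ℝ} {lam : Λ}
    (h : (t, lam) ∈ solDomain f Ω) : (t, solMap f Ω (t, lam), lam) ∈ Ω := by
  simpa using (solDomain_star hΩ hf h (right_mem_Icc.2 zero_le_one)).2.1

lemma solMap_zero_of_mem (hΩ : IsOpen Ω) (hf : ContDiffOn ℝ 1 f Ω) {t : ℝ} {lam : Λ}
    (h : (t, lam) ∈ solDomain f Ω) : solMap f Ω (0, lam) = 0 := by
  obtain ⟨y, hy0, hyΩ, -, -⟩ := exists_rescaled hf h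
  have := hyΩ 0 (left_mem_Icc.2 zero_le_one)
  rw [hy0, zero_mul] at this
  exact (solMap_zero hΩ hf this).2

/-- The solution map solves the differential equation. -/
lemma hasDerivAt_solMap (hΩ : IsOpen Ω) (hf : ContDiffOn ℝ 1 f Ω) {t : ℝ} {lam : Λ}
    (h : (t, lam) ∈ solDomain f Ω) :
    HasDerivAt (fun t => solMap f Ω (t, lam)) (f (t, solMap f Ω (t, lam), lam)) t := by
  have hW := isOpen_solDomain (l := 1) hΩ le_rfl (by exact_mod_cast hf)
  have hφ := (contDiffOn_solMap (l := 1) hΩ le_rfl (by exact_mod_cast hf)).continuousOn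
  have hopen : IsOpen {t : ℝ | (t, lam) ∈ solDomain f Ω} := hW.preimage (by fun_prop)
  have hcont : ContinuousOn (fun u => f (u, solMap f Ω (u, lam), lam))
      {t : ℝ | (t, lam) ∈ solDomain f Ω} := by
    refine hf.continuousOn.comp ?_ fun u hu => solMap_mem hΩ hf hu
    refine continuousOn_id.prodMk (ContinuousOn.prodMk ?_ continuousOn_const)
    exact hφ.comp (by fun_prop) fun u hu => hu
  have hstar : ∀ {t : ℝ}, (t, lam) ∈ solDomain f Ω → ∀ u ∈ uIcc 0 t,
      (u, lam) ∈ solDomain f Ω := by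
    intro t ht u hu
    rw [← segment_eq_uIcc, segment_eq_image'] at hu
    obtain ⟨s, hs, rfl⟩ := hu
    simpa using (solDomain_star hΩ hf ht hs).1
  have hint : ∀ {t : ℝ}, (t, lam) ∈ solDomain f Ω →
      IntervalIntegrable (fun u => f (u, solMap f Ω (u, lam), lam)) volume 0 t := fun ht =>
    (hcont.mono fun u hu => hstar ht u hu).intervalIntegrable
  have heq : ∀ t : ℝ, (t, lam) ∈ solDomain f Ω →
      solMap f Ω (t, lam) = ∫ u in (0 : ℝ)..t, f (u, solMap f Ω (u, lam), lam) := by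
    intro t ht
    have hd := fun s hs => (solDomain_star hΩ hf ht (s := s) hs).2.2
    have hcs : ContinuousOn (fun s : ℝ => t • f (s * t, solMap f Ω (s * t, lam), lam))
        (Icc 0 1) :=
      (hcont.comp (f := fun s : ℝ => s * t) (by fun_prop)
        fun s hs => (solDomain_star hΩ hf ht hs).1).const_smul t
    have hI := intervalIntegral.integral_eq_sub_of_hasDeriv_right_of_le zero_le_one
      (f := fun s => solMap f Ω (s * t, lam))
      (f' := fun s => t • f (s * t, solMap f Ω (s * t, lam), lam))
      (fun s hs => (hd s hs).continuousWithinAt)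
      (fun s hs => ((hd s (Ioo_subset_Icc_self hs)).hasDerivAt
        (Icc_mem_nhds hs.1 hs.2)).hasDerivWithinAt)
      (by rw [← uIcc_of_le zero_le_one] at hcs; exact hcs.intervalIntegrable)
    rw [intervalIntegral.integral_smul] at hI
    have e := intervalIntegral.smul_integral_comp_mul_right (a := 0) (b := 1)
      (fun u => f (u, solMap f Ω (u, lam), lam)) t
    rw [e] at hI
    simp only [zero_mul, one_mul] at hI
    rw [hI, solMap_zero_of_mem hΩ hf ht, sub_zero]
  have h1 := intervalIntegral.integral_hasDerivAt_right (hint h)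
    (hcont.stronglyMeasurableAtFilter hopen t h) (hcont.continuousAt (hopen.mem_nhds h))
  refine h1.congr_of_eventuallyEq ?_
  filter_upwards [hopen.mem_nhds h] with u hu using heq u hu

/-- Uniqueness: a solution on an interval around `0` is given by the solution map. -/
lemma solMap_unique (hΩ : IsOpen Ω) (hf : ContDiffOn ℝ 1 f Ω) {a : ℝ} (ha : 0 ≤ a) {lam : Λ}
    {x : ℝ → X} (h0 : x 0 = 0) (hmem : ∀ s ∈ Icc (-a) a, (s, x s, lam) ∈ Ω)
    (hx : ∀ s ∈ Icc (-a) a, HasDerivWithinAt x (f (s, x s, lam)) (Icc (-a) a) s) :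
    ∀ t ∈ Icc (-a) a, (t, lam) ∈ solDomain f Ω ∧ solMap f Ω (t, lam) = x t := by
  intro t ht
  have hsub : ∀ s ∈ Icc (0 : ℝ) 1, s * t ∈ Icc (-a) a := by
    intro s hs
    have := (convex_Icc (-a) a).smul_mem_of_zero_mem (by constructor <;> linarith) ht hs
    simpa using this
  have := solMap_of_rescaled hΩ hf (t := t) (lam := lam) (y := fun s => x (s * t))
    (by simpa using h0) (fun s hs => hmem _ (hsub s hs)) (fun s hs => by
      have h2 : HasDerivWithinAt (fun s => s * t) t (Icc (0 : ℝ) 1) s := by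
        simpa using (hasDerivWithinAt_id s (Icc (0 : ℝ) 1)).mul_const t
      exact HasDerivWithinAt.scomp s (hx _ (hsub s hs)) h2 hsub)
  simpa using this

end ParamFlow

/-! ### The spaces `Σ_n` as Hilbert spaces -/

section Spaces

variable {N : ℕ}

instance (N n : ℕ) : InnerProductSpace ℝ (Sg N n) :=
  inferInstanceAs (InnerProductSpace ℝ (sgSubmodule N n))

lemma isMonomialMul_unique {α : Fin 3 → ℕ} {u f f' : L2 N} (h : IsMonomialMul α u f)
    (h' : IsMonomialMul α u f') : f = f' := by
  unfold IsMonomialMul at h h'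
  refine Lp.ext ?_
  filter_upwards [h, h'] with x h1 h2
  rw [h1, h2]

lemma isWeakDeriv_unique {α : Fin 3 → ℕ} {u g g' : L2 N} (h : IsWeakDeriv α u g)
    (h' : IsWeakDeriv α u g') : g = g' := by
  rw [isWeakDeriv_iff] at h h'
  have hd : DenseRange (SchwartzMap.toLpCLM ℝ (V N) 2 (volume : Measure E3)) :=
    SchwartzMap.denseRange_toLpCLM (by simp)
  refine ext_inner_right ℝ fun v => ?_
  refine hd.induction_on (p := fun v => ⟪g, v⟫_ℝ = ⟪g', v⟫_ℝ) v
    (isClosed_eq (by fun_prop) (by fun_prop)) fun φ => ?_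
  rw [SchwartzMap.toLpCLM_apply, h φ, h' φ]

lemma isClosed_isMonomialMul (α : Fin 3 → ℕ) :
    IsClosed {p : L2 N × L2 N | IsMonomialMul α p.1 p.2} := by
  refine IsSeqClosed.isClosed ?_
  intro p q hp hpq
  obtain ⟨h1, h2⟩ := (Prod.tendsto_iff _ _).1 hpq
  have m1 := tendstoInMeasure_of_tendsto_Lp h1
  obtain ⟨ns, hns, a1⟩ := m1.exists_seq_tendsto_ae
  have m2 := tendstoInMeasure_of_tendsto_Lp (h2.comp hns.tendsto_atTop)
  obtain ⟨ms, hms, a2⟩ := m2.exists_seq_tendsto_ae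
  have hall : ∀ᵐ x : E3, ∀ k, (p k).2 x = (∏ i, x i ^ α i) • (p k).1 x :=
    ae_all_iff.2 hp
  change ∀ᵐ x : E3, q.2 x = (∏ i, x i ^ α i) • q.1 x
  filter_upwards [a1, a2, hall] with x b1 b2 b3
  refine tendsto_nhds_unique b2 ?_
  refine ((b1.comp hms.tendsto_atTop).const_smul (∏ i, x i ^ α i)).congr fun k => ?_
  exact (b3 _).symm

lemma isClosed_isWeakDeriv (α : Fin 3 → ℕ) :
    IsClosed {p : L2 N × L2 N | IsWeakDeriv α p.1 p.2} := by
  simp only [isWeakDeriv_iff, ofPred_forall]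
  exact isClosed_iInter fun φ => isClosed_eq (by fun_prop) (by fun_prop)

lemma isClosed_sgSubmodule (N n : ℕ) : IsClosed (sgSubmodule N n : Set (Tuples N n)) := by
  have : (sgSubmodule N n : Set (Tuples N n)) = ⋂ α : MIdx n,
      (fun w : Tuples N n => (w (Sum.inl (zeroIdx n)), w (Sum.inl α))) ⁻¹'
        {p : L2 N × L2 N | IsMonomialMul (fun i => (α.1 i : ℕ)) p.1 p.2} ∩
      (fun w : Tuples N n => (w (Sum.inl (zeroIdx n)), w (Sum.inr α))) ⁻¹'
        {p : L2 N × L2 N | IsWeakDeriv (fun i => (α.1 i : ℕ)) p.1 p.2} := by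
    ext w
    simp [sgSubmodule]
  rw [this]
  exact isClosed_iInter fun α =>
    ((isClosed_isMonomialMul _).preimage (by fun_prop)).inter
      ((isClosed_isWeakDeriv _).preimage (by fun_prop))

instance (N n : ℕ) : CompleteSpace (Sg N n) :=
  (isClosed_sgSubmodule N n).completeSpace_coe

lemma fn_injective {n : ℕ} : Function.Injective (fn : Sg N n → L2 N) := by
  intro v w h
  refine Subtype.ext (PiLp.ext fun a => ?_)
  have h0 : v.1 (Sum.inl (zeroIdx n)) = w.1 (Sum.inl (zeroIdx n)) := h
  rcases a with α | α
  · have h1 := (v.2 α).1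
    rw [h0] at h1
    exact isMonomialMul_unique h1 (w.2 α).1
  · have h1 := (v.2 α).2
    rw [h0] at h1
    exact isWeakDeriv_unique h1 (w.2 α).2

@[simp] lemma fn_sgIncl {m n : ℕ} (h : m ≤ n) (w : Sg N n) : fn (sgIncl h w) = fn w := by
  have e : castIdx h (zeroIdx m) = zeroIdx n := rfl
  change w.1.ofLp (Sum.inl (castIdx h (zeroIdx m))) = w.1.ofLp (Sum.inl (zeroIdx n))
  rw [e]

/-- A bounded operator into `L²` with values in `Σ_n` is bounded into `Σ_n`, by the closed graph
theorem. -/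
lemma exists_lift {E : Type*} [NormedAddCommGroup E] [NormedSpace ℝ E] [CompleteSpace E] {n : ℕ}
    (A : E →L[ℝ] L2 N) (h : ∀ u, ∃ v : Sg N n, fn v = A u) :
    ∃ B : E →L[ℝ] Sg N n, ∀ u, fn (B u) = A u := by
  choose b hb using h
  let B : E →ₗ[ℝ] Sg N n :=
    { toFun := b
      map_add' := fun x y => fn_injective (by rw [map_add, hb, hb, hb, map_add])
      map_smul' := fun c x => fn_injective (by
        rw [RingHom.id_apply, map_smul, hb, hb, map_smul]) }
  have hcl : IsClosed (B.graph : Set (E × Sg N n)) := by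
    have : (B.graph : Set (E × Sg N n)) = {p | fn p.2 = A p.1} := by
      ext p
      rw [SetLike.mem_coe, LinearMap.mem_graph_iff]
      constructor
      · intro hp
        change fn p.2 = A p.1
        rw [hp]
        exact hb _
      · intro hp
        exact fn_injective ((show fn p.2 = A p.1 from hp).trans (hb _).symm)
    rw [this]
    exact isClosed_eq (by fun_prop) (by fun_prop)
  exact ⟨⟨B, B.continuous_of_isClosed_graph hcl⟩, hb⟩

/-- A curve in `Σ_n` with derivative in `L²` given by a continuous curve in `Σ_n` has this
derivative in `Σ_n`. -/
lemma hasDerivAt_of_hasDerivAt_fn {n : ℕ} {f g : ℝ → Sg N n} (hg : Continuous g)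
    (h : ∀ t, HasDerivAt (fun t => fn (f t)) (fn (g t)) t) (t : ℝ) : HasDerivAt f (g t) t := by
  have e : ∀ t, f t = f 0 + ∫ s in (0 : ℝ)..t, g s := by
    intro t
    refine fn_injective ?_
    have h1 : fn (∫ s in (0 : ℝ)..t, g s) = ∫ s in (0 : ℝ)..t, fn (g s) :=
      (ContinuousLinearMap.intervalIntegral_comp_comm fn (hg.intervalIntegrable _ _)).symm
    rw [map_add, h1, intervalIntegral.integral_eq_sub_of_hasDerivAt (fun s _ => h s)
      ((fn.continuous.comp hg).intervalIntegrable _ _)]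
    abel
  have h2 : HasDerivAt (fun t => f 0 + ∫ s in (0 : ℝ)..t, g s) (g t) t :=
    (intervalIntegral.integral_hasDerivAt_right (hg.intervalIntegrable _ _)
      (hg.stronglyMeasurableAtFilter _ _) hg.continuousAt).const_add _
  exact h2.congr_of_eventuallyEq (Eventually.of_forall e)

/-- Curves which are locally bounded in `Σ_n` and continuous in `L²` are weakly continuous
in `Σ_n`. -/
lemma continuous_inner_of_continuous_fn {n : ℕ} {f : ℝ → Sg N n}
    (hf : Continuous fun t => fn (f t)) (hb : ∀ c, ∃ C, ∀ t, |t| ≤ c → ‖f t‖ ≤ C) (y : Sg N n) :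
    Continuous fun t => ⟪f t, y⟫_ℝ := by
  let A : L2 N →L[ℝ] Sg N n := ContinuousLinearMap.adjoint fn
  have hdense : DenseRange A := by
    have h1 : A.rangeᗮ = ⊥ := by
      rw [ContinuousLinearMap.orthogonal_range]
      rw [ContinuousLinearMap.adjoint_adjoint]
      exact LinearMap.ker_eq_bot.2 fn_injective
    have h2 := Submodule.topologicalClosure_eq_top_iff.2 h1
    have h3 := Submodule.dense_iff_topologicalClosure_eq_top.2 h2
    exact h3
  rw [continuous_iff_continuousAt]
  intro t₀
  obtain ⟨C, hC⟩ := hb (|t₀| + 1)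
  have hC0 : 0 ≤ C := (norm_nonneg _).trans (hC t₀ (by linarith))
  rw [Metric.continuousAt_iff']
  intro ε hε
  obtain ⟨w, hw⟩ := hdense.exists_dist_lt y (ε := ε / (3 * (C + 1))) (by positivity)
  have hcw : Continuous fun t => ⟪f t, A w⟫_ℝ := by
    have : ∀ t, ⟪f t, A w⟫_ℝ = ⟪fn (f t), w⟫_ℝ := fun t =>
      ContinuousLinearMap.adjoint_inner_right _ _ _
    simp only [this]
    exact hf.inner continuous_const
  have h1 := Metric.continuousAt_iff'.1 (hcw.continuousAt (x := t₀)) (ε / 3) (by positivity)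
  have h2 : ∀ᶠ t : ℝ in 𝓝 t₀, |t| ≤ |t₀| + 1 :=
    (continuous_abs.continuousAt (x := t₀)).eventually (eventually_le_nhds (by linarith))
  have h3 : ∀ t, |t| ≤ |t₀| + 1 → dist ⟪f t, y⟫_ℝ ⟪f t, A w⟫_ℝ ≤ ε / 3 := by
    intro t ht
    rw [Real.dist_eq, ← inner_sub_right]
    refine (abs_real_inner_le_norm _ _).trans ?_
    rw [dist_eq_norm] at hw
    calc ‖f t‖ * ‖y - A w‖ ≤ C * (ε / (3 * (C + 1))) := by
          gcongr
          exact hC t ht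
      _ ≤ ε / 3 := by
        rw [← mul_div_assoc, div_le_div_iff₀ (by positivity) (by positivity)]
        nlinarith
  filter_upwards [h1, h2] with t ht1 ht2
  have a := h3 t ht2
  have b := h3 t₀ (by linarith)
  calc dist ⟪f t, y⟫_ℝ ⟪f t₀, y⟫_ℝ
      ≤ dist ⟪f t, y⟫_ℝ ⟪f t, A w⟫_ℝ + dist ⟪f t, A w⟫_ℝ ⟪f t₀, A w⟫_ℝ
        + dist ⟪f t₀, A w⟫_ℝ ⟪f t₀, y⟫_ℝ := dist_triangle4 _ _ _ _
    _ < ε := by rw [dist_comm ⟪f t₀, A w⟫_ℝ]; linarith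

end Spaces

/-! ### The matrix `J` -/

section Matrix

variable {N : ℕ}

lemma matOp_ae (A : Matrix (Fin (2 * N)) (Fin (2 * N)) ℝ) (u : L2 N) :
    ∀ᵐ x : E3, matOp A u x = Matrix.toEuclideanCLM (𝕜 := ℝ) A (u x) :=
  ContinuousLinearMap.coeFn_compLpL _ _

lemma matOp_mul (A B : Matrix (Fin (2 * N)) (Fin (2 * N)) ℝ) (u : L2 N) :
    matOp (A * B) u = matOp A (matOp B u) := by
  refine Lp.ext ?_
  filter_upwards [matOp_ae (A * B) u, matOp_ae A (matOp B u), matOp_ae B u] with x h1 h2 h3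
  rw [h1, h2, h3, map_mul]
  rfl

lemma matOp_one (u : L2 N) : matOp (1 : Matrix (Fin (2 * N)) (Fin (2 * N)) ℝ) u = u := by
  refine Lp.ext ?_
  filter_upwards [matOp_ae 1 u] with x h1
  rw [h1, map_one]
  rfl

lemma matOp_neg (A : Matrix (Fin (2 * N)) (Fin (2 * N)) ℝ) (u : L2 N) :
    matOp (-A) u = -matOp A u := by
  refine Lp.ext ?_
  filter_upwards [matOp_ae (-A) u, matOp_ae A u, Lp.coeFn_neg (matOp A u)] with x h1 h2 h3
  rw [h1, h3, Pi.neg_apply, h2, map_neg]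
  rfl

lemma inner_toEuclideanCLM_left (A : Matrix (Fin (2 * N)) (Fin (2 * N)) ℝ) (x y : V N) :
    ⟪Matrix.toEuclideanCLM (𝕜 := ℝ) A x, y⟫_ℝ
      = ⟪x, Matrix.toEuclideanCLM (𝕜 := ℝ) A.transpose y⟫_ℝ := by
  rw [real_inner_comm, Matrix.inner_toEuclideanCLM, Matrix.inner_toEuclideanCLM,
    Matrix.dotProduct_mulVec, dotProduct_comm, Matrix.mulVec_transpose]

lemma inner_matOp_left (A : Matrix (Fin (2 * N)) (Fin (2 * N)) ℝ) (u v : L2 N) :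
    ⟪matOp A u, v⟫_ℝ = ⟪u, matOp A.transpose v⟫_ℝ := by
  rw [L2.inner_def, L2.inner_def]
  refine integral_congr_ae ?_
  filter_upwards [matOp_ae A u, matOp_ae A.transpose v] with x h1 h2
  rw [h1, h2, inner_toEuclideanCLM_left]

/-- A matrix acting pointwise on Schwartz functions. -/
def matSchwartz (A : Matrix (Fin (2 * N)) (Fin (2 * N)) ℝ) : 𝓢(E3, V N) →L[ℝ] 𝓢(E3, V N) :=
  SchwartzMap.postcompCLM (Matrix.toEuclideanCLM (𝕜 := ℝ) A)

lemma lineDeriv_matSchwartz (A : Matrix (Fin (2 * N)) (Fin (2 * N)) ℝ) (m : E3)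
    (φ : 𝓢(E3, V N)) : ∂_{m} (matSchwartz A φ) = matSchwartz A (∂_{m} φ) := by
  ext1 x
  rw [SchwartzMap.lineDerivOp_apply_eq_fderiv]
  change fderiv ℝ (fun x => Matrix.toEuclideanCLM (𝕜 := ℝ) A (φ x)) x m
    = Matrix.toEuclideanCLM (𝕜 := ℝ) A ((∂_{m} φ : 𝓢(E3, V N)) x)
  rw [SchwartzMap.lineDerivOp_apply_eq_fderiv]
  have h := ((Matrix.toEuclideanCLM (𝕜 := ℝ) A).hasFDerivAt.comp x
    (φ.differentiableAt (x := x)).hasFDerivAt).fderiv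
  exact congrArg (fun L => L m) h

lemma multiDeriv_matSchwartz (A : Matrix (Fin (2 * N)) (Fin (2 * N)) ℝ) (α : Fin 3 → ℕ)
    (φ : 𝓢(E3, V N)) : multiDeriv α (matSchwartz A φ) = matSchwartz A (multiDeriv α φ) := by
  have h : ∀ (m : E3) (k : ℕ) (φ : 𝓢(E3, V N)),
      (fun ψ : 𝓢(E3, V N) => ∂_{m} ψ)^[k] (matSchwartz A φ)
        = matSchwartz A ((fun ψ : 𝓢(E3, V N) => ∂_{m} ψ)^[k] φ) := fun m k φ =>
    ((Function.Semiconj.iterate_right (f := matSchwartz A)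
      (fun ψ => (lineDeriv_matSchwartz A m ψ).symm) k) φ).symm
  simp only [multiDeriv, h]

lemma toLp_matSchwartz (A : Matrix (Fin (2 * N)) (Fin (2 * N)) ℝ) (φ : 𝓢(E3, V N)) :
    (matSchwartz A φ).toLp 2 (volume : Measure E3) = matOp A (φ.toLp 2 volume) := by
  refine Lp.ext ?_
  filter_upwards [(matSchwartz A φ).coeFn_toLp 2 (volume : Measure E3),
    matOp_ae A (φ.toLp 2 volume), φ.coeFn_toLp 2 (volume : Measure E3)] with x h1 h2 h3
  rw [h1, h2, h3]
  rfl

/-- Matrices preserve `Σ_n`. -/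
lemma exists_fn_eq_matOp (A : Matrix (Fin (2 * N)) (Fin (2 * N)) ℝ) {n : ℕ} (w : Sg N n) :
    ∃ v : Sg N n, fn v = matOp A (fn w) := by
  refine ⟨⟨WithLp.toLp 2 fun a => matOp A (w.1 a), fun α => ⟨?_, ?_⟩⟩, rfl⟩
  · have h := (w.2 α).1
    unfold IsMonomialMul at h ⊢
    filter_upwards [h, matOp_ae A (w.1 (Sum.inl (zeroIdx n))), matOp_ae A (w.1 (Sum.inl α))]
      with x h1 h2 h3
    rw [h2, h3, h1, map_smul]
  · have h := (w.2 α).2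
    rw [isWeakDeriv_iff] at h ⊢
    intro φ
    have h1 := h (matSchwartz A.transpose φ)
    rw [multiDeriv_matSchwartz, toLp_matSchwartz, toLp_matSchwartz] at h1
    rw [← inner_matOp_left, ← inner_matOp_left] at h1
    exact h1

end Matrix

/-! ### The group `e^{Jτ·◇}` in `L²` -/

/-- The product rule for `A_t y(t)`, where `A` is bounded and strongly differentiable at `y(t₀)`. -/
lemma hasDerivWithinAt_clm_apply {E F : Type*} [NormedAddCommGroup E] [NormedSpace ℝ E]
    [NormedAddCommGroup F] [NormedSpace ℝ F] {A : ℝ → E →L[ℝ] F} {C : ℝ} (hA : ∀ t, ‖A t‖ ≤ C)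
    {s : Set ℝ} {t₀ : ℝ} {y : ℝ → E} {y' : E} {a : F} (hy : HasDerivWithinAt y y' s t₀)
    (hc : ContinuousWithinAt (fun t => A t y') s t₀)
    (ha : HasDerivWithinAt (fun t => A t (y t₀)) a s t₀) :
    HasDerivWithinAt (fun t => A t (y t)) (A t₀ y' + a) s t₀ := by
  rw [hasDerivWithinAt_iff_isLittleO] at *
  have h1 : (fun t => A t (y t - y t₀ - (t - t₀) • y')) =o[𝓝[s] t₀] fun t => t - t₀ := by
    refine Asymptotics.IsBigO.trans_isLittleO ?_ hy
    exact Asymptotics.IsBigO.of_bound C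
      (Eventually.of_forall fun t => (A t).le_of_opNorm_le (hA t) _)
  have h2 : (fun t => (t - t₀) • (A t y' - A t₀ y')) =o[𝓝[s] t₀] fun t => t - t₀ := by
    have h0 : (fun t => A t y' - A t₀ y') =o[𝓝[s] t₀] fun _ => (1 : ℝ) := by
      rw [Asymptotics.isLittleO_one_iff]
      exact tendsto_sub_nhds_zero_iff.2 hc
    have := (Asymptotics.isBigO_refl (fun t => t - t₀) (𝓝[s] t₀)).smul_isLittleO h0
    simpa using this
  refine ((h1.add h2).add ha).congr_left fun t => ?_
  simp only [map_sub, map_smul, smul_sub, smul_add]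
  abel

section Symmetry

variable {N n₀ : ℕ} {J : Matrix (Fin (2 * N)) (Fin (2 * N)) ℝ}
  {Dia : Fin n₀ → (L2 N →ₗ.[ℝ] L2 N)} {ord : Fin n₀ → ℕ} {G : Rn n₀ → (L2 N →L[ℝ] L2 N)}

lemma app_of_mem {T : L2 N →ₗ.[ℝ] L2 N} {u : L2 N} (h : u ∈ T.domain) :
    app T u = T ⟨u, h⟩ := by
  simp [app, h]

lemma app_of_notMem {T : L2 N →ₗ.[ℝ] L2 N} {u : L2 N} (h : u ∉ T.domain) : app T u = 0 := by
  simp [app, h]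

lemma app_add {T : L2 N →ₗ.[ℝ] L2 N} {u v : L2 N} (hu : u ∈ T.domain) (hv : v ∈ T.domain) :
    app T (u + v) = app T u + app T v := by
  rw [app_of_mem hu, app_of_mem hv, app_of_mem (T.domain.add_mem hu hv), ← T.map_add]
  rfl

lemma app_smul {T : L2 N →ₗ.[ℝ] L2 N} {u : L2 N} (c : ℝ) (hu : u ∈ T.domain) :
    app T (c • u) = c • app T u := by
  rw [app_of_mem hu, app_of_mem (T.domain.smul_mem c hu), ← T.map_smul]
  rfl

lemma app_sub {T : L2 N →ₗ.[ℝ] L2 N} {u v : L2 N} (hu : u ∈ T.domain) (hv : v ∈ T.domain) :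
    app T (u - v) = app T u - app T v := by
  rw [app_of_mem hu, app_of_mem hv, app_of_mem (T.domain.sub_mem hu hv), ← T.map_sub]
  rfl

namespace IsSymmetrySetup

variable (hsym : IsSymmetrySetup J Dia ord G)
include hsym

lemma inv_matOp (u : L2 N) : matOp J⁻¹ (matOp J u) = u := by
  rw [← matOp_mul, Matrix.nonsing_inv_mul _ hsym.invertible, matOp_one]

lemma matOp_inv (u : L2 N) : matOp J (matOp J⁻¹ u) = u := by
  rw [← matOp_mul, Matrix.mul_nonsing_inv _ hsym.invertible, matOp_one]

lemma inner_J (u v : L2 N) : ⟪matOp J u, v⟫_ℝ = -⟪u, matOp J v⟫_ℝ := by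
  rw [inner_matOp_left, hsym.antisymm, matOp_neg, inner_neg_right]

lemma dense_domain (j : Fin n₀) : Dense ((Dia j).domain : Set (L2 N)) :=
  (hsym.selfAdjoint j).dense_domain

lemma inner_Dia {j : Fin n₀} {u v : L2 N} (hu : u ∈ (Dia j).domain) (hv : v ∈ (Dia j).domain) :
    ⟪app (Dia j) u, v⟫_ℝ = ⟪u, app (Dia j) v⟫_ℝ := by
  have h := LinearPMap.adjoint_isFormalAdjoint (hsym.dense_domain j)
  have h2 := LinearPMap.isSelfAdjoint_def.1 (hsym.selfAdjoint j)
  rw [h2] at h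
  have := h ⟨u, hu⟩ ⟨v, hv⟩
  rw [app_of_mem hu, app_of_mem hv]
  exact this

lemma inner_JDia {j : Fin n₀} {u v : L2 N} (hu : u ∈ (Dia j).domain) (hv : v ∈ (Dia j).domain) :
    ⟪matOp J (app (Dia j) u), v⟫_ℝ = -⟪u, matOp J (app (Dia j) v)⟫_ℝ := by
  rw [hsym.inner_J, hsym.inner_Dia hu (hsym.comm_J j v hv).1, (hsym.comm_J j v hv).2]

lemma inner_JDia_self {j : Fin n₀} {u : L2 N} (hu : u ∈ (Dia j).domain) :
    ⟪u, matOp J (app (Dia j) u)⟫_ℝ = 0 := by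
  have := hsym.inner_JDia hu hu
  rw [real_inner_comm] at this
  linarith

lemma G_neg_apply (τ : Rn n₀) (u : L2 N) : G (-τ) (G τ u) = u := by
  have := hsym.group_add (-τ) τ
  rw [neg_add_cancel, hsym.group_zero] at this
  exact (DFunLike.congr_fun this u).symm

lemma G_apply_neg (τ : Rn n₀) (u : L2 N) : G τ (G (-τ) u) = u := by
  simpa using hsym.G_neg_apply (-τ) u

lemma G_add_apply (σ τ : Rn n₀) (u : L2 N) : G (σ + τ) u = G σ (G τ u) := by
  rw [hsym.group_add]; rfl

lemma G_comm (σ τ : Rn n₀) (u : L2 N) : G σ (G τ u) = G τ (G σ u) := by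
  rw [← hsym.G_add_apply, add_comm, hsym.G_add_apply]

lemma G_zero_apply (u : L2 N) : G 0 u = u := by
  rw [hsym.group_zero]; rfl

lemma G_mem_domain {j : Fin n₀} {u : L2 N} (hu : u ∈ (Dia j).domain) (τ : Rn n₀) :
    G τ u ∈ (Dia j).domain ∧ matOp J (app (Dia j) (G τ u)) = G τ (matOp J (app (Dia j) u)) := by
  rw [← hsym.generator]
  have h := (hsym.generator j u _).2 ⟨hu, rfl⟩
  have h2 := (G τ).hasFDerivAt.comp_hasDerivAt (0 : ℝ) h
  refine h2.congr_of_eventuallyEq (Eventually.of_forall fun t => ?_)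
  exact hsym.G_comm _ _ _

omit hsym in
/-- A property of `τ` which holds on the coordinate axes and is additive holds everywhere. -/
lemma Rn_induction {p : Rn n₀ → Prop} (h0 : p 0) (hadd : ∀ σ τ, p σ → p τ → p (σ + τ))
    (hax : ∀ j (c : ℝ), p (c • stdVec j)) (τ : Rn n₀) : p τ := by
  have e : τ = ∑ j, τ j • (stdVec j : Rn n₀) := by
    ext i
    simp [Finset.sum_apply, Pi.single_apply]
  rw [e]
  exact Finset.sum_induction _ p hadd h0 fun j _ => hax j _

/-- `v` is the derivative at `t = 0` of `e^{tJh·◇}u`. -/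
def Gen (G : Rn n₀ → (L2 N →L[ℝ] L2 N)) (h : Rn n₀) (u v : L2 N) : Prop :=
  HasDerivAt (fun t : ℝ => G (t • h) u) v 0

lemma hasDerivAt_line {h : Rn n₀} {u v : L2 N} (hg : Gen G h u v) (q : Rn n₀) (t : ℝ) :
    HasDerivAt (fun t : ℝ => G (q + t • h) u) (G (q + t • h) v) t := by
  have h1 : HasDerivAt (fun s : ℝ => G (s • h) u) v (t - t) := by rwa [sub_self]
  have h2 := h1.comp_sub_const t t
  have h3 := (G (q + t • h)).hasFDerivAt.comp_hasDerivAt t h2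
  refine h3.congr_of_eventuallyEq (Eventually.of_forall fun s => ?_)
  change G (q + s • h) u = G (q + t • h) (G ((s - t) • h) u)
  rw [← hsym.G_add_apply]
  congr 2
  module

lemma gen_axis {j : Fin n₀} {u : L2 N} (hu : u ∈ (Dia j).domain) (c : ℝ) :
    Gen G (c • stdVec j) u (c • matOp J (app (Dia j) u)) := by
  have h := (hsym.generator j u _).2 ⟨hu, rfl⟩
  have h1 : HasDerivAt (fun t : ℝ => G (t • stdVec j) u) (matOp J (app (Dia j) u)) (0 * c) := by
    rwa [zero_mul]
  have h2 := HasDerivAt.scomp (0 : ℝ) h1 ((hasDerivAt_id (0 : ℝ)).mul_const c)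
  rw [one_mul] at h2
  refine h2.congr_of_eventuallyEq (Eventually.of_forall fun t => ?_)
  simp [smul_smul]

lemma norm_G (τ : Rn n₀) : ∀ u, ‖G τ u‖ = ‖u‖ := by
  refine Rn_induction (p := fun τ => ∀ u, ‖G τ u‖ = ‖u‖) (fun u => by rw [hsym.G_zero_apply])
    (fun σ τ hσ hτ u => by rw [hsym.G_add_apply, hσ, hτ]) (fun j c u => ?_) τ
  refine (hsym.dense_domain j).induction (P := fun u => ‖G (c • stdVec j) u‖ = ‖u‖)
    (fun u hu => ?_) (isClosed_eq (by fun_prop) (by fun_prop)) u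
  have hd : ∀ t : ℝ, HasDerivAt (fun t : ℝ => ⟪G (t • stdVec j) u, G (t • stdVec j) u⟫_ℝ)
      0 t := by
    intro t
    have h1 := hsym.hasDerivAt_line (h := stdVec j) ((hsym.generator j u _).2 ⟨hu, rfl⟩) 0 t
    simp only [zero_add] at h1
    have h2 := h1.inner ℝ h1
    rw [← (hsym.G_mem_domain hu (t • stdVec j)).2, real_inner_comm (G (t • stdVec j) u),
      hsym.inner_JDia_self (hsym.G_mem_domain hu _).1, add_zero] at h2
    exact h2
  have h3 := is_const_of_deriv_eq_zero (fun t => (hd t).differentiableAt) (fun t => (hd t).deriv)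
    c 0
  simp only [zero_smul, hsym.G_zero_apply, real_inner_self_eq_norm_sq] at h3
  exact (sq_eq_sq₀ (norm_nonneg _) (norm_nonneg _)).1 h3

lemma opNorm_G_le (τ : Rn n₀) : ‖G τ‖ ≤ 1 :=
  ContinuousLinearMap.opNorm_le_bound _ zero_le_one fun u => by rw [hsym.norm_G, one_mul]

lemma inner_G_G (τ : Rn n₀) (u v : L2 N) : ⟪G τ u, G τ v⟫_ℝ = ⟪u, v⟫_ℝ :=
  LinearIsometry.inner_map_map ⟨(G τ).toLinearMap, hsym.norm_G τ⟩ u v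

lemma inner_G_left (τ : Rn n₀) (u v : L2 N) : ⟪G τ u, v⟫_ℝ = ⟪u, G (-τ) v⟫_ℝ := by
  rw [← hsym.inner_G_G τ u (G (-τ) v), hsym.G_apply_neg]

lemma gen_add {h₁ h₂ : Rn n₀} {u v₁ v₂ : L2 N} (hg₁ : Gen G h₁ u v₁) (hg₂ : Gen G h₂ u v₂) :
    Gen G (h₁ + h₂) u (v₁ + v₂) := by
  have hc : Continuous fun t : ℝ => G (t • h₁) v₂ :=
    (hsym.group_cont v₂).comp (by fun_prop)
  have h := hasDerivWithinAt_clm_apply (A := fun t : ℝ => G (t • h₁)) (C := 1) (s := univ)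
    (t₀ := 0) (y := fun t => G (t • h₂) u) (y' := v₂) (a := v₁)
    (fun t => hsym.opNorm_G_le _) hg₂.hasDerivWithinAt hc.continuousWithinAt (by
      have h1 : HasDerivAt (fun t : ℝ => G (t • h₁) u) v₁ 0 := hg₁
      simpa [hsym.G_zero_apply] using h1)
  rw [hasDerivWithinAt_univ, zero_smul, hsym.G_zero_apply, add_comm] at h
  refine h.congr_of_eventuallyEq (Eventually.of_forall fun t => ?_)
  change G (t • (h₁ + h₂)) u = G (t • h₁) (G (t • h₂) u)
  rw [smul_add, hsym.G_add_apply]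

lemma gen_of_mem {u : L2 N} (hu : ∀ j, u ∈ (Dia j).domain) (h : Rn n₀) :
    Gen G h u (∑ j, h j • matOp J (app (Dia j) u)) := by
  have key : ∀ s : Finset (Fin n₀),
      Gen G (∑ j ∈ s, h j • stdVec j) u (∑ j ∈ s, h j • matOp J (app (Dia j) u)) := by
    classical
    intro s
    induction s using Finset.induction_on with
    | empty =>
      simp only [Finset.sum_empty]
      simpa [Gen, hsym.G_zero_apply] using hasDerivAt_const (0 : ℝ) u
    | insert a s ha ih =>
      rw [Finset.sum_insert ha, Finset.sum_insert ha]
      exact hsym.gen_add (hsym.gen_axis (hu a) _) ih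
  have e : h = ∑ j, h j • (stdVec j : Rn n₀) := by
    ext i
    simp [Finset.sum_apply, Pi.single_apply]
  conv => enter [2]; rw [e]
  exact key _

lemma G_matOp (τ : Rn n₀) : ∀ u, G τ (matOp J u) = matOp J (G τ u) := by
  refine Rn_induction (p := fun τ => ∀ u, G τ (matOp J u) = matOp J (G τ u))
    (fun u => by rw [hsym.G_zero_apply, hsym.G_zero_apply])
    (fun σ τ hσ hτ u => by rw [hsym.G_add_apply, hτ, hσ, hsym.G_add_apply]) (fun j c u => ?_) τ
  refine (hsym.dense_domain j).induction
    (P := fun u => G (c • stdVec j) (matOp J u) = matOp J (G (c • stdVec j) u))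
    (fun u hu => ?_) (isClosed_eq (by fun_prop) (by fun_prop)) u
  -- the difference `w` of the two sides solves `w' = J◇w`, so that its norm is constant
  let w : ℝ → L2 N := fun t => G (t • stdVec j) (matOp J u) - matOp J (G (t • stdVec j) u)
  have hJu := hsym.comm_J j u hu
  have hw : ∀ t, HasDerivAt w (matOp J (app (Dia j) (w t))) t ∧ w t ∈ (Dia j).domain := by
    intro t
    have h1 := hsym.hasDerivAt_line (h := stdVec j)
      ((hsym.generator j (matOp J u) _).2 ⟨hJu.1, rfl⟩) 0 t
    have h2 := hsym.hasDerivAt_line (h := stdVec j) ((hsym.generator j u _).2 ⟨hu, rfl⟩) 0 t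
    simp only [zero_add] at h1 h2
    have h3 := h1.sub ((matOp J).hasFDerivAt.comp_hasDerivAt t h2)
    have m1 := hsym.G_mem_domain hJu.1 (t • stdVec j)
    have m2 := hsym.G_mem_domain hu (t • stdVec j)
    have m3 := hsym.comm_J j _ m2.1
    refine ⟨?_, (Dia j).domain.sub_mem m1.1 m3.1⟩
    rw [app_sub m1.1 m3.1, map_sub, m1.2, m3.2, m2.2]
    exact h3
  have hd : ∀ t, HasDerivAt (fun t => ⟪w t, w t⟫_ℝ) 0 t := by
    intro t
    have h2 := (hw t).1.inner ℝ (hw t).1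
    rw [real_inner_comm (w t), hsym.inner_JDia_self (hw t).2, add_zero] at h2
    exact h2
  have h3 := is_const_of_deriv_eq_zero (fun t => (hd t).differentiableAt) (fun t => (hd t).deriv)
    c 0
  have h0 : w 0 = 0 := by simp [w, hsym.G_zero_apply]
  simp only [h0, inner_zero_left] at h3
  exact sub_eq_zero.1 (inner_self_eq_zero.1 h3)

lemma app_G (j : Fin n₀) (τ : Rn n₀) (u : L2 N) :
    app (Dia j) (G τ u) = G τ (app (Dia j) u) := by
  by_cases hu : u ∈ (Dia j).domain
  · have h := (hsym.G_mem_domain hu τ).2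
    rw [hsym.G_matOp] at h
    have := congrArg (matOp J⁻¹) h
    rwa [hsym.inv_matOp, hsym.inv_matOp] at this
  · have h2 : G τ u ∉ (Dia j).domain := fun h => hu (by
      have := (hsym.G_mem_domain h (-τ)).1
      rwa [hsym.G_neg_apply] at this)
    rw [app_of_notMem hu, app_of_notMem h2, map_zero]

/-- The functionals `Π_j` are invariant under the group. -/
lemma momentum_G (τ : Rn n₀) (u : L2 N) : momentum Dia (G τ u) = momentum Dia u := by
  simp only [momentum, hsym.app_G, hsym.inner_G_G]

end IsSymmetrySetup
end Symmetry

/-! ### The group `e^{Jτ·◇}` on the spaces `Σ_n` -/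

section PartialDerivatives

variable {n₀ : ℕ} {W : Type*} [NormedAddCommGroup W] [NormedSpace ℝ W]

/-- The linear map on `ℝ^{n₀}` with the values `w j` on the standard basis. -/
def ofPartials (w : Fin n₀ → W) : Rn n₀ →L[ℝ] W :=
  ∑ j, (EuclideanSpace.proj j : Rn n₀ →L[ℝ] ℝ).smulRight (w j)

@[simp] lemma ofPartials_apply (w : Fin n₀ → W) (h : Rn n₀) :
    ofPartials w h = ∑ j, h j • w j := by
  simp [ofPartials]

lemma contDiff_ofPartials {E : Type*} [NormedAddCommGroup E] [NormedSpace ℝ E] {k : WithTop ℕ∞}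
    {w : Fin n₀ → E → W} (hw : ∀ j, ContDiff ℝ k (w j)) :
    ContDiff ℝ k fun q => ofPartials fun j => w j q := by
  unfold ofPartials
  refine ContDiff.sum fun j _ => ?_
  exact (ContinuousLinearMap.smulRightL ℝ (Rn n₀) W (EuclideanSpace.proj j)).contDiff.comp (hw j)

lemma continuous_ofPartials {E : Type*} [TopologicalSpace E]
    {w : Fin n₀ → E → W} (hw : ∀ j, Continuous (w j)) :
    Continuous fun q => ofPartials fun j => w j q := by
  unfold ofPartials
  refine continuous_finsetSum _ fun j _ => ?_
  exact (ContinuousLinearMap.smulRightL ℝ (Rn n₀) W (EuclideanSpace.proj j)).continuous.comp (hw j)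

lemma contDiff_succ_of_partials {f : Rn n₀ → W} {w : Fin n₀ → Rn n₀ → W} {k : ℕ}
    (hf : ∀ q, HasFDerivAt f (ofPartials fun j => w j q) q) (hw : ∀ j, ContDiff ℝ k (w j)) :
    ContDiff ℝ ((k + 1 : ℕ) : WithTop ℕ∞) f := by
  rw [Nat.cast_add, Nat.cast_one, contDiff_succ_iff_hasFDerivAt]
  exact ⟨fun q => ofPartials fun j => w j q, contDiff_ofPartials hw, hf⟩

end PartialDerivatives

section Scale

variable {N n₀ : ℕ} {J : Matrix (Fin (2 * N)) (Fin (2 * N)) ℝ}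
  {Dia : Fin n₀ → (L2 N →ₗ.[ℝ] L2 N)} {ord : Fin n₀ → ℕ} {G : Rn n₀ → (L2 N →L[ℝ] L2 N)}

/-- The matrix `J` on `Σ_n`. -/
def jS (A : Matrix (Fin (2 * N)) (Fin (2 * N)) ℝ) (n : ℕ) : Sg N n →L[ℝ] Sg N n :=
  (exists_lift ((matOp A).comp fn) fun u : Sg N n => exists_fn_eq_matOp A u).choose

@[simp] lemma fn_jS (A : Matrix (Fin (2 * N)) (Fin (2 * N)) ℝ) {n : ℕ} (u : Sg N n) :
    fn (jS A n u) = matOp A (fn u) :=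
  (exists_lift ((matOp A).comp fn) fun u : Sg N n => exists_fn_eq_matOp A u).choose_spec u

namespace IsSymmetrySetup

variable (hsym : IsSymmetrySetup J Dia ord G)
include hsym

lemma exists_gS (n : ℕ) (τ : Rn n₀) :
    ∃ B : Sg N n →L[ℝ] Sg N n, ∀ u, fn (B u) = G τ (fn u) := by
  refine exists_lift ((G τ).comp fn) fun u => ?_
  obtain ⟨C, hC⟩ := hsym.group_bound n (‖τ‖ + 1) (by positivity)
  obtain ⟨v, hv, -⟩ := hC τ (by linarith) u
  exact ⟨v, hv⟩

/-- The operators `e^{Jτ·◇}` on `Σ_n`. -/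
def gS (n : ℕ) (τ : Rn n₀) : Sg N n →L[ℝ] Sg N n := (hsym.exists_gS n τ).choose

@[simp] lemma fn_gS {n : ℕ} (τ : Rn n₀) (u : Sg N n) : fn (hsym.gS n τ u) = G τ (fn u) :=
  (hsym.exists_gS n τ).choose_spec u

lemma gS_zero (n : ℕ) : hsym.gS n 0 = 1 := by
  ext u
  refine fn_injective ?_
  rw [hsym.fn_gS, hsym.G_zero_apply]
  rfl

lemma gS_add (n : ℕ) (σ τ : Rn n₀) : hsym.gS n (σ + τ) = (hsym.gS n σ).comp (hsym.gS n τ) := by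
  ext u
  refine fn_injective ?_
  rw [hsym.fn_gS, hsym.G_add_apply]
  simp

lemma gS_bound (n : ℕ) (c : ℝ) : ∃ C, 0 ≤ C ∧ ∀ τ, ‖τ‖ ≤ c → ‖hsym.gS n τ‖ ≤ C := by
  obtain ⟨C, hC⟩ := hsym.group_bound n (max c 1) (by positivity)
  refine ⟨max C 0, le_max_right _ _, fun τ hτ => ?_⟩
  refine ContinuousLinearMap.opNorm_le_bound _ (le_max_right _ _) fun u => ?_
  obtain ⟨v, hv, hb⟩ := hC τ (hτ.trans (le_max_left _ _)) u
  have : hsym.gS n τ u = v := fn_injective (by rw [hv, hsym.fn_gS])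
  rw [this]
  exact hb.trans (by gcongr; exact le_max_left _ _)

lemma tendsto_gS_axis (n : ℕ) (j : Fin n₀) (x : Sg N n) :
    Tendsto (fun t : ℝ => hsym.gS n (t • stdVec j) x) (𝓝 0) (𝓝 x) := by
  obtain ⟨C, -, hC⟩ := hsym.gS_bound n 1
  refine tendsto_group_zero (fun t : ℝ => hsym.gS n (t • stdVec j)) ?_ ?_ (C := C) ?_ ?_ x
  · simp [hsym.gS_zero]
  · intro s t
    simp only [add_smul, hsym.gS_add]
  · intro t ht
    refine hC _ ?_
    simpa [norm_smul] using ht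
  · intro x y
    refine continuous_inner_of_continuous_fn (f := fun t : ℝ => hsym.gS n (t • stdVec j) x) ?_ ?_ y
    · simp only [hsym.fn_gS]
      exact (hsym.group_cont _).comp (by fun_prop)
    · intro c
      obtain ⟨C, hC0, hC⟩ := hsym.gS_bound n c
      refine ⟨C * ‖x‖, fun t ht => ContinuousLinearMap.le_of_opNorm_le _ (hC _ ?_) _⟩
      simpa [norm_smul] using ht

/-- The group is strongly continuous on `Σ_n`. -/
lemma continuous_gS (n : ℕ) (x : Sg N n) : Continuous fun q => hsym.gS n q x := by
  obtain ⟨C, hC0, hC⟩ := hsym.gS_bound n 1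
  have key : ∀ (s : Finset (Fin n₀)) (x : Sg N n),
      Tendsto (fun q : Rn n₀ => hsym.gS n (∑ j ∈ s, q j • stdVec j) x) (𝓝 0) (𝓝 x) := by
    classical
    intro s x
    induction s using Finset.induction_on with
    | empty => simp [hsym.gS_zero]
    | insert a s ha ih =>
      simp only [Finset.sum_insert ha, hsym.gS_add]
      have hproj : Tendsto (fun q : Rn n₀ => q a) (𝓝 0) (𝓝 0) := by
        have : Continuous fun q : Rn n₀ => q a := by fun_prop
        simpa using this.tendsto 0
      have h1 := (hsym.tendsto_gS_axis n a x).comp hproj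
      have h2 : Tendsto (fun q : Rn n₀ => hsym.gS n (q a • stdVec a)
          (hsym.gS n (∑ j ∈ s, q j • stdVec j) x - x)) (𝓝 0) (𝓝 0) := by
        have h3 : Tendsto (fun q : Rn n₀ => C * ‖hsym.gS n (∑ j ∈ s, q j • stdVec j) x - x‖)
            (𝓝 0) (𝓝 0) := by
          simpa using (tendsto_iff_norm_sub_tendsto_zero.1 ih).const_mul C
        refine squeeze_zero_norm' ?_ h3
        have hn : ∀ᶠ q : Rn n₀ in 𝓝 0, ‖q a‖ ≤ 1 := by
          have := hproj.norm
          rw [norm_zero] at this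
          exact this.eventually (eventually_le_nhds one_pos)
        filter_upwards [hn] with q hq
        refine ContinuousLinearMap.le_of_opNorm_le _ (hC _ ?_) _
        simpa [norm_smul] using hq
      have h4 := h2.add h1
      rw [zero_add] at h4
      refine h4.congr fun q => ?_
      simp
  have h0 : Tendsto (fun q : Rn n₀ => hsym.gS n q x) (𝓝 0) (𝓝 x) := by
    refine (key Finset.univ x).congr fun q => ?_
    congr 2
    ext i
    simp [Finset.sum_apply, Pi.single_apply]
  rw [continuous_iff_continuousAt]
  intro q₀
  have h1 : Tendsto (fun q : Rn n₀ => q - q₀) (𝓝 q₀) (𝓝 0) := by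
    have : Continuous fun q : Rn n₀ => q - q₀ := by fun_prop
    simpa using this.tendsto q₀
  have h2 := (((hsym.gS n q₀).continuous.tendsto x).comp h0).comp h1
  refine h2.congr fun q => ?_
  change hsym.gS n q₀ (hsym.gS n (q - q₀) x) = _
  rw [← ContinuousLinearMap.comp_apply, ← hsym.gS_add, add_sub_cancel]

/-- Joint continuity of `(q, x) ↦ e^{Jq·◇}x` on `Σ_n`. -/
lemma continuous_gS_uncurry (n : ℕ) :
    Continuous fun z : Rn n₀ × Sg N n => hsym.gS n z.1 z.2 := by
  rw [continuous_iff_continuousAt]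
  rintro ⟨q, x⟩
  obtain ⟨C, hC0, hC⟩ := hsym.gS_bound n (‖q‖ + 1)
  have h1 : Tendsto (fun z : Rn n₀ × Sg N n => hsym.gS n z.1 x) (𝓝 (q, x))
      (𝓝 (hsym.gS n q x)) :=
    ((hsym.continuous_gS n x).comp continuous_fst).tendsto (q, x)
  have h2 : Tendsto (fun z : Rn n₀ × Sg N n => hsym.gS n z.1 (z.2 - x)) (𝓝 (q, x)) (𝓝 0) := by
    have h3 : Tendsto (fun z : Rn n₀ × Sg N n => C * ‖z.2 - x‖) (𝓝 (q, x)) (𝓝 0) := by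
      have : Continuous fun z : Rn n₀ × Sg N n => C * ‖z.2 - x‖ := by fun_prop
      simpa using this.tendsto (q, x)
    refine squeeze_zero_norm' ?_ h3
    have hn : ∀ᶠ z : Rn n₀ × Sg N n in 𝓝 (q, x), ‖z.1‖ ≤ ‖q‖ + 1 := by
      have : Continuous fun z : Rn n₀ × Sg N n => ‖z.1‖ := by fun_prop
      exact (this.tendsto (q, x)).eventually (eventually_le_nhds (by simp))
    filter_upwards [hn] with z hz
    exact ContinuousLinearMap.le_of_opNorm_le _ (hC _ hz) _
  have h4 := h2.add h1
  rw [zero_add] at h4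
  refine h4.congr fun z => ?_
  simp

variable {d : ℕ} (hd : ∀ j, ord j ≤ d)
include hd

omit hd in
lemma exists_dS (j : Fin n₀) {n m : ℕ} (h : n + ord j ≤ m) :
    ∃ B : Sg N m →L[ℝ] Sg N n, ∀ u, fn u ∈ (Dia j).domain ∧ fn (B u) = app (Dia j) (fn u) := by
  have hmaps : ∀ u : Sg N m, fn u ∈ (Dia j).domain ∧ ∃ v : Sg N n, fn v = app (Dia j) (fn u) := by
    intro u
    have := hsym.maps j n (sgIncl h u)
    rwa [fn_sgIncl] at this
  choose hdom b hb using hmaps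
  let B : Sg N m →ₗ[ℝ] Sg N n :=
    { toFun := b
      map_add' := fun x y => fn_injective (by
        rw [map_add, hb, hb, hb, map_add, app_add (hdom x) (hdom y)])
      map_smul' := fun c x => fn_injective (by
        rw [RingHom.id_apply, map_smul, hb, hb, map_smul, app_smul c (hdom x)]) }
  have hcl : IsClosed (B.graph : Set (Sg N m × Sg N n)) := by
    have : (B.graph : Set (Sg N m × Sg N n))
        = (fun p : Sg N m × Sg N n => (fn p.1, fn p.2)) ⁻¹'
          ((Dia j).graph : Set (L2 N × L2 N)) := by
      ext p
      rw [SetLike.mem_coe, LinearMap.mem_graph_iff, mem_preimage, SetLike.mem_coe,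
        LinearPMap.mem_graph_iff]
      constructor
      · intro hp
        refine ⟨⟨fn p.1, hdom _⟩, rfl, ?_⟩
        rw [hp, ← app_of_mem (hdom p.1)]
        exact (hb _).symm
      · rintro ⟨y, hy1, hy2⟩
        refine fn_injective ?_
        change fn p.2 = fn (b p.1)
        rw [hb, app_of_mem (hdom p.1)]
        simp only at hy1 hy2
        rw [← hy2]
        congr 1
        exact Subtype.ext hy1
    rw [this]
    exact IsClosed.preimage (by fun_prop) (hsym.selfAdjoint j).isClosed
  exact ⟨⟨B, B.continuous_of_isClosed_graph hcl⟩, fun u => ⟨hdom u, hb u⟩⟩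

omit hd in
lemma fn_mem_domain {j : Fin n₀} {m : ℕ} (h : ord j ≤ m) (u : Sg N m) : fn u ∈ (Dia j).domain :=
  ((hsym.exists_dS j (n := 0) (m := m) (by omega)).choose_spec u).1

/-- The operator `◇_j` from `Σ_m` to `Σ_n`, where `n + d ≤ m`. -/
def dS (j : Fin n₀) {n m : ℕ} (h : n + d ≤ m) : Sg N m →L[ℝ] Sg N n :=
  (hsym.exists_dS j (n := n) (m := m) (by have := hd j; omega)).choose

@[simp] lemma fn_dS (j : Fin n₀) {n m : ℕ} (h : n + d ≤ m) (u : Sg N m) :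
    fn (hsym.dS hd j h u) = app (Dia j) (fn u) :=
  ((hsym.exists_dS j (n := n) (m := m) (by have := hd j; omega)).choose_spec u).2

/-- The operator `J◇_j` from `Σ_m` to `Σ_n`, where `n + d ≤ m`. -/
def bS (j : Fin n₀) {n m : ℕ} (h : n + d ≤ m) : Sg N m →L[ℝ] Sg N n :=
  (jS J n).comp (hsym.dS hd j h)

@[simp] lemma fn_bS (j : Fin n₀) {n m : ℕ} (h : n + d ≤ m) (u : Sg N m) :
    fn (hsym.bS hd j h u) = matOp J (app (Dia j) (fn u)) := by
  simp [bS]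

/-- The operator `e^{Jq·◇}` from `Σ_m` to `Σ_n`, where `n ≤ m`. -/
def gI {n m : ℕ} (h : n ≤ m) (q : Rn n₀) : Sg N m →L[ℝ] Sg N n := (hsym.gS n q).comp (sgIncl h)

omit hd in
@[simp] lemma fn_gI {n m : ℕ} (h : n ≤ m) (q : Rn n₀) (u : Sg N m) :
    fn (hsym.gI h q u) = G q (fn u) := by
  simp [gI]

omit hd in
lemma continuous_gI_uncurry {n m : ℕ} (h : n ≤ m) :
    Continuous fun z : Rn n₀ × Sg N m => hsym.gI h z.1 z.2 :=
  (hsym.continuous_gS_uncurry n).comp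
    (continuous_fst.prodMk ((sgIncl h).continuous.comp continuous_snd))

lemma hasDerivAt_G_line {m : ℕ} (h : d ≤ m) (x : Sg N m) (q v : Rn n₀) (t : ℝ) :
    HasDerivAt (fun t : ℝ => G (q + t • v) (fn x))
      (G (q + t • v) (∑ j, v j • matOp J (app (Dia j) (fn x)))) t :=
  hsym.hasDerivAt_line
    (hsym.gen_of_mem (fun j => hsym.fn_mem_domain ((hd j).trans h) x) v) q t

lemma hasDerivAt_gI_line {n m : ℕ} (h : n + d ≤ m) (x : Sg N m) (q v : Rn n₀) (t : ℝ) :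
    HasDerivAt (fun t : ℝ => hsym.gI (n := n) (m := m) (by omega) (q + t • v) x)
      (hsym.gS n (q + t • v) (∑ j, v j • hsym.bS hd j h x)) t := by
  refine hasDerivAt_of_hasDerivAt_fn
    (g := fun t => hsym.gS n (q + t • v) (∑ j, v j • hsym.bS hd j h x)) ?_ (fun t => ?_) t
  · exact (hsym.continuous_gS n _).comp (by fun_prop)
  · have := hsym.hasDerivAt_G_line hd (by omega : d ≤ m) x q v t
    simpa using this

/-- On `Σ_{n + d}` the group is differentiable in `Σ_n`. -/
lemma hasFDerivAt_gI_apply {n m : ℕ} (h : n + d ≤ m) (x : Sg N m) (q : Rn n₀) :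
    HasFDerivAt (fun q => hsym.gI (n := n) (m := m) (by omega) q x)
      (ofPartials fun j => hsym.gS n q (hsym.bS hd j h x)) q := by
  refine hasFDerivAt_of_hasDerivAt_lines
    (f' := fun q => ofPartials fun j => hsym.gS n q (hsym.bS hd j h x))
    (continuous_ofPartials fun j => hsym.continuous_gS n _) (fun q v t => ?_) q
  have := hsym.hasDerivAt_gI_line hd h x q v t
  simpa using this

/-- `q ↦ e^{Jq·◇}` is locally Lipschitz with values in the operators from `Σ_{n+d}` to `Σ_n`. -/
lemma gI_lipschitz {n m : ℕ} (h : n + d ≤ m) (c : ℝ) : ∃ C, 0 ≤ C ∧ ∀ q q' : Rn n₀,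
    ‖q‖ ≤ c → ‖q'‖ ≤ c → ‖hsym.gI (n := n) (m := m) (by omega) q
      - hsym.gI (n := n) (m := m) (by omega) q'‖ ≤ C * ‖q - q'‖ := by
  obtain ⟨C, hC0, hC⟩ := hsym.gS_bound n c
  refine ⟨C * ∑ j, ‖hsym.bS hd j h‖, by positivity, fun q q' hq hq' => ?_⟩
  refine ContinuousLinearMap.opNorm_le_bound _ (by positivity) fun x => ?_
  rw [sub_apply]
  have := (convex_closedBall (0 : Rn n₀) c).norm_image_sub_le_of_norm_hasFDerivWithin_le
    (f := fun q => hsym.gI (n := n) (m := m) (by omega) q x)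
    (f' := fun q => ofPartials fun j => hsym.gS n q (hsym.bS hd j h x))
    (C := C * (∑ j, ‖hsym.bS hd j h‖) * ‖x‖) (x := q') (y := q)
    (fun z _ => (hsym.hasFDerivAt_gI_apply hd h x z).hasFDerivWithinAt) ?_ (by simpa using hq')
    (by simpa using hq)
  · linarith
  · intro z hz
    refine ContinuousLinearMap.opNorm_le_bound _ (by positivity) fun v => ?_
    rw [ofPartials_apply, Finset.mul_sum, Finset.sum_mul, Finset.sum_mul]
    refine norm_sum_le_of_le _ fun j _ => ?_
    rw [norm_smul]
    have h1 : ‖v j‖ ≤ ‖v‖ := PiLp.norm_apply_le v j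
    have h2 : ‖hsym.gS n z (hsym.bS hd j h x)‖ ≤ C * (‖hsym.bS hd j h‖ * ‖x‖) :=
      ((hsym.gS n z).le_of_opNorm_le (hC z (by simpa using hz)) _).trans
        (by gcongr; exact ContinuousLinearMap.le_opNorm _ _)
    calc ‖v j‖ * ‖hsym.gS n z (hsym.bS hd j h x)‖
        ≤ ‖v‖ * (C * (‖hsym.bS hd j h‖ * ‖x‖)) := by gcongr
      _ = _ := by ring

lemma continuous_gI_op {n m : ℕ} (h : n + d ≤ m) :
    Continuous fun q => hsym.gI (n := n) (m := m) (by omega) q := by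
  rw [continuous_iff_continuousAt]
  intro q
  obtain ⟨C, hC0, hC⟩ := hsym.gI_lipschitz hd h (‖q‖ + 1)
  rw [ContinuousAt, tendsto_iff_norm_sub_tendsto_zero]
  have hlim : Tendsto (fun q' => C * ‖q' - q‖) (𝓝 q) (𝓝 0) := by
    have : Continuous fun q' => C * ‖q' - q‖ := by fun_prop
    simpa using this.tendsto q
  refine squeeze_zero' (Eventually.of_forall fun _ => norm_nonneg _) ?_ hlim
  have hn : ∀ᶠ z : Rn n₀ in 𝓝 q, ‖z‖ ≤ ‖q‖ + 1 :=
    (continuous_norm.tendsto q).eventually (eventually_le_nhds (by simp))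
  filter_upwards [hn] with z hz using hC z q hz (by linarith)

lemma gI_comp_bS {n p m : ℕ} (h : n + d ≤ m) (h1 : n ≤ p) (h2 : p + d ≤ m) (j : Fin n₀)
    (q : Rn n₀) (x : Sg N m) :
    hsym.gS n q (hsym.bS hd j h x) = hsym.gI h1 q (hsym.bS hd j h2 x) :=
  fn_injective (by simp)

/-- `q ↦ e^{Jq·◇}` is of class `C^k` with values in the operators from `Σ_{n+(k+1)d}` to `Σ_n`. -/
lemma contDiff_gI_op (k : ℕ) : ∀ {n m : ℕ} (_ : n + (k + 1) * d ≤ m) (hnm : n ≤ m),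
    ContDiff ℝ k fun q => hsym.gI hnm q := by
  induction k with
  | zero =>
    intro n m h hnm
    rw [Nat.cast_zero, contDiff_zero]
    exact hsym.continuous_gI_op hd (by simpa using h)
  | succ k ih =>
    intro n m h hnm
    have h1 : n + (k + 1) * d + d ≤ m := by
      have : (k + 1 + 1) * d = (k + 1) * d + d := by ring
      omega
    have h2 : n + d ≤ m := by
      have : d ≤ (k + 1) * d + d := by omega
      omega
    have h3 : n ≤ n + (k + 1) * d := by omega
    refine contDiff_succ_of_partials (f := fun q => hsym.gI hnm q)
      (w := fun j q => (hsym.gI h3 q).comp (hsym.bS hd j h1)) (fun q => ?_) (fun j => ?_)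
    · refine hasFDerivAt_clm_of_pointwise (A := fun q => hsym.gI hnm q)
        (A' := fun q => ofPartials fun j => (hsym.gI h3 q).comp (hsym.bS hd j h1)) ?_ ?_ q
      · refine continuous_ofPartials fun j => ?_
        exact (ih (n := n) (m := n + (k + 1) * d) le_rfl h3).continuous.clm_comp continuous_const
      · intro x q
        have e : (ofPartials fun j => (hsym.gI h3 q).comp (hsym.bS hd j h1)).flip x
            = ofPartials fun j => hsym.gS n q (hsym.bS hd j h2 x) := by
          ext v
          simp [hsym.gI_comp_bS hd h2 h3 h1, sum_apply]
        rw [e]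
        exact hsym.hasFDerivAt_gI_apply hd h2 x q
    · exact (ih (n := n) (m := n + (k + 1) * d) le_rfl h3).clm_comp contDiff_const

/-- `(q, x) ↦ e^{Jq·◇}x` is of class `C^k` from `ℝ^{n₀} × Σ_{n+kd}` to `Σ_n`. -/
lemma contDiff_gI_uncurry (k : ℕ) : ∀ {n m : ℕ} (_ : n + k * d ≤ m) (hnm : n ≤ m),
    ContDiff ℝ k fun z : Rn n₀ × Sg N m => hsym.gI hnm z.1 z.2 := by
  induction k with
  | zero =>
    intro n m h hnm
    rw [Nat.cast_zero, contDiff_zero]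
    exact hsym.continuous_gI_uncurry hnm
  | succ k ih =>
    intro n m h hnm
    have h1 : n + k * d + d ≤ m := by
      have : (k + 1) * d = k * d + d := by ring
      omega
    have h2 : n + d ≤ m := by omega
    have h3 : n ≤ n + k * d := by omega
    rw [Nat.cast_add, Nat.cast_one, contDiff_succ_iff_hasFDerivAt]
    refine ⟨fun z => (ofPartials fun j => hsym.gI h3 z.1 (hsym.bS hd j h1 z.2)).comp
      (ContinuousLinearMap.fst ℝ (Rn n₀) (Sg N m))
      + (hsym.gI hnm z.1).comp (ContinuousLinearMap.snd ℝ (Rn n₀) (Sg N m)), ?_, ?_⟩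
    · refine ContDiff.add (ContDiff.clm_comp (contDiff_ofPartials fun j => ?_) contDiff_const)
        (ContDiff.clm_comp ?_ contDiff_const)
      · exact (ih (n := n) (m := n + k * d) le_rfl h3).comp
          (contDiff_fst.prodMk ((hsym.bS hd j h1).contDiff.comp contDiff_snd))
      · exact (hsym.contDiff_gI_op hd k h hnm).comp contDiff_fst
    · rintro ⟨q, x⟩
      have h4 := hsym.hasFDerivAt_gI_apply hd h2 x q
      simp only [hsym.gI_comp_bS hd h2 h3 h1] at h4
      exact hasFDerivAt_apply_of_continuousAt (A := fun q => hsym.gI hnm q)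
        (hsym.continuous_gI_op hd h2).continuousAt h4

end IsSymmetrySetup
end Scale

/-! ### The projection `P_{N_g}` and its extension to `Σ_{-r}` -/

section Projection

variable {N n₀ : ℕ} {J : Matrix (Fin (2 * N)) (Fin (2 * N)) ℝ}
  {Dia : Fin n₀ → (L2 N →ₗ.[ℝ] L2 N)} {ord : Fin n₀ → ℕ} {G : Rn n₀ → (L2 N →L[ℝ] L2 N)}
  {O : Set (Rn n₀)} {Φ : Rn n₀ → L2 N} {p₀ : Rn n₀}

@[simp] lemma toSd_apply {n : ℕ} (f : L2 N) (w : Sg N n) : toSd n f w = ⟪f, fn w⟫_ℝ := rfl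

/-- The inclusion `L² ⊆ Σ_{-n}` as a bounded operator. -/
def toSdL (N n : ℕ) : L2 N →L[ℝ] Sd N n :=
  LinearMap.mkContinuous
    { toFun := toSd n
      map_add' := fun x y => by ext w; simp [inner_add_left]
      map_smul' := fun c x => by ext w; simp [inner_smul_left] } ‖(fn : Sg N n →L[ℝ] L2 N)‖
    (fun x => by
      refine ContinuousLinearMap.opNorm_le_bound _ (by positivity) fun w => ?_
      calc ‖⟪x, fn w⟫_ℝ‖ ≤ ‖x‖ * ‖fn w‖ := norm_inner_le_norm _ _
        _ ≤ ‖x‖ * (‖(fn : Sg N n →L[ℝ] L2 N)‖ * ‖w‖) := by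
          gcongr; exact ContinuousLinearMap.le_opNorm _ _
        _ = _ := by ring)

@[simp] lemma toSdL_apply {n : ℕ} (f : L2 N) : toSdL N n f = toSd n f := rfl

namespace IsSolitonFamily

variable (hΦ : IsSolitonFamily J Dia O Φ) (hp₀ : p₀ ∈ O)
include hΦ hp₀

lemma exists_fn_eq (n : ℕ) : ∃ w : Sg N n, fn w = Φ p₀ := by
  obtain ⟨Φn, -, h⟩ := hΦ.smooth n
  exact ⟨Φn p₀, h p₀ hp₀⟩

/-- `Φ` is differentiable in every `Σ_n`. -/
lemma exists_hasFDerivAt (n : ℕ) : ∃ (Φn : Rn n₀ → Sg N n) (L : Rn n₀ →L[ℝ] Sg N n),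
    HasFDerivAt Φn L p₀ ∧ (∀ᶠ p in 𝓝 p₀, p ∈ O ∧ fn (Φn p) = Φ p) ∧
    ∀ j, fn (L (stdVec j)) = pderiv Φ p₀ j := by
  obtain ⟨Φn, hs, h⟩ := hΦ.smooth n
  have hO := hΦ.isOpen.mem_nhds hp₀
  have hd : HasFDerivAt Φn (fderiv ℝ Φn p₀) p₀ :=
    (((hs p₀ hp₀).contDiffAt hO).differentiableAt (by simp)).hasFDerivAt
  have hev : ∀ᶠ p in 𝓝 p₀, p ∈ O ∧ fn (Φn p) = Φ p := by
    filter_upwards [hO] with p hp using ⟨hp, h p hp⟩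
  refine ⟨Φn, fderiv ℝ Φn p₀, hd, hev, fun j => ?_⟩
  have h1 : HasFDerivAt Φ (fn.comp (fderiv ℝ Φn p₀)) p₀ := by
    refine (fn.hasFDerivAt.comp p₀ hd).congr_of_eventuallyEq ?_
    filter_upwards [hev] with p hp using hp.2.symm
  rw [pderiv, h1.fderiv]
  rfl

lemma exists_fn_eq_pderiv (n : ℕ) (j : Fin n₀) : ∃ w : Sg N n, fn w = pderiv Φ p₀ j := by
  obtain ⟨-, L, -, -, h⟩ := hΦ.exists_hasFDerivAt hp₀ n
  exact ⟨_, h j⟩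

variable (hsym : IsSymmetrySetup J Dia ord G)
include hsym

lemma exists_fn_eq_Dia (n : ℕ) (j : Fin n₀) : ∃ w : Sg N n, fn w = app (Dia j) (Φ p₀) := by
  obtain ⟨w, hw⟩ := hΦ.exists_fn_eq hp₀ (n + ord j)
  obtain ⟨B, hB⟩ := hsym.exists_dS j (le_refl (n + ord j))
  exact ⟨B w, by rw [(hB w).2, hw]⟩

lemma mem_domain (j : Fin n₀) : Φ p₀ ∈ (Dia j).domain := by
  obtain ⟨w, hw⟩ := hΦ.exists_fn_eq hp₀ (ord j)
  rw [← hw]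
  exact hsym.fn_mem_domain le_rfl w

/-- Differentiating `Π_j(Φ_p) = p_j` gives `⟨◇_jΦ_p, ∂_{p_k}Φ_p⟩ = δ_{jk}`. -/
lemma inner_Dia_pderiv (j k : Fin n₀) :
    ⟪app (Dia j) (Φ p₀), pderiv Φ p₀ k⟫_ℝ = if j = k then 1 else 0 := by
  obtain ⟨Φn, L, hd, hev, hL⟩ := hΦ.exists_hasFDerivAt hp₀ (ord j)
  obtain ⟨B, hB⟩ := hsym.exists_dS j (n := 0) (m := ord j) (by omega)
  have hdom : ∀ u : Sg N (ord j), fn u ∈ (Dia j).domain := fun u => (hB u).1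
  have h1 : HasFDerivAt (fun p => (1 / 2 : ℝ) * ⟪fn (B (Φn p)), fn (Φn p)⟫_ℝ) _ p₀ :=
    ((fn.hasFDerivAt.comp p₀ (B.hasFDerivAt.comp p₀ hd)).inner ℝ
      (fn.hasFDerivAt.comp p₀ hd)).const_mul (1 / 2 : ℝ)
  have h2 : HasFDerivAt (fun p : Rn n₀ => p j) (EuclideanSpace.proj j : Rn n₀ →L[ℝ] ℝ) p₀ :=
    (EuclideanSpace.proj j : Rn n₀ →L[ℝ] ℝ).hasFDerivAt
  have h3 : (fun p => (1 / 2 : ℝ) * ⟪fn (B (Φn p)), fn (Φn p)⟫_ℝ) =ᶠ[𝓝 p₀] fun p => p j := by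
    filter_upwards [hev] with p hp
    have := congrArg (fun q : Rn n₀ => q j) (hΦ.momentum_eq p hp.1)
    simp only [momentum] at this
    rw [(hB _).2, hp.2]
    exact this
  have h4 := congrArg (fun T : Rn n₀ →L[ℝ] ℝ => T (stdVec k))
    ((h1.congr_of_eventuallyEq h3.symm).unique h2)
  have h5 : Φ p₀ = fn (Φn p₀) := hev.self_of_nhds.2.symm
  have h6 : (EuclideanSpace.proj j : Rn n₀ →L[ℝ] ℝ) (stdVec k) = if j = k then 1 else 0 := by
    simp
  simp only [h6] at h4
  rw [← h4]
  have e1 : ⟪fn (B (Φn p₀)), fn (L (stdVec k))⟫_ℝ = ⟪app (Dia j) (Φ p₀), pderiv Φ p₀ k⟫_ℝ := by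
    rw [(hB _).2, h5, hL]
  have e2 : ⟪fn (B (L (stdVec k))), fn (Φn p₀)⟫_ℝ = ⟪app (Dia j) (Φ p₀), pderiv Φ p₀ k⟫_ℝ := by
    rw [(hB _).2, hsym.inner_Dia (hdom _) (hdom _), real_inner_comm, hL, h5]
  change _ = (1 / 2 : ℝ) * (⟪fn (B (Φn p₀)), fn (L (stdVec k))⟫_ℝ
    + ⟪fn (B (L (stdVec k))), fn (Φn p₀)⟫_ℝ)
  rw [e1, e2]
  ring

lemma inner_JDia_Dia (j k : Fin n₀) :
    ⟪matOp J (app (Dia j) (Φ p₀)), app (Dia k) (Φ p₀)⟫_ℝ = 0 := by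
  have hm := hΦ.mem_domain hp₀ hsym
  have hDm : ∀ j k, app (Dia k) (Φ p₀) ∈ (Dia j).domain := by
    intro j k
    obtain ⟨w, hw⟩ := hΦ.exists_fn_eq_Dia hp₀ hsym (ord j) k
    rw [← hw]
    exact hsym.fn_mem_domain le_rfl w
  have hcomm : app (Dia j) (app (Dia k) (Φ p₀)) = app (Dia k) (app (Dia j) (Φ p₀)) := by
    obtain ⟨w, hw⟩ := hΦ.exists_fn_eq hp₀ (ord j + ord k)
    rw [← hw]
    exact hsym.comm j k w
  have h1 := hsym.inner_JDia (hm j) (hDm j k)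
  have h2 := hsym.inner_JDia (hm k) (hDm k j)
  have h3 := hsym.inner_J (app (Dia j) (Φ p₀)) (app (Dia k) (Φ p₀))
  rw [hcomm] at h1
  rw [real_inner_comm (matOp J _)] at h3
  linarith

lemma inner_JDia_Jinv_pderiv (j k : Fin n₀) :
    ⟪matOp J (app (Dia j) (Φ p₀)), matOp J⁻¹ (pderiv Φ p₀ k)⟫_ℝ = if j = k then -1 else 0 := by
  rw [hsym.inner_J, hsym.matOp_inv, hΦ.inner_Dia_pderiv hp₀ hsym]
  split_ifs <;> simp

/-- The elements of `N_g(𝓗_{p₀}^*)` are Schwartz functions. -/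
lemma exists_fn_eq_of_mem_NgStar (n : ℕ) {ψ : L2 N} (hψ : ψ ∈ NgStar J Dia Φ p₀) :
    ∃ w : Sg N n, fn w = ψ := by
  have : NgStar J Dia Φ p₀ ≤ LinearMap.range (fn : Sg N n →L[ℝ] L2 N).toLinearMap := by
    refine Submodule.span_le.2 ?_
    rintro x (⟨j, rfl⟩ | ⟨j, rfl⟩)
    · exact hΦ.exists_fn_eq_Dia hp₀ hsym n j
    · obtain ⟨w, hw⟩ := hΦ.exists_fn_eq_pderiv hp₀ n j
      obtain ⟨v, hv⟩ := exists_fn_eq_matOp J⁻¹ w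
      exact ⟨v, by rw [hw] at hv; exact hv⟩
  exact this hψ

/-- The extension of `P_{N_g}(p₀)` to an operator from `Σ_{-r}` to `Σ_n`. -/
lemma exists_projection (r n : ℕ) : ∃ E : Sd N r →L[ℝ] Sg N n,
    (∀ u, fn (E (toSd r u)) = projNg J Dia Φ p₀ u) ∧
    ∀ W : Sd N r, ∀ w : Sg N r, fn w ∈ NgStar J Dia Φ p₀ → W w = ⟪fn (E W), fn w⟫_ℝ := by
  choose a ha using hΦ.exists_fn_eq_Dia hp₀ hsym r
  choose a' ha' using hΦ.exists_fn_eq_Dia hp₀ hsym n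
  choose b hb using hΦ.exists_fn_eq_pderiv hp₀ r
  choose b' hb' using hΦ.exists_fn_eq_pderiv hp₀ n
  let E : Sd N r →L[ℝ] Sg N n := ∑ j,
    (-((ContinuousLinearMap.apply ℝ ℝ (jS J⁻¹ r (b j))).smulRight (jS J n (a' j)))
      + (ContinuousLinearMap.apply ℝ ℝ (a j)).smulRight (b' j))
  have hE : ∀ W : Sd N r, fn (E W) = ∑ j,
      (-(W (jS J⁻¹ r (b j)) • matOp J (app (Dia j) (Φ p₀))) + W (a j) • pderiv Φ p₀ j) := by
    intro W
    simp [E, sum_apply, ha', hb']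
  refine ⟨E, fun u => ?_, fun W w hw => ?_⟩
  · rw [hE]
    simp [projNg, ha, hb]
  · have key : ∀ ψ ∈ NgStar J Dia Φ p₀, ∃ w : Sg N r, fn w = ψ ∧ W w = ⟪fn (E W), ψ⟫_ℝ := by
      intro ψ hψ
      induction hψ using Submodule.span_induction with
      | mem x hx =>
        rcases hx with ⟨k, rfl⟩ | ⟨k, rfl⟩
        · refine ⟨a k, ha k, ?_⟩
          rw [hE, sum_inner]
          have h1 : ∀ j, ⟪pderiv Φ p₀ j, app (Dia k) (Φ p₀)⟫_ℝ = if k = j then 1 else 0 :=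
            fun j => by rw [real_inner_comm]; exact hΦ.inner_Dia_pderiv hp₀ hsym k j
          simp [inner_add_left, inner_neg_left, real_inner_smul_left,
            hΦ.inner_JDia_Dia hp₀ hsym, h1]
        · refine ⟨jS J⁻¹ r (b k), by rw [fn_jS, hb], ?_⟩
          rw [hE, sum_inner]
          have h0 : ∀ j, ⟪pderiv Φ p₀ j, matOp J⁻¹ (pderiv Φ p₀ k)⟫_ℝ = 0 := fun j => by
            rw [real_inner_comm]
            exact hΦ.isotropic p₀ hp₀ k j
          simp [inner_add_left, inner_neg_left, real_inner_smul_left, h0,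
            hΦ.inner_JDia_Jinv_pderiv hp₀ hsym]
      | zero => exact ⟨0, by simp, by simp⟩
      | add x y _ _ hx hy =>
        obtain ⟨w, hw, hw'⟩ := hx
        obtain ⟨v, hv, hv'⟩ := hy
        exact ⟨w + v, by rw [map_add, hw, hv], by rw [map_add, hw', hv', inner_add_right]⟩
      | smul c x _ hx =>
        obtain ⟨w, hw, hw'⟩ := hx
        exact ⟨c • w, by rw [map_smul, hw], by
          rw [map_smul, hw', inner_smul_right, smul_eq_mul]⟩
    obtain ⟨w', hw', h⟩ := key _ hw
    rwa [fn_injective hw'] at h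

lemma inner_projNg (X : L2 N) {ψ : L2 N} (hψ : ψ ∈ NgStar J Dia Φ p₀) :
    ⟪projNg J Dia Φ p₀ X, ψ⟫_ℝ = ⟪X, ψ⟫_ℝ := by
  obtain ⟨E, hE, hE'⟩ := hΦ.exists_projection hp₀ hsym 0 0
  obtain ⟨w, rfl⟩ := hΦ.exists_fn_eq_of_mem_NgStar hp₀ hsym 0 hψ
  rw [← hE, ← hE' _ _ hψ]
  rfl

omit hΦ hp₀ hsym in
lemma projNg_eq_zero {X : L2 N} (h : ∀ ψ ∈ NgStar J Dia Φ p₀, ⟪X, ψ⟫_ℝ = 0) :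
    projNg J Dia Φ p₀ X = 0 := by
  refine Finset.sum_eq_zero fun j _ => ?_
  rw [h _ (Submodule.subset_span (Or.inl (mem_range_self j))),
    h _ (Submodule.subset_span (Or.inr (mem_range_self j)))]
  simp

lemma exists_proj_perp (s : ℕ) : ∃ Q : Sg N s → perp (NgStar J Dia Φ p₀) s,
    IsBoundedLinearMap ℝ Q ∧ ∀ w, fn (Q w).1 = fn w - projNg J Dia Φ p₀ (fn w) := by
  obtain ⟨E, hE, -⟩ := hΦ.exists_projection hp₀ hsym 0 s
  let L : Sg N s →L[ℝ] Sg N s := ContinuousLinearMap.id ℝ (Sg N s) - E ∘L toSdL N 0 ∘L fn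
  have hL : ∀ w, fn (L w) = fn w - projNg J Dia Φ p₀ (fn w) := fun w => by
    simp [L, hE]
  let Q : Sg N s → perp (NgStar J Dia Φ p₀) s := fun w => ⟨L w, fun ψ hψ => by
    rw [hL, inner_sub_left, hΦ.inner_projNg hp₀ hsym _ hψ, sub_self]⟩
  exact ⟨Q, IsLinearMap.with_bound ⟨fun x y => Subtype.ext (L.map_add x y),
    fun c x => Subtype.ext (L.map_smul c x)⟩ ‖L‖ fun w => L.le_opNorm w, hL⟩

omit hΦ hp₀ hsym in
/-- The complementary projection on `Σ_{-r}`, for an extension `E` of `P_{N_g}(p₀)`. -/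
lemma exists_proj_perpNeg {r n : ℕ} (E : Sd N r →L[ℝ] Sg N n)
    (hE : ∀ W : Sd N r, ∀ w : Sg N r, fn w ∈ NgStar J Dia Φ p₀ → W w = ⟪fn (E W), fn w⟫_ℝ) :
    ∃ Q : Sd N r → perpNeg (NgStar J Dia Φ p₀) r, IsBoundedLinearMap ℝ Q ∧
      ∀ W, (Q W).1 = W - toSd r (fn (E W)) := by
  let L : Sd N r →L[ℝ] Sd N r := ContinuousLinearMap.id ℝ (Sd N r) - toSdL N r ∘L fn ∘L E
  let Q : Sd N r → perpNeg (NgStar J Dia Φ p₀) r := fun W => ⟨L W, fun w hw => by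
    simp [L, hE W w hw]⟩
  refine ⟨Q, IsLinearMap.with_bound ⟨fun x y => Subtype.ext (L.map_add x y),
    fun c x => Subtype.ext (L.map_smul c x)⟩ ‖L‖ fun W => L.le_opNorm W, fun W => rfl⟩

/-- `P_{N_g}(p₀)` as a bounded operator of `L²` which factors through `Σ_n`. -/
lemma exists_projNg_clm (n : ℕ) : ∃ P : L2 N →L[ℝ] Sg N n, ∀ u, fn (P u) = projNg J Dia Φ p₀ u := by
  obtain ⟨E, hE, -⟩ := hΦ.exists_projection hp₀ hsym 0 n
  exact ⟨E ∘L toSdL N 0, hE⟩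

lemma projNg_projNg (u : L2 N) :
    projNg J Dia Φ p₀ (projNg J Dia Φ p₀ u) = projNg J Dia Φ p₀ u := by
  obtain ⟨P, hP⟩ := hΦ.exists_projNg_clm hp₀ hsym 0
  have h : projNg J Dia Φ p₀ (u - projNg J Dia Φ p₀ u) = 0 := projNg_eq_zero fun ψ hψ => by
    rw [inner_sub_left, hΦ.inner_projNg hp₀ hsym _ hψ, sub_self]
  rw [← hP (u - projNg J Dia Φ p₀ u), map_sub, map_sub, hP, hP, sub_eq_zero] at h
  exact h.symm

end IsSolitonFamily

end Projection

/-! ### The reduced system and its bounds -/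

section Gronwall

variable {E : Type*} [NormedAddCommGroup E] [NormedSpace ℝ E]

/-- Grönwall's inequality on `[0, 1]` with zero initial value. -/
lemma norm_le_of_norm_deriv_le_unitInterval {y y' : ℝ → E} {κ b : ℝ} (hκ : 0 < κ) (hb : 0 ≤ b)
    (h0 : y 0 = 0) (hy : ∀ s ∈ Icc (0 : ℝ) 1, HasDerivWithinAt y (y' s) (Icc 0 1) s)
    (hle : ∀ s ∈ Icc (0 : ℝ) 1, ‖y' s‖ ≤ κ * (b + ‖y s‖)) : ‖y 1‖ ≤ Real.exp κ * b := by
  have h := norm_le_gronwallBound_of_norm_deriv_right_le (f := y) (f' := y') (δ := 0) (K := κ)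
    (ε := κ * b) (a := 0) (b := 1) (fun s hs => (hy s hs).continuousWithinAt)
    (fun s hs => (hy s (Ico_subset_Icc_self hs)).mono_of_mem_nhdsWithin (Icc_mem_nhdsGE_of_mem hs))
    (by simp [h0]) (fun s hs => (hle s (Ico_subset_Icc_self hs)).trans_eq (by ring))
    1 (right_mem_Icc.2 zero_le_one)
  rw [gronwallBound_of_K_ne_0 hκ.ne'] at h
  refine h.trans ?_
  have : κ * b / κ = b := by field_simp
  rw [this]
  simp only [sub_zero, mul_one, zero_mul, zero_add]
  nlinarith

lemma eq_zero_of_norm_deriv_le {y y' : ℝ → E} {a κ : ℝ} (ha : 0 ≤ a) (h0 : y 0 = 0)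
    (hy : ∀ t ∈ Icc (-a) a, HasDerivWithinAt y (y' t) (Icc (-a) a) t)
    (hle : ∀ t ∈ Icc (-a) a, ‖y' t‖ ≤ κ * ‖y t‖) : ∀ t ∈ Icc (-a) a, y t = 0 := by
  intro t ht
  have hsub : ∀ s ∈ Icc (0 : ℝ) 1, s * t ∈ Icc (-a) a := by
    intro s hs
    have := (convex_Icc (-a) a).smul_mem_of_zero_mem (by constructor <;> linarith) ht hs
    simpa using this
  have := norm_le_of_norm_deriv_le_unitInterval (y := fun s => y (s * t))
    (y' := fun s => t • y' (s * t)) (κ := |t| * |κ| + 1) (b := 0) (by positivity) le_rfl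
    (by simpa using h0) (fun s hs => by
      have h2 : HasDerivWithinAt (fun s => s * t) t (Icc (0 : ℝ) 1) s := by
        simpa using (hasDerivWithinAt_id s (Icc (0 : ℝ) 1)).mul_const t
      exact HasDerivWithinAt.scomp s (hy _ (hsub s hs)) h2 hsub)
    (fun s hs => by
      rw [norm_smul, Real.norm_eq_abs, zero_add]
      have h1 := (hle _ (hsub s hs)).trans
        (mul_le_mul_of_nonneg_right (le_abs_self κ) (norm_nonneg _))
      nlinarith [abs_nonneg t, norm_nonneg (y (s * t)),
        mul_le_mul_of_nonneg_left h1 (abs_nonneg t)])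
  simpa using this

end Gronwall

section Reduced

variable {P H H₁ W Z : Type} [NormedAddCommGroup P] [NormedSpace ℝ P] [CompleteSpace P]
  [NormedAddCommGroup H] [NormedSpace ℝ H]
  [NormedAddCommGroup H₁] [NormedSpace ℝ H₁] [CompleteSpace H₁]
  [NormedAddCommGroup W] [NormedSpace ℝ W]
  [NormedAddCommGroup Z] [NormedSpace ℝ Z] [CompleteSpace Z]

/-- The vector field `(T, A, g(q, D))` of the system for `(τ, q, S)` with parameter `(ϱ, R)`, where
`T`, `A`, `D` are evaluated at `(t, h((q, S), (ϱ, R)))`. -/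
def reducedField (T A : ℝ × P × W → P) (D : ℝ × P × W → H) (g : P × H → H₁)
    (h : (P × H₁) × (P × Z) → P × W) (x : ℝ × (P × P × H₁) × (P × Z)) : P × P × H₁ :=
  (T (x.1, h (x.2.1.2, x.2.2)), A (x.1, h (x.2.1.2, x.2.2)),
    g (x.2.1.2.1, D (x.1, h (x.2.1.2, x.2.2))))

/-- The domain of `reducedField` for coefficients defined on `(-3, 3) × U`. -/
def reducedDomain (h : (P × H₁) × (P × Z) → P × W) (U : Set (P × W)) :
    Set (ℝ × (P × P × H₁) × (P × Z)) :=
  {x | x.1 ∈ Ioo (-3 : ℝ) 3 ∧ h (x.2.1.2, x.2.2) ∈ U}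

variable {T A : ℝ × P × W → P} {D : ℝ × P × W → H} {g : P × H → H₁}
  {h : (P × H₁) × (P × Z) → P × W} {U : Set (P × W)} {l : ℕ}

omit [CompleteSpace P] [CompleteSpace H₁] [CompleteSpace Z] [NormedSpace ℝ P] [NormedSpace ℝ H₁]
  [NormedSpace ℝ W] [NormedSpace ℝ Z] in
lemma isOpen_reducedDomain (hU : IsOpen U) (hh : Continuous h) : IsOpen (reducedDomain h U) := by
  have h1 : IsOpen {x : ℝ × (P × P × H₁) × (P × Z) | x.1 ∈ Ioo (-3 : ℝ) 3} :=
    isOpen_Ioo.preimage continuous_fst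
  have h2 : IsOpen {x : ℝ × (P × P × H₁) × (P × Z) | h (x.2.1.2, x.2.2) ∈ U} :=
    hU.preimage (by fun_prop)
  exact h1.inter h2

omit [CompleteSpace P] [CompleteSpace H₁] [CompleteSpace Z] in
lemma contDiffOn_reducedField (hT : ContDiffOn ℝ l T (Ioo (-3) 3 ×ˢ U))
    (hA : ContDiffOn ℝ l A (Ioo (-3) 3 ×ˢ U)) (hD : ContDiffOn ℝ l D (Ioo (-3) 3 ×ˢ U))
    (hg : ContDiff ℝ l g) (hh : ContDiff ℝ l h) :
    ContDiffOn ℝ l (reducedField T A D g h) (reducedDomain h U) := by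
  have hc : ContDiff ℝ l fun x : ℝ × (P × P × H₁) × (P × Z) => (x.1, h (x.2.1.2, x.2.2)) :=
    contDiff_fst.prodMk (hh.comp (by fun_prop))
  have hm : MapsTo (fun x : ℝ × (P × P × H₁) × (P × Z) => (x.1, h (x.2.1.2, x.2.2)))
      (reducedDomain h U) (Ioo (-3) 3 ×ˢ U) := fun x hx => hx
  have hq : ContDiff ℝ l fun x : ℝ × (P × P × H₁) × (P × Z) => x.2.1.2.1 := by fun_prop
  exact (hT.comp hc.contDiffOn hm).prodMk ((hA.comp hc.contDiffOn hm).prodMk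
    (hg.comp_contDiffOn (hq.contDiffOn.prodMk (hD.comp hc.contDiffOn hm))))

/-- The reduced system can be solved for `|t| ≤ 5/2` and small parameters `(ϱ, R)`, and its
solutions satisfy the bounds inherited from the coefficients. The solution at the parameter `0` is
`(∫ T(t, 0) dt, 0, 0)`, which exists for all these times; nearby parameters are reached by
compactness and the bounds follow from Grönwall's inequality. -/
theorem exists_bounds_solMap (hl : 1 ≤ l) (hU : IsOpen U)
    (hT : ContDiffOn ℝ l T (Ioo (-3) 3 ×ˢ U))
    (hA : ContDiffOn ℝ l A (Ioo (-3) 3 ×ˢ U)) (hD : ContDiffOn ℝ l D (Ioo (-3) 3 ×ˢ U))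
    (hg : ContDiff ℝ l g) (hh : ContDiff ℝ l h) (hU₀ : (0, 0) ∈ U) {c Cr : ℝ} (hc : 0 ≤ c)
    (hCr : 0 ≤ Cr) {M₀ i : ℕ} (hM₀ : 1 ≤ M₀)
    (hAb : ∀ t ∈ Ioo (-3 : ℝ) 3, ∀ y ∈ U, ‖A (t, y)‖ ≤ Cr * ‖y.2‖ ^ (M₀ + 1))
    (hDb : ∀ t ∈ Ioo (-3 : ℝ) 3, ∀ y ∈ U,
      ‖D (t, y)‖ ≤ Cr * (‖y.1‖ + ‖y.2‖) ^ i * ‖y.2‖ ^ M₀)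
    (hgb : ∀ q x, ‖q‖ ≤ 1 → ‖g (q, x)‖ ≤ c * ‖x‖)
    (hhb : ∀ q S ϱ R, ‖q‖ ≤ 1 → ‖S‖ ≤ 1 → ‖R‖ ≤ 1 →
      ‖(h ((q, S), (ϱ, R))).1‖ ≤ ‖ϱ‖ + c * (‖R‖ + ‖S‖) ∧
      ‖(h ((q, S), (ϱ, R))).2‖ ≤ c * (‖R‖ + ‖S‖)) :
    ∃ V : Set (P × Z), IsOpen V ∧ 0 ∈ V ∧ ∃ C : ℝ, 0 ≤ C ∧
      ∀ lam ∈ V, ∀ t ∈ Icc (-(5 / 2) : ℝ) (5 / 2),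
        (t, lam) ∈ solDomain (reducedField T A D g h) (reducedDomain h U) ∧
        ∀ x, x = solMap (reducedField T A D g h) (reducedDomain h U) (t, lam) →
          ‖x.2.1‖ ≤ 1 ∧ ‖x.2.2‖ ≤ 1 ∧ ‖lam.2‖ ≤ 1 ∧
          ‖x.2.1‖ ≤ C * ‖lam.2‖ ^ (M₀ + 1) ∧ ‖x.2.2‖ ≤ C * ‖lam.2‖ ∧
          ‖x.2.2‖ ≤ C * (‖lam.1‖ + ‖lam.2‖) ^ i * ‖lam.2‖ ^ M₀ ∧
          ‖A (t, h (x.2, lam))‖ ≤ C * ‖lam.2‖ ^ (M₀ + 1) ∧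
          ‖D (t, h (x.2, lam))‖ ≤ C * (‖lam.1‖ + ‖lam.2‖) ^ i * ‖lam.2‖ ^ M₀ := by
  set f := reducedField T A D g h with hfdef
  set Ω := reducedDomain h U with hΩdef
  have hΩ : IsOpen Ω := isOpen_reducedDomain hU hh.continuous
  have hf : ContDiffOn ℝ l f Ω := contDiffOn_reducedField hT hA hD hg hh
  have hl' : (1 : WithTop ℕ∞) ≤ l := by exact_mod_cast hl
  have hf1 : ContDiffOn ℝ 1 f Ω := hf.of_le hl'
  -- the solution at the parameter `0`
  have hh0 : h ((0, 0), 0) = (0, 0) := by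
    have := hhb 0 0 0 0 (by simp) (by simp) (by simp)
    simp only [norm_zero, add_zero, mul_zero, norm_le_zero_iff] at this
    exact Prod.ext this.1 this.2
  have hA0 : ∀ t ∈ Ioo (-3 : ℝ) 3, A (t, 0, 0) = 0 := fun t ht => by
    simpa using hAb t ht (0, 0) hU₀
  have hD0 : ∀ t ∈ Ioo (-3 : ℝ) 3, D (t, 0, 0) = 0 := fun t ht => by
    have := hDb t ht (0, 0) hU₀
    simpa [show M₀ ≠ 0 by omega] using this
  have hg0 : g (0, 0) = 0 := by simpa using hgb 0 0 (by simp)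
  have hbase : ∀ t ∈ Icc (-(5 / 2) : ℝ) (5 / 2), (t, (0 : P × Z)) ∈ solDomain f Ω ∧
      (solMap f Ω (t, 0)).2 = 0 := by
    have hTc : ContinuousOn (fun t : ℝ => T (t, 0, 0)) (Ioo (-3) 3) :=
      hT.continuousOn.comp (by fun_prop) fun t ht => ⟨ht, hU₀⟩
    have hmem : ∀ s ∈ Icc (-(5 / 2) : ℝ) (5 / 2), s ∈ Ioo (-3 : ℝ) 3 := fun s hs =>
      ⟨by linarith [hs.1], by linarith [hs.2]⟩
    have := solMap_unique (a := 5 / 2) hΩ hf1 (by norm_num) (lam := (0 : P × Z))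
      (x := fun t => (∫ s in (0 : ℝ)..t, T (s, 0, 0), 0, 0)) (by simp)
      (fun s hs => ⟨hmem s hs, by simpa only [hh0] using hU₀⟩)
      (fun s hs => by
        have h1 : HasDerivAt (fun t => ∫ s in (0 : ℝ)..t, T (s, 0, 0)) (T (s, 0, 0)) s := by
          refine intervalIntegral.integral_hasDerivAt_right ?_
            (hTc.stronglyMeasurableAtFilter isOpen_Ioo s (hmem s hs))
            (hTc.continuousAt (Ioo_mem_nhds (hmem s hs).1 (hmem s hs).2))
          refine (hTc.mono fun u hu => ?_).intervalIntegrable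
          exact (ordConnected_Ioo.uIcc_subset (by norm_num) (hmem s hs)) hu
        have h2 : HasDerivAt (fun t => ((∫ s in (0 : ℝ)..t, T (s, 0, 0), 0, 0) : P × P × H₁))
            (T (s, 0, 0), 0, 0) s :=
          h1.prodMk ((hasDerivAt_const s 0).prodMk (hasDerivAt_const s 0))
        have h3 : f (s, (∫ s in (0 : ℝ)..s, T (s, 0, 0), 0, 0), 0) = (T (s, 0, 0), 0, 0) := by
          simp only [hfdef, reducedField]
          simp only [hh0, hA0 s (hmem s hs), hD0 s (hmem s hs), hg0]
        rw [h3]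
        exact h2.hasDerivWithinAt)
    exact fun t ht => ⟨(this t ht).1, by rw [(this t ht).2]; rfl⟩
  -- a neighbourhood of the parameter `0` where the solutions exist and are bounded
  let B : Set ((P × P × H₁) × (P × Z)) :=
    {w | ‖w.1.2.1‖ < 1 ∧ ‖w.1.2.2‖ < 1 ∧ ‖w.2.1‖ < 1 ∧ ‖w.2.2‖ < 1}
  have hB : IsOpen B := by
    have h1 : IsOpen {w : (P × P × H₁) × (P × Z) | ‖w.1.2.1‖ < 1} :=
      isOpen_lt (by fun_prop) continuous_const
    have h2 : IsOpen {w : (P × P × H₁) × (P × Z) | ‖w.1.2.2‖ < 1} :=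
      isOpen_lt (by fun_prop) continuous_const
    have h3 : IsOpen {w : (P × P × H₁) × (P × Z) | ‖w.2.1‖ < 1} :=
      isOpen_lt (by fun_prop) continuous_const
    have h4 : IsOpen {w : (P × P × H₁) × (P × Z) | ‖w.2.2‖ < 1} :=
      isOpen_lt (by fun_prop) continuous_const
    exact h1.inter (h2.inter (h3.inter h4))
  have hO : IsOpen (solDomain f Ω ∩ (fun p => (solMap f Ω p, p.2)) ⁻¹' B) :=
    ((contDiffOn_solMap hΩ hl hf).continuousOn.prodMk
      continuous_snd.continuousOn).isOpen_inter_preimage (isOpen_solDomain hΩ hl hf) hB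
  obtain ⟨u, V, -, hV, hu, h0V, huV⟩ := generalized_tube_lemma
    (isCompact_Icc (a := (-(5 / 2) : ℝ)) (b := 5 / 2)) (isCompact_singleton (x := (0 : P × Z))) hO
    (by
      rintro ⟨t, lam⟩ ⟨ht, rfl : lam = 0⟩
      refine ⟨(hbase t ht).1, ?_⟩
      simp [B, (hbase t ht).2])
  have hdom : ∀ lam ∈ V, ∀ t ∈ Icc (-(5 / 2) : ℝ) (5 / 2), (t, lam) ∈ solDomain f Ω ∧
      ‖(solMap f Ω (t, lam)).2.1‖ ≤ 1 ∧ ‖(solMap f Ω (t, lam)).2.2‖ ≤ 1 ∧ ‖lam.1‖ ≤ 1 ∧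
      ‖lam.2‖ ≤ 1 := fun lam hlam t ht => by
    obtain ⟨h1, h2, h3, h4, h5⟩ := huV (mk_mem_prod (hu ht) hlam)
    exact ⟨h1, h2.le, h3.le, h4.le, h5.le⟩
  have hscale : ∀ t ∈ Icc (-(5 / 2) : ℝ) (5 / 2), ∀ s ∈ Icc (0 : ℝ) 1,
      s * t ∈ Icc (-(5 / 2) : ℝ) (5 / 2) := by
    intro t ht s hs
    have := (convex_Icc (-(5 / 2) : ℝ) (5 / 2)).smul_mem_of_zero_mem (by norm_num) ht hs
    simpa using this
  -- a first linear bound for `S`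
  set K₁ : ℝ := Cr * (1 + 4 * c) ^ i * (2 * c) ^ (M₀ - 1) * c with hK₁
  have hK₁0 : 0 ≤ K₁ := by positivity
  set κ : ℝ := 5 / 2 * (c * K₁) + 1 with hκ
  have hκ0 : 0 < κ := by positivity
  set L : ℝ := Real.exp κ with hL
  have hL0 : 0 ≤ L := (Real.exp_pos _).le
  have hrough : ∀ lam ∈ V, ∀ t ∈ Icc (-(5 / 2) : ℝ) (5 / 2),
      ‖D (t, h ((solMap f Ω (t, lam)).2, lam))‖ ≤
        K₁ * (‖lam.2‖ + ‖(solMap f Ω (t, lam)).2.2‖) := by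
    intro lam hlam t ht
    obtain ⟨hmem, hq, hS, hϱ, hR⟩ := hdom lam hlam t ht
    obtain ⟨htI, hyU⟩ := solMap_mem hΩ hf1 hmem
    obtain ⟨b1, b2⟩ := hhb _ _ lam.1 lam.2 hq hS hR
    refine (hDb t htI _ hyU).trans ?_
    have hs : ‖lam.2‖ + ‖(solMap f Ω (t, lam)).2.2‖ ≤ 2 := by linarith
    set w := ‖lam.2‖ + ‖(solMap f Ω (t, lam)).2.2‖ with hw
    have hw0 : 0 ≤ w := by positivity
    have b2' : ‖(h ((solMap f Ω (t, lam)).2, lam)).2‖ ≤ c * w := b2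
    have b1' : ‖(h ((solMap f Ω (t, lam)).2, lam)).1‖ ≤ ‖lam.1‖ + c * w := b1
    have hcw : c * w ≤ 2 * c := by nlinarith
    have e : M₀ = (M₀ - 1) + 1 := by omega
    have b3 : (‖(h ((solMap f Ω (t, lam)).2, lam)).1‖ + ‖(h ((solMap f Ω (t, lam)).2, lam)).2‖) ^ i
        ≤ (1 + 4 * c) ^ i := pow_le_pow_left₀ (by positivity) (by linarith) i
    calc _ ≤ Cr * (1 + 4 * c) ^ i * (c * w) ^ M₀ :=
          mul_le_mul (mul_le_mul_of_nonneg_left b3 hCr)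
            (pow_le_pow_left₀ (norm_nonneg _) b2' _) (by positivity) (by positivity)
      _ = Cr * (1 + 4 * c) ^ i * ((c * w) ^ (M₀ - 1) * (c * w)) := by
          rw [← pow_succ, ← e]
      _ ≤ Cr * (1 + 4 * c) ^ i * ((2 * c) ^ (M₀ - 1) * (c * w)) := by gcongr
      _ = K₁ * w := by rw [hK₁]; ring
  have hrescaled : ∀ lam ∈ V, ∀ t ∈ Icc (-(5 / 2) : ℝ) (5 / 2),
      (solMap f Ω (0 * t, lam)) = 0 ∧ ∀ s ∈ Icc (0 : ℝ) 1,
      HasDerivWithinAt (fun s => (solMap f Ω (s * t, lam)).2.1)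
        (t • A (s * t, h ((solMap f Ω (s * t, lam)).2, lam))) (Icc 0 1) s ∧
      HasDerivWithinAt (fun s => (solMap f Ω (s * t, lam)).2.2)
        (t • g ((solMap f Ω (s * t, lam)).2.1,
          D (s * t, h ((solMap f Ω (s * t, lam)).2, lam)))) (Icc 0 1) s := by
    intro lam hlam t ht
    refine ⟨by rw [zero_mul]; exact solMap_zero_of_mem hΩ hf1 (hdom lam hlam t ht).1,
      fun s hs => ?_⟩
    have h1 := (solDomain_star hΩ hf1 (hdom lam hlam t ht).1 hs).2.2
    have h2 := (ContinuousLinearMap.snd ℝ P (P × H₁)).hasFDerivAt.comp_hasDerivWithinAt s h1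
    exact ⟨(ContinuousLinearMap.fst ℝ P H₁).hasFDerivAt.comp_hasDerivWithinAt s h2,
      (ContinuousLinearMap.snd ℝ P H₁).hasFDerivAt.comp_hasDerivWithinAt s h2⟩
  have habs : ∀ t ∈ Icc (-(5 / 2) : ℝ) (5 / 2), |t| ≤ 5 / 2 := fun t ht => abs_le.2 ht
  have hlin : ∀ lam ∈ V, ∀ t ∈ Icc (-(5 / 2) : ℝ) (5 / 2),
      ‖(solMap f Ω (t, lam)).2.2‖ ≤ L * ‖lam.2‖ := by
    intro lam hlam t ht
    obtain ⟨h0, hder⟩ := hrescaled lam hlam t ht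
    have := norm_le_of_norm_deriv_le_unitInterval (y := fun s => (solMap f Ω (s * t, lam)).2.2)
      hκ0 (norm_nonneg lam.2) (by simp only [h0]; rfl) (fun s hs => (hder s hs).2) (fun s hs => by
        have hst := hscale t ht s hs
        rw [norm_smul, Real.norm_eq_abs]
        calc _ ≤ 5 / 2 * (c * (K₁ * (‖lam.2‖ + ‖(solMap f Ω (s * t, lam)).2.2‖))) := by
              gcongr
              · exact habs t ht
              · exact (hgb _ _ (hdom lam hlam _ hst).2.1).trans
                  (mul_le_mul_of_nonneg_left (hrough lam hlam _ hst) hc)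
          _ ≤ κ * (‖lam.2‖ + ‖(solMap f Ω (s * t, lam)).2.2‖) := by
              rw [hκ]
              have : 0 ≤ ‖lam.2‖ + ‖(solMap f Ω (s * t, lam)).2.2‖ := by positivity
              nlinarith)
    simpa only [one_mul] using this
  -- the final bounds
  set e : ℝ := 1 + 2 * (c * (1 + L)) with he
  have he0 : 0 ≤ e := by positivity
  have hAD : ∀ lam ∈ V, ∀ t ∈ Icc (-(5 / 2) : ℝ) (5 / 2),
      ‖A (t, h ((solMap f Ω (t, lam)).2, lam))‖ ≤ Cr * e ^ (M₀ + 1) * ‖lam.2‖ ^ (M₀ + 1) ∧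
      ‖D (t, h ((solMap f Ω (t, lam)).2, lam))‖ ≤
        Cr * e ^ i * e ^ M₀ * ((‖lam.1‖ + ‖lam.2‖) ^ i * ‖lam.2‖ ^ M₀) := by
    intro lam hlam t ht
    obtain ⟨hmem, hq, hS, hϱ, hR⟩ := hdom lam hlam t ht
    obtain ⟨htI, hyU⟩ := solMap_mem hΩ hf1 hmem
    obtain ⟨b1, b2⟩ := hhb _ _ lam.1 lam.2 hq hS hR
    have hS' := hlin lam hlam t ht
    have hcc : c * (‖lam.2‖ + ‖(solMap f Ω (t, lam)).2.2‖) ≤ c * (1 + L) * ‖lam.2‖ := by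
      rw [mul_assoc]
      gcongr
      linarith
    have hcL : 0 ≤ c * (1 + L) := by positivity
    have b2' : ‖(h ((solMap f Ω (t, lam)).2, lam)).2‖ ≤ e * ‖lam.2‖ := by
      refine (b2.trans hcc).trans ?_
      gcongr
      linarith
    have b1' : ‖(h ((solMap f Ω (t, lam)).2, lam)).1‖ + ‖(h ((solMap f Ω (t, lam)).2, lam)).2‖
        ≤ e * (‖lam.1‖ + ‖lam.2‖) := by
      have h1 : ‖(h ((solMap f Ω (t, lam)).2, lam)).1‖ ≤ ‖lam.1‖ + c * (1 + L) * ‖lam.2‖ :=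
        b1.trans (by linarith)
      have h2 : ‖(h ((solMap f Ω (t, lam)).2, lam)).2‖ ≤ c * (1 + L) * ‖lam.2‖ := b2.trans hcc
      have h3 : e * (‖lam.1‖ + ‖lam.2‖) = ‖lam.1‖ + 2 * (c * (1 + L) * ‖lam.2‖) +
          (2 * (c * (1 + L)) * ‖lam.1‖ + ‖lam.2‖) := by rw [he]; ring
      have h4 : 0 ≤ 2 * (c * (1 + L)) * ‖lam.1‖ + ‖lam.2‖ := by positivity
      linarith
    constructor
    · refine (hAb t htI _ hyU).trans ?_
      rw [mul_assoc, ← mul_pow]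
      gcongr
    · refine (hDb t htI _ hyU).trans ?_
      calc _ ≤ Cr * (e * (‖lam.1‖ + ‖lam.2‖)) ^ i * (e * ‖lam.2‖) ^ M₀ := by gcongr
        _ = _ := by rw [mul_pow, mul_pow]; ring
  set CA : ℝ := Cr * e ^ (M₀ + 1) with hCA
  set CD : ℝ := Cr * e ^ i * e ^ M₀ with hCD
  have hCA0 : 0 ≤ CA := by positivity
  have hCD0 : 0 ≤ CD := by positivity
  set C : ℝ := 5 / 2 * CA + 5 / 2 * (c * CD) + L + CA + CD with hC
  have hcCD : 0 ≤ c * CD := by positivity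
  refine ⟨V, hV, h0V rfl, C, by positivity, fun lam hlam t ht => ⟨(hdom lam hlam t ht).1, ?_⟩⟩
  rintro x rfl
  obtain ⟨hmem, hq, hS, hϱ, hR⟩ := hdom lam hlam t ht
  obtain ⟨h0, hder⟩ := hrescaled lam hlam t ht
  have hqb : ‖(solMap f Ω (t, lam)).2.1‖ ≤ 5 / 2 * (CA * ‖lam.2‖ ^ (M₀ + 1)) := by
    have := norm_image_sub_le_of_norm_deriv_le_segment_01' (fun s hs => (hder s hs).1)
      (C := 5 / 2 * (CA * ‖lam.2‖ ^ (M₀ + 1))) (fun s hs => by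
        rw [norm_smul, Real.norm_eq_abs]
        gcongr
        · exact habs t ht
        · exact (hAD lam hlam _ (hscale t ht s (Ico_subset_Icc_self hs))).1)
    simpa only [h0, one_mul, Prod.snd_zero, Prod.fst_zero, sub_zero] using this
  have hSb : ‖(solMap f Ω (t, lam)).2.2‖ ≤
      5 / 2 * (c * (CD * ((‖lam.1‖ + ‖lam.2‖) ^ i * ‖lam.2‖ ^ M₀))) := by
    have := norm_image_sub_le_of_norm_deriv_le_segment_01' (fun s hs => (hder s hs).2)
      (C := 5 / 2 * (c * (CD * ((‖lam.1‖ + ‖lam.2‖) ^ i * ‖lam.2‖ ^ M₀)))) (fun s hs => by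
        have hst := hscale t ht s (Ico_subset_Icc_self hs)
        rw [norm_smul, Real.norm_eq_abs]
        gcongr
        · exact habs t ht
        · exact (hgb _ _ (hdom lam hlam _ hst).2.1).trans
            (mul_le_mul_of_nonneg_left (hAD lam hlam _ hst).2 hc))
    simpa only [h0, one_mul, Prod.snd_zero, sub_zero] using this
  have hw : 0 ≤ (‖lam.1‖ + ‖lam.2‖) ^ i * ‖lam.2‖ ^ M₀ := by positivity
  refine ⟨hq, hS, hR, hqb.trans ?_, (hlin lam hlam t ht).trans ?_, hSb.trans ?_,
    (hAD lam hlam t ht).1.trans ?_, (hAD lam hlam t ht).2.trans ?_⟩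
  · rw [← mul_assoc]; gcongr; rw [hC]; linarith
  · gcongr; rw [hC]; linarith
  · rw [mul_assoc C, ← mul_assoc, ← mul_assoc, mul_assoc (5 / 2 : ℝ)]; gcongr; rw [hC]; linarith
  · gcongr; rw [hC]; linarith
  · rw [mul_assoc C]; gcongr; rw [hC]; linarith

/-- The flow of the reduced system for `|t| ≤ 2`, with its regularity, bounds and uniqueness. -/
theorem exists_reduced_flow (hl : 1 ≤ l) (hU : IsOpen U)
    (hT : ContDiffOn ℝ l T (Ioo (-3) 3 ×ˢ U))
    (hA : ContDiffOn ℝ l A (Ioo (-3) 3 ×ˢ U)) (hD : ContDiffOn ℝ l D (Ioo (-3) 3 ×ˢ U))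
    (hg : ContDiff ℝ l g) (hh : ContDiff ℝ l h) (hU₀ : (0, 0) ∈ U) {c Cr : ℝ} (hc : 0 ≤ c)
    (hCr : 0 ≤ Cr) {M₀ i : ℕ} (hM₀ : 1 ≤ M₀)
    (hAb : ∀ t ∈ Ioo (-3 : ℝ) 3, ∀ y ∈ U, ‖A (t, y)‖ ≤ Cr * ‖y.2‖ ^ (M₀ + 1))
    (hDb : ∀ t ∈ Ioo (-3 : ℝ) 3, ∀ y ∈ U,
      ‖D (t, y)‖ ≤ Cr * (‖y.1‖ + ‖y.2‖) ^ i * ‖y.2‖ ^ M₀)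
    (hgb : ∀ q x, ‖q‖ ≤ 1 → ‖g (q, x)‖ ≤ c * ‖x‖)
    (hhb : ∀ q S ϱ R, ‖q‖ ≤ 1 → ‖S‖ ≤ 1 → ‖R‖ ≤ 1 →
      ‖(h ((q, S), (ϱ, R))).1‖ ≤ ‖ϱ‖ + c * (‖R‖ + ‖S‖) ∧
      ‖(h ((q, S), (ϱ, R))).2‖ ≤ c * (‖R‖ + ‖S‖)) :
    ∃ (V : Set (P × Z)) (x : ℝ × P × Z → P × P × H₁) (C : ℝ), IsOpen V ∧ 0 ∈ V ∧ 0 ≤ C ∧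
      ContDiffOn ℝ l x (Ioo (-2) 2 ×ˢ V) ∧
      (∀ lam ∈ V, x (0, lam) = 0 ∧ ∀ t ∈ Icc (-2 : ℝ) 2,
        (t, x (t, lam), lam) ∈ reducedDomain h U ∧
        HasDerivAt (fun t => x (t, lam)) (reducedField T A D g h (t, x (t, lam), lam)) t) ∧
      (∀ lam ∈ V, ∀ t ∈ Icc (-2 : ℝ) 2,
        ‖(x (t, lam)).2.1‖ ≤ 1 ∧ ‖(x (t, lam)).2.2‖ ≤ 1 ∧ ‖lam.2‖ ≤ 1 ∧
        ‖(x (t, lam)).2.1‖ ≤ C * ‖lam.2‖ ^ (M₀ + 1) ∧ ‖(x (t, lam)).2.2‖ ≤ C * ‖lam.2‖ ∧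
        ‖(x (t, lam)).2.2‖ ≤ C * (‖lam.1‖ + ‖lam.2‖) ^ i * ‖lam.2‖ ^ M₀ ∧
        ‖A (t, h ((x (t, lam)).2, lam))‖ ≤ C * ‖lam.2‖ ^ (M₀ + 1) ∧
        ‖D (t, h ((x (t, lam)).2, lam))‖ ≤ C * (‖lam.1‖ + ‖lam.2‖) ^ i * ‖lam.2‖ ^ M₀) ∧
      ∀ lam, ∀ y : ℝ → P × P × H₁, y 0 = 0 →
        (∀ t ∈ Icc (-2 : ℝ) 2, (t, y t, lam) ∈ reducedDomain h U) →
        (∀ t ∈ Icc (-2 : ℝ) 2, HasDerivWithinAt y (reducedField T A D g h (t, y t, lam))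
          (Icc (-2) 2) t) → ∀ t ∈ Icc (-2 : ℝ) 2, y t = x (t, lam) := by
  have hΩ : IsOpen (reducedDomain h U) := isOpen_reducedDomain hU hh.continuous
  have hf : ContDiffOn ℝ l (reducedField T A D g h) (reducedDomain h U) :=
    contDiffOn_reducedField hT hA hD hg hh
  have hf1 : ContDiffOn ℝ 1 (reducedField T A D g h) (reducedDomain h U) :=
    hf.of_le (by exact_mod_cast hl)
  obtain ⟨V, hV, h0V, C, hC, hb⟩ :=
    exists_bounds_solMap hl hU hT hA hD hg hh hU₀ hc hCr hM₀ hAb hDb hgb hhb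
  have hI : ∀ t ∈ Icc (-2 : ℝ) 2, t ∈ Icc (-(5 / 2) : ℝ) (5 / 2) := fun t ht =>
    ⟨by linarith [ht.1], by linarith [ht.2]⟩
  refine ⟨V, solMap (reducedField T A D g h) (reducedDomain h U), C, hV, h0V, hC, ?_,
    fun lam hlam => ⟨?_, fun t ht => ⟨?_, ?_⟩⟩, fun lam hlam t ht => ?_,
    fun lam y hy0 hmem hy t ht => ?_⟩
  · refine (contDiffOn_solMap hΩ hl hf).mono ?_
    rintro ⟨t, lam⟩ ⟨ht, hlam⟩
    exact (hb lam hlam t (hI t (Ioo_subset_Icc_self ht))).1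
  · exact solMap_zero_of_mem hΩ hf1 (hb lam hlam 0 (by norm_num)).1
  · exact solMap_mem hΩ hf1 (hb lam hlam t (hI t ht)).1
  · exact hasDerivAt_solMap hΩ hf1 (hb lam hlam t (hI t ht)).1
  · exact (hb lam hlam t (hI t ht)).2 _ rfl
  · exact (solMap_unique hΩ hf1 (by norm_num) hy0 hmem hy t ht).2.symm

end Reduced

/-! ### The arguments of the coefficients along the moving frame -/

lemma norm_toLp_le_sum {n₀ : ℕ} (f : Fin n₀ → ℝ) :
    ‖(WithLp.toLp 2 f : Rn n₀)‖ ≤ ∑ j, |f j| := by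
  have h : (WithLp.toLp 2 f : Rn n₀) = ∑ j, f j • stdVec j := by
    ext k
    simp [Pi.single_apply]
  rw [h]
  refine (norm_sum_le _ _).trans (Finset.sum_le_sum fun j _ => ?_)
  simp [norm_smul]

namespace IsSymmetrySetup

variable {N n₀ : ℕ} {J : Matrix (Fin (2 * N)) (Fin (2 * N)) ℝ}
  {Dia : Fin n₀ → (L2 N →ₗ.[ℝ] L2 N)} {ord : Fin n₀ → ℕ} {G : Rn n₀ → (L2 N →L[ℝ] L2 N)}
  (hsym : IsSymmetrySetup J Dia ord G) {d : ℕ} (hd : ∀ j, ord j ≤ d)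

/-- The vector of the pairings `⟨R, ◇_j w⟩`. -/
def pairing {n m : ℕ} (h : n + d ≤ m) (R : Sd N n) (w : Sg N m) : Rn n₀ :=
  WithLp.toLp 2 fun j => R (hsym.dS hd j h w)

lemma contDiff_pairing {n m : ℕ} (h : n + d ≤ m) {k : WithTop ℕ∞} :
    ContDiff ℝ k fun x : Sd N n × Sg N m => hsym.pairing hd h x.1 x.2 := by
  rw [contDiff_euclidean]
  intro j
  exact contDiff_fst.clm_apply ((hsym.dS hd j h).contDiff.comp contDiff_snd)

lemma norm_pairing_le {n m : ℕ} (h : n + d ≤ m) : ∃ C, 0 ≤ C ∧ ∀ (R : Sd N n) (w : Sg N m),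
    ‖hsym.pairing hd h R w‖ ≤ C * (‖R‖ * ‖w‖) := by
  refine ⟨∑ j, ‖hsym.dS hd j h‖, by positivity, fun R w => ?_⟩
  refine (norm_toLp_le_sum _).trans ?_
  rw [Finset.sum_mul]
  refine Finset.sum_le_sum fun j _ => ?_
  calc |R (hsym.dS hd j h w)| ≤ ‖R‖ * ‖hsym.dS hd j h w‖ := R.le_opNorm _
    _ ≤ ‖R‖ * (‖hsym.dS hd j h‖ * ‖w‖) := by gcongr; exact ContinuousLinearMap.le_opNorm _ _
    _ = _ := by ring

lemma momentum_eq_pairing {m : ℕ} (h : 0 + d ≤ m) (w : Sg N m) :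
    momentum Dia (fn w) = (1 / 2 : ℝ) • hsym.pairing hd h (toSd 0 (fn w)) w := by
  ext j
  simp only [momentum, pairing, PiLp.smul_apply, toSd_apply, fn_dS, smul_eq_mul]
  rw [real_inner_comm]

include hsym hd in
lemma contDiff_momentum {m : ℕ} (h : d ≤ m) {k : WithTop ℕ∞} :
    ContDiff ℝ k fun w : Sg N m => momentum Dia (fn w) := by
  simp only [hsym.momentum_eq_pairing hd (by omega : 0 + d ≤ m)]
  refine ((hsym.contDiff_pairing hd _).comp (ContDiff.prodMk ?_ contDiff_id)).const_smul _
  exact (toSdL N 0 ∘L fn : Sg N m →L[ℝ] Sd N 0).contDiff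

include hsym hd in
lemma norm_momentum_le {m : ℕ} (h : d ≤ m) : ∃ C, 0 ≤ C ∧ ∀ w : Sg N m,
    ‖momentum Dia (fn w)‖ ≤ C * (‖w‖ * ‖w‖) := by
  obtain ⟨C, hC0, hC⟩ := hsym.norm_pairing_le hd (by omega : 0 + d ≤ m)
  set L : Sg N m →L[ℝ] Sd N 0 := toSdL N 0 ∘L fn
  refine ⟨1 / 2 * (C * ‖L‖), by positivity, fun w => ?_⟩
  rw [hsym.momentum_eq_pairing hd (by omega : 0 + d ≤ m), norm_smul]
  calc _ ≤ ‖(1 / 2 : ℝ)‖ * (C * (‖L w‖ * ‖w‖)) := by gcongr; exact hC _ _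
    _ ≤ ‖(1 / 2 : ℝ)‖ * (C * (‖L‖ * ‖w‖ * ‖w‖)) := by gcongr; exact L.le_opNorm w
    _ = _ := by norm_num; ring

/-- Expansion of the quadratic map `Π` at `u + w`, with the cross term as a pairing of `u` with
`◇w`. -/
lemma momentum_add {n m s : ℕ} (h : n + d ≤ m) (hs : d ≤ s) (u : Sg N s) (w : Sg N m) :
    momentum Dia (fn u + fn w) = momentum Dia (fn u) + hsym.pairing hd h (toSd n (fn u)) w
      + momentum Dia (fn w) := by
  ext j
  have hu : fn u ∈ (Dia j).domain := hsym.fn_mem_domain ((hd j).trans hs) u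
  have hw : fn w ∈ (Dia j).domain := hsym.fn_mem_domain ((hd j).trans (by omega)) w
  simp only [momentum, pairing, PiLp.add_apply, app_add hu hw, inner_add_left, inner_add_right,
    toSd_apply, fn_dS]
  rw [hsym.inner_Dia hw hu, real_inner_comm (app (Dia j) (fn u)) (fn w),
    hsym.inner_Dia hu hw]
  ring

lemma momentum_sub {n m s : ℕ} (h : n + d ≤ m) (hs : d ≤ s) (u : Sg N s) (w : Sg N m) :
    momentum Dia (fn u - fn w) = momentum Dia (fn u) - hsym.pairing hd h (toSd n (fn u)) w
      + momentum Dia (fn w) := by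
  have h1 := hsym.momentum_add hd h hs u (-w)
  have h2 : hsym.pairing hd h (toSd n (fn u)) (-w) = -hsym.pairing hd h (toSd n (fn u)) w := by
    ext j; simp [pairing]
  have h3 : momentum Dia (fn (-w)) = momentum Dia (fn w) := by
    rw [hsym.momentum_eq_pairing hd (by omega : 0 + d ≤ m),
      hsym.momentum_eq_pairing hd (by omega : 0 + d ≤ m)]
    ext j
    simp [pairing]
  rw [h2, h3, map_neg] at h1
  rw [sub_eq_add_neg, sub_eq_add_neg, h1]

/-- The functional `e^{Jq·◇}(R + S)` in `Σ_{-r}`, for `R ∈ Σ_{-m}`: the group acts by duality. -/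
def movedFrame {m n r : ℕ} (hmr : m ≤ r) (x : Rn n₀ × Sg N n) (R : Sd N m) : Sd N r :=
  (R + toSdL N m (fn x.2)).comp (hsym.gI hmr (-x.1))

lemma movedFrame_toSd {m n r : ℕ} (hmr : m ≤ r) (x : Rn n₀ × Sg N n) (u : L2 N) :
    hsym.movedFrame hmr x (toSd m u) = toSd r (G x.1 (u + fn x.2)) := by
  ext w
  simp only [movedFrame, ContinuousLinearMap.comp_apply, add_apply, toSdL_apply,
    toSd_apply, fn_gI, hsym.inner_G_left, inner_add_left]

include hd in
lemma contDiff_movedFrame {m n r l : ℕ} (h : m + (l + 1) * d ≤ r) (hmr : m ≤ r) :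
    ContDiff ℝ l fun x : (Rn n₀ × Sg N n) × Sd N m => hsym.movedFrame hmr x.1 x.2 := by
  have h1 : ContDiff ℝ l fun x : (Rn n₀ × Sg N n) × Sd N m => x.2 + toSdL N m (fn x.1.2) :=
    contDiff_snd.add ((toSdL N m ∘L fn : Sg N n →L[ℝ] Sd N m).contDiff.comp
      (contDiff_snd.comp contDiff_fst))
  have h2 : ContDiff ℝ l fun x : (Rn n₀ × Sg N n) × Sd N m => hsym.gI hmr (-x.1.1) :=
    (hsym.contDiff_gI_op hd l h hmr).comp (contDiff_neg.comp (contDiff_fst.comp contDiff_fst))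
  exact h1.clm_comp h2

lemma norm_gI_le {m r : ℕ} (hmr : m ≤ r) (c : ℝ) :
    ∃ C, 0 ≤ C ∧ ∀ q, ‖q‖ ≤ c → ‖hsym.gI hmr q‖ ≤ C := by
  obtain ⟨C, hC0, hC⟩ := hsym.gS_bound m c
  refine ⟨C * ‖(sgIncl hmr : Sg N r →L[ℝ] Sg N m)‖, by positivity, fun q hq => ?_⟩
  exact (ContinuousLinearMap.opNorm_comp_le _ _).trans (by gcongr; exact hC q hq)

lemma norm_movedFrame_le {m n r : ℕ} (hmr : m ≤ r) : ∃ C, 0 ≤ C ∧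
    ∀ (q : Rn n₀) (S : Sg N n) (R : Sd N m), ‖q‖ ≤ 1 →
      ‖hsym.movedFrame hmr (q, S) R‖ ≤ C * (‖R‖ + ‖S‖) := by
  obtain ⟨C, hC0, hC⟩ := hsym.norm_gI_le hmr 1
  set L : Sg N n →L[ℝ] Sd N m := toSdL N m ∘L fn
  refine ⟨(1 + ‖L‖) * C, by positivity, fun q S R hq => ?_⟩
  calc _ ≤ ‖R + L S‖ * ‖hsym.gI hmr (-q)‖ := ContinuousLinearMap.opNorm_comp_le _ _
    _ ≤ (‖R‖ + ‖L‖ * ‖S‖) * C := by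
      gcongr
      · exact (norm_add_le _ _).trans (by gcongr; exact L.le_opNorm S)
      · exact hC _ (by simpa using hq)
    _ ≤ ((1 + ‖L‖) * (‖R‖ + ‖S‖)) * C := by
      gcongr
      nlinarith [norm_nonneg R, norm_nonneg S, norm_nonneg L,
        mul_nonneg (norm_nonneg L) (norm_nonneg R)]
    _ = _ := by ring

variable {O : Set (Rn n₀)} {Φ : Rn n₀ → L2 N} {p₀ : Rn n₀}

include hsym hd in
/-- The arguments `(Π(R), R)` of the coefficients as a function of `q`, `S`, and of the datum
`(ϱ, R₀)`, where `R` is the projection of `e^{Jq·◇}(R₀ + S)` to `N_g^⊥(𝓗_{p₀}^*)`. Since the group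
preserves `Π`, the component `Π(R)` has an expression which makes sense for `R₀` in `Σ_{-m}` when
`Π(R₀)` is replaced by `ϱ`. -/
lemma exists_arguments (hΦ : IsSolitonFamily J Dia O Φ) (hp₀ : p₀ ∈ O) {l m n r : ℕ}
    (hmr : m + (l + 1) * d ≤ r) (hn : m + d ≤ n) :
    ∃ h : (Rn n₀ × Sg N n) × (Rn n₀ × Sd N m) → Rn n₀ × perpNeg (NgStar J Dia Φ p₀) r,
      ContDiff ℝ l h ∧
      (∃ c : ℝ, 0 ≤ c ∧ ∀ q S ϱ R, ‖q‖ ≤ 1 → ‖S‖ ≤ 1 → ‖R‖ ≤ 1 →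
        ‖(h ((q, S), (ϱ, R))).1‖ ≤ ‖ϱ‖ + c * (‖R‖ + ‖S‖) ∧
        ‖(h ((q, S), (ϱ, R))).2‖ ≤ c * (‖R‖ + ‖S‖)) ∧
      ∀ q S (u₀ : Sg N d), ∀ u, u = G q (fn u₀ + fn S) →
        (h ((q, S), (momentum Dia (fn u₀), toSd m (fn u₀)))).1 =
          momentum Dia (u - projNg J Dia Φ p₀ u) ∧
        (h ((q, S), (momentum Dia (fn u₀), toSd m (fn u₀)))).2.1 =
          toSd r (u - projNg J Dia Φ p₀ u) := by
  have hmr' : m ≤ r := le_trans (Nat.le_add_right _ _) hmr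
  obtain ⟨E, hE, hE'⟩ := hΦ.exists_projection hp₀ hsym r (r + d)
  obtain ⟨Q, hQb, hQ⟩ := IsSolitonFamily.exists_proj_perpNeg E hE'
  let Wf : (Rn n₀ × Sg N n) × (Rn n₀ × Sd N m) → Sd N r :=
    fun x => hsym.movedFrame hmr' x.1 x.2.2
  have hWf : ContDiff ℝ l Wf :=
    (hsym.contDiff_movedFrame hd hmr hmr').comp (by fun_prop :
      ContDiff ℝ l fun x : (Rn n₀ × Sg N n) × (Rn n₀ × Sd N m) => (x.1, x.2.2))
  let h : (Rn n₀ × Sg N n) × (Rn n₀ × Sd N m) → Rn n₀ × perpNeg (NgStar J Dia Φ p₀) r :=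
    fun x => (x.2.1 + hsym.pairing hd hn x.2.2 x.1.2 + momentum Dia (fn x.1.2)
      - hsym.pairing hd le_rfl (Wf x) (E (Wf x)) + momentum Dia (fn (E (Wf x))), Q (Wf x))
  refine ⟨h, ?_, ?_, ?_⟩
  · refine ContDiff.prodMk ?_ (hQb.contDiff.comp hWf)
    refine ContDiff.add (ContDiff.sub (ContDiff.add (ContDiff.add (by fun_prop) ?_) ?_) ?_) ?_
    · exact (hsym.contDiff_pairing hd hn).comp (by fun_prop :
        ContDiff ℝ l fun x : (Rn n₀ × Sg N n) × (Rn n₀ × Sd N m) => (x.2.2, x.1.2))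
    · exact (hsym.contDiff_momentum hd (by omega : d ≤ n)).comp (by fun_prop :
        ContDiff ℝ l fun x : (Rn n₀ × Sg N n) × (Rn n₀ × Sd N m) => x.1.2)
    · exact (hsym.contDiff_pairing hd (le_refl (r + d))).comp (hWf.prodMk (E.contDiff.comp hWf))
    · exact (hsym.contDiff_momentum hd (by omega : d ≤ r + d)).comp (E.contDiff.comp hWf)
  · obtain ⟨c₁, hc₁, h₁⟩ := hsym.norm_pairing_le hd hn
    obtain ⟨c₂, hc₂, h₂⟩ := hsym.norm_momentum_le hd (by omega : d ≤ n)
    obtain ⟨c₃, hc₃, h₃⟩ := hsym.norm_pairing_le hd (le_refl (r + d))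
    obtain ⟨c₄, hc₄, h₄⟩ := hsym.norm_momentum_le hd (by omega : d ≤ r + d)
    obtain ⟨b, hb, hQn⟩ := hQb.bound
    obtain ⟨a, ha, hW⟩ := hsym.norm_movedFrame_le (n := n) hmr'
    refine ⟨c₁ + c₂ + c₃ * (a * (‖E‖ * a) * 2) + c₄ * (‖E‖ * a * (‖E‖ * a) * 2) + b * a,
      by positivity, fun q S ϱ R hq hS hR => ?_⟩
    have hWn := hW q S R hq
    set w := ‖R‖ + ‖S‖ with hw
    have hw0 : 0 ≤ w := by positivity
    have hw2 : w ≤ 2 := by linarith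
    set V := hsym.movedFrame hmr' (q, S) R with hV
    have hEV : ‖E V‖ ≤ ‖E‖ * (a * w) := (E.le_opNorm V).trans (by gcongr)
    have hww : w * w ≤ 2 * w := by nlinarith
    have b1 : ‖hsym.pairing hd hn R S‖ ≤ c₁ * w := by
      refine (h₁ R S).trans ?_
      gcongr
      nlinarith [norm_nonneg R, norm_nonneg S]
    have b2 : ‖momentum Dia (fn S)‖ ≤ c₂ * w := by
      refine (h₂ S).trans ?_
      gcongr
      nlinarith [norm_nonneg R, norm_nonneg S]
    have b3 : ‖hsym.pairing hd le_rfl V (E V)‖ ≤ c₃ * (a * (‖E‖ * a) * 2) * w := by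
      calc _ ≤ c₃ * (‖V‖ * ‖E V‖) := h₃ _ _
        _ ≤ c₃ * ((a * w) * (‖E‖ * (a * w))) := by gcongr
        _ = c₃ * (a * (‖E‖ * a)) * (w * w) := by ring
        _ ≤ c₃ * (a * (‖E‖ * a)) * (2 * w) := by gcongr
        _ = _ := by ring
    have b4 : ‖momentum Dia (fn (E V))‖ ≤ c₄ * (‖E‖ * a * (‖E‖ * a) * 2) * w := by
      calc _ ≤ c₄ * (‖E V‖ * ‖E V‖) := h₄ _
        _ ≤ c₄ * ((‖E‖ * (a * w)) * (‖E‖ * (a * w))) := by gcongr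
        _ = c₄ * (‖E‖ * a * (‖E‖ * a)) * (w * w) := by ring
        _ ≤ c₄ * (‖E‖ * a * (‖E‖ * a)) * (2 * w) := by gcongr
        _ = _ := by ring
    have b5 : ‖Q V‖ ≤ b * a * w := by
      calc _ ≤ b * ‖V‖ := hQn V
        _ ≤ b * (a * w) := by gcongr
        _ = _ := by ring
    have p3 : 0 ≤ c₃ * (a * (‖E‖ * a) * 2) * w := by positivity
    have p4 : 0 ≤ c₄ * (‖E‖ * a * (‖E‖ * a) * 2) * w := by positivity
    have p5 : 0 ≤ b * a * w := by positivity
    constructor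
    · change ‖ϱ + hsym.pairing hd hn R S + momentum Dia (fn S)
        - hsym.pairing hd le_rfl V (E V) + momentum Dia (fn (E V))‖ ≤ _
      refine (norm_add_le _ _).trans ?_
      have i1 := norm_sub_le (ϱ + hsym.pairing hd hn R S + momentum Dia (fn S))
        (hsym.pairing hd le_rfl V (E V))
      have i2 := norm_add_le (ϱ + hsym.pairing hd hn R S) (momentum Dia (fn S))
      have i3 := norm_add_le ϱ (hsym.pairing hd hn R S)
      linarith
    · change ‖Q V‖ ≤ _
      refine b5.trans ?_
      gcongr
      have : 0 ≤ c₁ + c₂ + c₃ * (a * (‖E‖ * a) * 2) + c₄ * (‖E‖ * a * (‖E‖ * a) * 2) := by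
        positivity
      linarith
  · rintro q S u₀ u rfl
    have hWu : Wf ((q, S), (momentum Dia (fn u₀), toSd m (fn u₀))) =
        toSd r (G q (fn u₀ + fn S)) := hsym.movedFrame_toSd hmr' (q, S) (fn u₀)
    have hdn : d ≤ n := by omega
    have hu : G q (fn u₀ + fn S) = fn (hsym.gS d q (u₀ + sgIncl hdn S)) := by simp
    have hEu := hE (G q (fn u₀ + fn S))
    constructor
    · change _ + _ + _ - hsym.pairing hd le_rfl (Wf _) (E (Wf _)) + momentum Dia (fn (E (Wf _))) = _
      rw [hWu, ← hEu]
      conv_rhs => rw [hu, hsym.momentum_sub hd (le_refl (r + d)) le_rfl, ← hu]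
      rw [hsym.momentum_G, hsym.momentum_add hd hn le_rfl]
    · change (Q (Wf _)).1 = _
      rw [hWu, hQ, ← hEu]
      ext w
      simp [inner_sub_left]

end IsSymmetrySetup

/-! ### The correspondence with the original system -/

lemma exists_primitive_Icc {E : Type*} [NormedAddCommGroup E] [NormedSpace ℝ E] [CompleteSpace E]
    {a : ℝ} (ha : 0 ≤ a) {φ : ℝ → E} (hφ : ContinuousOn φ (Icc (-a) a)) :
    ∃ Ψ : ℝ → E, Ψ 0 = 0 ∧ ∀ t ∈ Icc (-a) a, HasDerivWithinAt Ψ (φ t) (Icc (-a) a) t := by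
  have hle : -a ≤ a := by linarith
  have hc : Continuous (IccExtend hle ((Icc (-a) a).domRestrict φ)) :=
    (continuousOn_iff_continuous_domRestrict.1 hφ).Icc_extend'
  refine ⟨fun t => ∫ s in (0 : ℝ)..t, IccExtend hle ((Icc (-a) a).domRestrict φ) s, by simp,
    fun t ht => ?_⟩
  have h := (hc.integral_hasStrictDerivAt 0 t).hasDerivAt.hasDerivWithinAt (s := Icc (-a) a)
  rwa [IccExtend_of_mem hle _ ht] at h

lemma HasDerivWithinAt.components {E F H : Type*} [NormedAddCommGroup E] [NormedSpace ℝ E]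
    [NormedAddCommGroup F] [NormedSpace ℝ F] [NormedAddCommGroup H] [NormedSpace ℝ H]
    {x : ℝ → E × F × H} {a : E} {b : F} {c : H} {s : Set ℝ} {t : ℝ}
    (hx : HasDerivWithinAt x (a, b, c) s t) :
    HasDerivWithinAt (fun t => (x t).1) a s t ∧ HasDerivWithinAt (fun t => (x t).2.1) b s t ∧
      HasDerivWithinAt (fun t => (x t).2.2) c s t := by
  have h1 := (ContinuousLinearMap.fst ℝ E (F × H)).hasFDerivAt.comp_hasDerivWithinAt t hx
  have h2 := (ContinuousLinearMap.snd ℝ E (F × H)).hasFDerivAt.comp_hasDerivWithinAt t hx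
  have h3 := (ContinuousLinearMap.fst ℝ F H).hasFDerivAt.comp_hasDerivWithinAt t h2
  have h4 := (ContinuousLinearMap.snd ℝ F H).hasFDerivAt.comp_hasDerivWithinAt t h2
  exact ⟨h1, h3, h4⟩

/-- If `(P u)' = ∑_j a_j L_j (P u)` with bounded coefficients and `P u` vanishes at `0`, then it
vanishes identically. -/
lemma clm_apply_eq_zero_of_hasDerivWithinAt {E : Type*} [NormedAddCommGroup E] [NormedSpace ℝ E]
    {n₀ : ℕ} {a : ℝ} (ha : 0 ≤ a) (P : E →L[ℝ] E) (L : Fin n₀ → E →L[ℝ] E) {u F : ℝ → E}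
    {c : ℝ → Rn n₀} {B : ℝ} (h0 : P (u 0) = 0)
    (hu : ∀ t ∈ Icc (-a) a, HasDerivWithinAt u (F t) (Icc (-a) a) t)
    (hF : ∀ t ∈ Icc (-a) a, P (F t) = ∑ j, c t j • L j (P (u t)))
    (hB : ∀ t ∈ Icc (-a) a, ‖c t‖ ≤ B) : ∀ t ∈ Icc (-a) a, P (u t) = 0 := by
  refine eq_zero_of_norm_deriv_le (y := fun t => P (u t)) (y' := fun t => P (F t))
    (κ := B * ∑ j, ‖L j‖) ha h0 (fun t ht => ?_) (fun t ht => ?_)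
  · have := P.hasFDerivAt.comp_hasDerivWithinAt t (hu t ht)
    exact this
  · rw [hF t ht, mul_assoc, Finset.sum_mul, Finset.mul_sum]
    refine (norm_sum_le _ _).trans (Finset.sum_le_sum fun j _ => ?_)
    rw [norm_smul]
    gcongr
    · exact (norm_nonneg _).trans (hB t ht)
    · exact (PiLp.norm_apply_le _ j).trans (hB t ht)
    · exact ContinuousLinearMap.le_opNorm _ _

section Correspondence

variable {N n₀ : ℕ} {J : Matrix (Fin (2 * N)) (Fin (2 * N)) ℝ}
  {Dia : Fin n₀ → (L2 N →ₗ.[ℝ] L2 N)} {ord : Fin n₀ → ℕ} {G : Rn n₀ → (L2 N →L[ℝ] L2 N)}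
  {O : Set (Rn n₀)} {Φ : Rn n₀ → L2 N} {p₀ : Rn n₀} {K : Submodule ℝ (L2 N)}

lemma continuous_toPerpNeg (r s : ℕ) : Continuous fun R : perp K s => toPerpNeg r R := by
  refine Continuous.subtype_mk (f := fun R : perp K s => toSdL N r (fn R.1)) ?_ _
  exact (toSdL N r).continuous.comp (fn.continuous.comp continuous_subtype_val)

variable (hsym : IsSymmetrySetup J Dia ord G) {d : ℕ} (hd : ∀ j, ord j ≤ d)
include hsym hd

omit hd in
lemma continuousOn_gI {n m : ℕ} (h : n ≤ m) {X : Type*} [TopologicalSpace X] {s : Set X}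
    {q : X → Rn n₀} {y : X → Sg N m} (hq : ContinuousOn q s) (hy : ContinuousOn y s) :
    ContinuousOn (fun x => hsym.gI h (q x) (y x)) s := by
  have h1 : ContinuousOn (fun x => (q x, y x)) s := hq.prodMk hy
  have h2 := hsym.continuous_gI_uncurry h
  have h3 := h2.comp_continuousOn h1
  exact h3

/-- The derivative of `e^{Jq(t)·◇} y(t)`. -/
lemma hasDerivWithinAt_G_apply {q : ℝ → Rn n₀} {q' : Rn n₀} {y : ℝ → L2 N} {y' : L2 N} {s : Set ℝ}
    {t : ℝ} (hq : HasDerivWithinAt q q' s t) (hy : HasDerivWithinAt y y' s t) {x : Sg N d}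
    (hx : fn x = y t) :
    HasDerivWithinAt (fun t => G (q t) (y t))
      (G (q t) y' + ∑ j, q' j • matOp J (app (Dia j) (G (q t) (y t)))) s t := by
  refine hasDerivWithinAt_clm_apply (C := 1) (fun t => hsym.opNorm_G_le _) hy
    ((hsym.group_cont y').continuousAt.comp_continuousWithinAt hq.continuousWithinAt) ?_
  have h1 := fn.hasFDerivAt.comp_hasDerivWithinAt t
    ((hsym.hasFDerivAt_gI_apply hd (by omega : 0 + d ≤ d) x (q t)).comp_hasDerivWithinAt t hq)
  have e1 : (fn ∘ (fun q => hsym.gI (by omega : 0 ≤ d) q x) ∘ q : ℝ → L2 N)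
      = fun u => G (q u) (y t) := by
    funext u
    simp [hx]
  rw [e1] at h1
  have e2 : fn (ofPartials (fun j => hsym.gS 0 (q t) (hsym.bS hd j (by omega : 0 + d ≤ d) x)) q')
      = ∑ j, q' j • matOp J (app (Dia j) (G (q t) (y t))) := by
    simp [hx, hsym.G_matOp, hsym.app_G]
  rw [← e2]
  exact h1

variable (hΦ : IsSolitonFamily J Dia O Φ) (hp₀ : p₀ ∈ O) {m n r : ℕ} (hmd : m + d ≤ n)
  (hnr : n ≤ r)
  {T A : ℝ × Rn n₀ × perpNeg (NgStar J Dia Φ p₀) r → Rn n₀}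
  {D : ℝ × Rn n₀ × perpNeg (NgStar J Dia Φ p₀) r → Sg N r}
  {U : Set (Rn n₀ × perpNeg (NgStar J Dia Φ p₀) r)}
  {h : (Rn n₀ × Sg N n) × (Rn n₀ × Sd N m) → Rn n₀ × perpNeg (NgStar J Dia Φ p₀) r}
  (hh : ∀ q S (u₀ : Sg N d), ∀ u, u = G q (fn u₀ + fn S) →
    (h ((q, S), (momentum Dia (fn u₀), toSd m (fn u₀)))).1 =
      momentum Dia (u - projNg J Dia Φ p₀ u) ∧
    (h ((q, S), (momentum Dia (fn u₀), toSd m (fn u₀)))).2.1 =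
      toSd r (u - projNg J Dia Φ p₀ u))
include hΦ hp₀ hmd hh

omit hsym hd hΦ hp₀ hmd in
/-- If `e^{Jq·◇}(R₀ + S)` is the function `R`, orthogonal to `N_g(𝓗_{p₀}^*)`, then `h` gives the
arguments `(Π(R), R)`. -/
lemma arguments_eq {q : Rn n₀} {S : Sg N n} {u₀ : Sg N d}
    {R : perp (NgStar J Dia Φ p₀) d}
    (hR : fn R.1 = G q (fn u₀ + fn S) - projNg J Dia Φ p₀ (G q (fn u₀ + fn S))) :
    h ((q, S), (momentum Dia (fn u₀), toSd m (fn u₀))) =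
      (momentum Dia (fn R.1), toPerpNeg r R) := by
  obtain ⟨h1, h2⟩ := hh q S u₀ _ rfl
  refine Prod.ext ?_ (Subtype.ext ?_)
  · rw [h1, hR]
  · rw [h2, ← hR]
    rfl

/-- Solutions of the reduced system with the datum of `R₀ ∈ Σ_d ∩ N_g^⊥(𝓗_{p₀}^*)` give solutions
`R = e^{Jq·◇}(R₀ + S)` of the original one. The orthogonality of `R` to `N_g(𝓗_{p₀}^*)` propagates:
since the field is annihilated by `P_{N_g}` at the point `R - P_{N_g}R`, the function `P_{N_g}R`
satisfies a homogeneous linear differential equation. -/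
lemma solution_of_reduced {a : ℝ} (ha : 0 ≤ a) (ha3 : a < 3)
    (htangent : ∀ t ∈ Ioo (-3 : ℝ) 3, ∀ R : perp (NgStar J Dia Φ p₀) d,
      (momentum Dia (fn R.1), toPerpNeg r R) ∈ U →
      projNg J Dia Φ p₀ (∑ j, A (t, momentum Dia (fn R.1), toPerpNeg r R) j •
        matOp J (app (Dia j) (fn R.1)) + fn (D (t, momentum Dia (fn R.1), toPerpNeg r R))) = 0)
    (R₀ : perp (NgStar J Dia Φ p₀) d) {lam : Rn n₀ × Sd N m}
    (hlam : lam = (momentum Dia (fn R₀.1), toSd m (fn R₀.1))) {B : ℝ}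
    {x : ℝ → Rn n₀ × Rn n₀ × Sg N n} (hx0 : x 0 = 0)
    (hU : ∀ t ∈ Icc (-a) a, h ((x t).2, lam) ∈ U)
    (hB : ∀ t ∈ Icc (-a) a, ‖A (t, h ((x t).2, lam))‖ ≤ B)
    (hx : ∀ t ∈ Icc (-a) a, HasDerivWithinAt x
      (reducedField T A D (fun y => hsym.gI hnr (-y.1) y.2) h (t, x t, lam)) (Icc (-a) a) t)
    {R : ℝ → perp (NgStar J Dia Φ p₀) d}
    (hR : ∀ t, fn (R t).1 = G (x t).2.1 (fn R₀.1 + fn (x t).2.2)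
      - projNg J Dia Φ p₀ (G (x t).2.1 (fn R₀.1 + fn (x t).2.2))) :
    ∀ t ∈ Icc (-a) a, fn (R t).1 = G (x t).2.1 (fn R₀.1 + fn (x t).2.2) ∧
      h ((x t).2, lam) = (momentum Dia (fn (R t).1), toPerpNeg r (R t)) ∧
      HasDerivWithinAt (fun t => fn (R t).1)
        (∑ j, A (t, h ((x t).2, lam)) j • matOp J (app (Dia j) (fn (R t).1))
          + fn (D (t, h ((x t).2, lam)))) (Icc (-a) a) t := by
  set I := Icc (-a) a with hI
  have hdn : d ≤ n := by omega
  have harg : ∀ t, h ((x t).2, lam) = (momentum Dia (fn (R t).1), toPerpNeg r (R t)) := fun t => by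
    rw [hlam]
    exact arguments_eq hh (hR t)
  set u : ℝ → L2 N := fun t => G (x t).2.1 (fn R₀.1 + fn (x t).2.2) with hu
  let F : ℝ → L2 N := fun t => ∑ j, A (t, h ((x t).2, lam)) j • matOp J (app (Dia j) (u t))
    + fn (D (t, h ((x t).2, lam)))
  have hud : ∀ t ∈ I, HasDerivWithinAt u (F t) I t := by
    intro t ht
    obtain ⟨-, hq, hS⟩ := HasDerivWithinAt.components (hx t ht)
    have h2 := fn.hasFDerivAt.comp_hasDerivWithinAt t hS
    have hy : HasDerivWithinAt (fun t => fn R₀.1 + fn (x t).2.2)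
      (fn (hsym.gI hnr (-(x t).2.1) (D (t, h ((x t).2, lam))))) I t := h2.const_add (fn R₀.1)
    have hx' : fn (R₀.1 + sgIncl hdn (x t).2.2) = fn R₀.1 + fn (x t).2.2 := by simp
    have h3 := hasDerivWithinAt_G_apply hsym hd hq hy hx'
    rw [hsym.fn_gI, hsym.G_apply_neg, add_comm] at h3
    exact h3
  -- the component `P_{N_g} R` vanishes
  obtain ⟨P, hP⟩ := hΦ.exists_projNg_clm hp₀ hsym d
  let P' : L2 N →L[ℝ] L2 N := fn ∘L P
  let L : Fin n₀ → L2 N →L[ℝ] L2 N := fun j =>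
    P' ∘L matOp J ∘L fn ∘L hsym.dS hd j (by omega : 0 + d ≤ d) ∘L P
  have hLj : ∀ j v, L j v = projNg J Dia Φ p₀ (matOp J (app (Dia j) (projNg J Dia Φ p₀ v))) := by
    intro j v
    simp [L, P', hP]
  have hPn : ∀ v, P' v = projNg J Dia Φ p₀ v := hP
  have hu0 : P' (u 0) = 0 := by
    have : u 0 = fn R₀.1 := by simp [hu, hx0, hsym.G_zero_apply]
    rw [this, hPn]
    exact IsSolitonFamily.projNg_eq_zero R₀.2
  have hF : ∀ t ∈ I, P' (F t) = ∑ j, A (t, h ((x t).2, lam)) j • L j (P' (u t)) := by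
    intro t ht
    have htan := htangent t ⟨by linarith [ht.1], by linarith [ht.2]⟩ (R t)
      (by rw [← harg]; exact hU t ht)
    rw [← harg] at htan
    have hterm : ∀ j, matOp J (app (Dia j) (u t)) = matOp J (app (Dia j) (fn (R t).1))
        + matOp J (app (Dia j) (projNg J Dia Φ p₀ (u t))) := by
      intro j
      have h1 : fn (R t).1 ∈ (Dia j).domain := hsym.fn_mem_domain (hd j) _
      have h2 : projNg J Dia Φ p₀ (u t) ∈ (Dia j).domain := by
        rw [← hP]
        exact hsym.fn_mem_domain (hd j) _
      rw [← map_add, ← app_add h1 h2, hR, sub_add_cancel]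
    have hdec : F t = (∑ j, A (t, h ((x t).2, lam)) j • matOp J (app (Dia j) (fn (R t).1))
        + fn (D (t, h ((x t).2, lam)))) + ∑ j, A (t, h ((x t).2, lam)) j •
          matOp J (app (Dia j) (projNg J Dia Φ p₀ (u t))) := by
      simp only [F, hterm, smul_add, Finset.sum_add_distrib]
      abel
    rw [hdec, map_add, hPn, htan, zero_add, map_sum]
    refine Finset.sum_congr rfl fun j _ => ?_
    rw [map_smul, hPn, hPn, hLj, hΦ.projNg_projNg hp₀ hsym]
  have hproj : ∀ t ∈ I, projNg J Dia Φ p₀ (u t) = 0 := fun t ht => by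
    rw [← hPn]
    exact clm_apply_eq_zero_of_hasDerivWithinAt ha P' L hu0 hud hF hB t ht
  have hRu : ∀ t ∈ I, fn (R t).1 = u t := fun t ht => by rw [hR, hproj t ht, sub_zero]
  intro t ht
  refine ⟨hRu t ht, harg t, ?_⟩
  rw [hRu t ht]
  exact (hud t ht).congr hRu (hRu t ht)

omit hΦ hp₀ hmd in
/-- Solutions of the original system come from solutions of the reduced one: with `q = ∫ 𝒜` and
`S = ∫ e^{-Jq·◇} 𝒟` one has `R = e^{Jq·◇}(R₀ + S)`. -/
lemma reduced_of_solution {a : ℝ} (ha : 0 ≤ a) (ha3 : a < 3)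
    (hAc : ContinuousOn A (Ioo (-3) 3 ×ˢ U)) (hDc : ContinuousOn D (Ioo (-3) 3 ×ˢ U))
    {R : ℝ → perp (NgStar J Dia Φ p₀) d} {τ : ℝ → Rn n₀} {lam : Rn n₀ × Sd N m}
    (hlam : lam = (momentum Dia (fn (R 0).1), toSd m (fn (R 0).1)))
    (hRc : ContinuousOn R (Icc (-a) a))
    (hU : ∀ t ∈ Icc (-a) a, (momentum Dia (fn (R t).1), toPerpNeg r (R t)) ∈ U)
    (hτ : ∀ t ∈ Icc (-a) a, HasDerivWithinAt τ
      (T (t, momentum Dia (fn (R t).1), toPerpNeg r (R t))) (Icc (-a) a) t)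
    (hR : ∀ t ∈ Icc (-a) a, HasDerivWithinAt (fun t => fn (R t).1)
      (∑ j, A (t, momentum Dia (fn (R t).1), toPerpNeg r (R t)) j •
        matOp J (app (Dia j) (fn (R t).1))
          + fn (D (t, momentum Dia (fn (R t).1), toPerpNeg r (R t)))) (Icc (-a) a) t) :
    ∃ x : ℝ → Rn n₀ × Rn n₀ × Sg N n, x 0 = 0 ∧
      (∀ t ∈ Icc (-a) a, (t, x t, lam) ∈ reducedDomain h U) ∧
      (∀ t ∈ Icc (-a) a, HasDerivWithinAt x
        (reducedField T A D (fun y => hsym.gI hnr (-y.1) y.2) h (t, x t, lam)) (Icc (-a) a) t) ∧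
      ∀ t ∈ Icc (-a) a, τ t = τ 0 + (x t).1 ∧
        fn (R t).1 = G (x t).2.1 (fn (R 0).1 + fn (x t).2.2) := by
  set I := Icc (-a) a with hI
  have h0I : (0 : ℝ) ∈ I := ⟨by linarith, ha⟩
  set α : ℝ → ℝ × Rn n₀ × perpNeg (NgStar J Dia Φ p₀) r :=
    fun t => (t, momentum Dia (fn (R t).1), toPerpNeg r (R t)) with hα
  have hαm : MapsTo α I (Ioo (-3) 3 ×ˢ U) := fun t ht =>
    ⟨⟨by linarith [ht.1], by linarith [ht.2]⟩, hU t ht⟩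
  have hα₁ : ContinuousOn (fun t => momentum Dia (fn (R t).1)) I :=
    ((hsym.contDiff_momentum hd (le_refl d) (k := 0)).continuous.comp
      continuous_subtype_val).comp_continuousOn hRc
  have hα₂ : ContinuousOn (fun t => toPerpNeg r (R t)) I :=
    (continuous_toPerpNeg r d).comp_continuousOn hRc
  have hα₃ : ContinuousOn (fun t => (momentum Dia (fn (R t).1), toPerpNeg r (R t))) I :=
    ContinuousOn.prodMk hα₁ hα₂
  have hαc : ContinuousOn α I := ContinuousOn.prodMk continuousOn_id hα₃
  have hAα : ContinuousOn (fun t => A (α t)) I := hAc.comp hαc hαm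
  have hDα : ContinuousOn (fun t => D (α t)) I := hDc.comp hαc hαm
  obtain ⟨q, hq0, hq⟩ := exists_primitive_Icc ha hAα
  have hqc : ContinuousOn q I := fun t ht => (hq t ht).continuousWithinAt
  have hgD : ContinuousOn (fun t => hsym.gI hnr (-q t) (D (α t))) I :=
    continuousOn_gI hsym hnr hqc.neg hDα
  obtain ⟨S, hS0, hS⟩ := exists_primitive_Icc ha hgD
  have hform : ∀ t ∈ I, fn (R t).1 = G (q t) (fn (R 0).1 + fn (S t)) := by
    have hder : ∀ t ∈ I, HasDerivWithinAt (fun t => G (-q t) (fn (R t).1) - fn (S t)) 0 I t := by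
      intro t ht
      have hx : fn (R t).1 = (fun t => fn (R t).1) t := rfl
      have h1 := hasDerivWithinAt_G_apply hsym hd (hq t ht).neg (hR t ht) hx
      have h2 : HasDerivWithinAt (fun t => fn (S t)) (fn (hsym.gI hnr (-q t) (D (α t)))) I t :=
        fn.hasFDerivAt.comp_hasDerivWithinAt t (hS t ht)
      have h3 := h1.sub h2
      have e : G (-q t) (∑ j, A (α t) j • matOp J (app (Dia j) (fn (R t).1)) + fn (D (α t)))
          + ∑ j, (-A (α t)) j • matOp J (app (Dia j) (G (-q t) (fn (R t).1)))
          - fn (hsym.gI hnr (-q t) (D (α t))) = 0 := by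
        simp [hsym.app_G, hsym.G_matOp, map_sum]
      rw [← e]
      exact h3
    intro t ht
    have hconst : G (-q t) (fn (R t).1) - fn (S t) = G (-q 0) (fn (R 0).1) - fn (S 0) := by
      have := (convex_Icc (-a) a).norm_image_sub_le_of_norm_hasDerivWithin_le (C := 0) hder
        (by simp) h0I ht
      rw [zero_mul, norm_le_zero_iff, sub_eq_zero] at this
      exact this
    rw [hq0, hS0, neg_zero, hsym.G_zero_apply, map_zero, sub_zero] at hconst
    rw [← sub_eq_iff_eq_add.1 hconst, hsym.G_apply_neg]
  have harg : ∀ t ∈ I, h ((q t, S t), lam) = (momentum Dia (fn (R t).1), toPerpNeg r (R t)) := by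
    intro t ht
    have h1 : fn (R t).1 = G (q t) (fn (R 0).1 + fn (S t))
        - projNg J Dia Φ p₀ (G (q t) (fn (R 0).1 + fn (S t))) := by
      rw [← hform t ht, IsSolitonFamily.projNg_eq_zero (R t).2, sub_zero]
    rw [hlam]
    exact arguments_eq hh h1
  refine ⟨fun t => (τ t - τ 0, q t, S t), by simp [hq0, hS0], fun t ht => ?_, fun t ht => ?_,
    fun t ht => ⟨by simp, hform t ht⟩⟩
  · refine ⟨(hαm ht).1, ?_⟩
    change h ((q t, S t), lam) ∈ U
    rw [harg t ht]
    exact hU t ht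
  · have e : reducedField T A D (fun y => hsym.gI hnr (-y.1) y.2) h
        (t, (τ t - τ 0, q t, S t), lam) =
        (T (α t), A (α t), hsym.gI hnr (-q t) (D (α t))) := by
      simp only [reducedField, harg t ht]
      rfl
    rw [e]
    exact ((hτ t ht).sub_const _).prodMk ((hq t ht).prodMk (hS t ht))

end Correspondence

/-! ### The flow in coordinates -/

section Flow

variable {N n₀ : ℕ} {J : Matrix (Fin (2 * N)) (Fin (2 * N)) ℝ}
  {Dia : Fin n₀ → (L2 N →ₗ.[ℝ] L2 N)} {ord : Fin n₀ → ℕ} {G : Rn n₀ → (L2 N →L[ℝ] L2 N)}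
  {O : Set (Rn n₀)} {Φ : Rn n₀ → L2 N} {p₀ : Rn n₀}

/-- The datum `(Π(R), R)` of the reduced system which belongs to a point `(τ, Π, R)`. -/
def datum (Dia : Fin n₀ → (L2 N →ₗ.[ℝ] L2 N)) (m : ℕ) {s : ℕ} {K : Submodule ℝ (L2 N)}
    (z : Phase n₀ K s) : Rn n₀ × Sd N m :=
  (momentum Dia (fn z.2.2.1), toSd m (fn z.2.2.1))

variable (hsym : IsSymmetrySetup J Dia ord G) {d : ℕ} (hd : ∀ j, ord j ≤ d)
  {m n r s s' : ℕ} {K : Submodule ℝ (L2 N)}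

/-- The map `(τ₀, Π, R₀) ↦ (τ₀ + τ, Π, Q e^{Jq·◇}(R₀ + S))` from points of regularity `s'` to `s`,
where `(τ, q, S)` is the value at the datum of `(τ₀, Π, R₀)` of a map `x`, and `Q` is a projection
to `Σ_s ∩ K^⊥`. -/
def frameFlow (x : ℝ × Rn n₀ × Sd N m → Rn n₀ × Rn n₀ × Sg N n) (Q : Sg N s → perp K s)
    (hs : s ≤ s') (hn : s ≤ n) (t : ℝ) (z : Phase n₀ K s') : Phase n₀ K s :=
  (z.1 + (x (t, datum Dia m z)).1, z.2.1,
    Q (hsym.gI hs (x (t, datum Dia m z)).2.1 z.2.2.1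
      + hsym.gI hn (x (t, datum Dia m z)).2.1 (x (t, datum Dia m z)).2.2))

variable {x : ℝ × Rn n₀ × Sd N m → Rn n₀ × Rn n₀ × Sg N n}

lemma datum_eq_of_samePoint {z : Phase n₀ K s} {z' : Phase n₀ K s'} (h : SamePoint z z') :
    datum Dia m z = datum Dia m z' := by
  simp only [datum, h.2.2]

lemma fn_frameFlow {Q : Sg N s → perp K s}
    (hQ : ∀ w, fn (Q w).1 = fn w - projNg J Dia Φ p₀ (fn w)) (hs : s ≤ s') (hn : s ≤ n) (t : ℝ)
    (z : Phase n₀ K s') :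
    fn (frameFlow hsym x Q hs hn t z).2.2.1 =
      G (x (t, datum Dia m z)).2.1 (fn z.2.2.1 + fn (x (t, datum Dia m z)).2.2)
      - projNg J Dia Φ p₀
        (G (x (t, datum Dia m z)).2.1 (fn z.2.2.1 + fn (x (t, datum Dia m z)).2.2)) := by
  simp [frameFlow, hQ]

lemma samePoint_frameFlow {s₁ s₁' : ℕ} {Q : Sg N s → perp K s}
    (hQ : ∀ w, fn (Q w).1 = fn w - projNg J Dia Φ p₀ (fn w)) (hs : s ≤ s') (hn : s ≤ n)
    {Q₁ : Sg N s₁ → perp K s₁} (hQ₁ : ∀ w, fn (Q₁ w).1 = fn w - projNg J Dia Φ p₀ (fn w))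
    (hs₁ : s₁ ≤ s₁') (hn₁ : s₁ ≤ n) (t : ℝ) {z : Phase n₀ K s'} {z₁ : Phase n₀ K s₁'}
    (h : SamePoint z z₁) :
    SamePoint (frameFlow hsym x Q hs hn t z) (frameFlow hsym x Q₁ hs₁ hn₁ t z₁) := by
  refine ⟨?_, h.2.1, ?_⟩
  · simp only [frameFlow, datum_eq_of_samePoint h, h.1]
  · rw [fn_frameFlow hsym hQ, fn_frameFlow hsym hQ₁, datum_eq_of_samePoint h, h.2.2]

lemma samePoint_symm {z : Phase n₀ K s} {z' : Phase n₀ K s'} (h : SamePoint z z') :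
    SamePoint z' z := ⟨h.1.symm, h.2.1.symm, h.2.2.symm⟩

include hsym hd in
lemma contDiff_datum (hds : d ≤ s) {k : WithTop ℕ∞} :
    ContDiff ℝ k (datum Dia m : Phase n₀ K s → Rn n₀ × Sd N m) := by
  have h1 : ContDiff ℝ k fun z : Phase n₀ K s => z.2.2.1 :=
    (perp K s).subtypeL.contDiff.comp (contDiff_snd.comp contDiff_snd)
  have h2 := (hsym.contDiff_momentum hd hds (k := k)).comp h1
  have h3 := (toSdL N m ∘L fn : Sg N s →L[ℝ] Sd N m).contDiff (n := k)
  have h4 := h3.comp h1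
  exact ContDiff.prodMk h2 h4

include hd in
/-- The loss of regularity from `s'` to `s ≤ s' - ld` makes the flow a map of class `C^l`. -/
lemma contDiffOn_frameFlow {l : ℕ} (hl : 1 ≤ l) {I : Set ℝ} {V : Set (Rn n₀ × Sd N m)}
    (hx : ContDiffOn ℝ l x (I ×ˢ V)) {Q : Sg N s → perp K s} (hQ : IsBoundedLinearMap ℝ Q)
    (hss : s + l * d ≤ s') (hsn : s + l * d ≤ n) (hs : s ≤ s') (hn : s ≤ n)
    {W : Set (Phase n₀ K s')} (hW : ∀ z ∈ W, datum Dia m z ∈ V) :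
    ContDiffOn ℝ l (fun y : ℝ × Phase n₀ K s' => frameFlow hsym x Q hs hn y.1 y.2) (I ×ˢ W) := by
  have hds : d ≤ s' := by nlinarith
  have h0 : ContDiff ℝ l fun y : ℝ × Phase n₀ K s' => (y.1, datum Dia m y.2) :=
    contDiff_fst.prodMk ((contDiff_datum hsym hd hds).comp contDiff_snd)
  have h1 : ContDiffOn ℝ l (fun y : ℝ × Phase n₀ K s' => x (y.1, datum Dia m y.2)) (I ×ˢ W) :=
    hx.comp h0.contDiffOn fun y hy => ⟨hy.1, hW _ hy.2⟩
  have hτ : ContDiffOn ℝ l (fun y : ℝ × Phase n₀ K s' => (x (y.1, datum Dia m y.2)).1) (I ×ˢ W) :=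
    contDiff_fst.comp_contDiffOn h1
  have hq : ContDiffOn ℝ l (fun y : ℝ × Phase n₀ K s' => (x (y.1, datum Dia m y.2)).2.1)
      (I ×ˢ W) := (contDiff_fst.comp contDiff_snd).comp_contDiffOn h1
  have hS : ContDiffOn ℝ l (fun y : ℝ × Phase n₀ K s' => (x (y.1, datum Dia m y.2)).2.2)
      (I ×ˢ W) := (contDiff_snd.comp contDiff_snd).comp_contDiffOn h1
  have hR : ContDiff ℝ l fun y : ℝ × Phase n₀ K s' => y.2.2.2.1 :=
    (perp K s').subtypeL.contDiff.comp (contDiff_snd.comp (contDiff_snd.comp contDiff_snd))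
  have g1 := hsym.contDiff_gI_uncurry hd l hss hs
  have g2 := hsym.contDiff_gI_uncurry hd l hsn hn
  have k1 := g1.comp_contDiffOn (hq.prodMk hR.contDiffOn)
  have k2 := g2.comp_contDiffOn (hq.prodMk hS)
  have k3 := hQ.contDiff.comp_contDiffOn (k1.add k2)
  have k4 : ContDiffOn ℝ l (fun y : ℝ × Phase n₀ K s' => y.2.1) (I ×ˢ W) :=
    (contDiff_fst.comp contDiff_snd).contDiffOn
  have k5 : ContDiffOn ℝ l (fun y : ℝ × Phase n₀ K s' => y.2.2.1) (I ×ˢ W) :=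
    (contDiff_fst.comp (contDiff_snd.comp contDiff_snd)).contDiffOn
  exact (k4.add hτ).prodMk (k5.prodMk k3)

include hsym hd in
/-- The quantity which defines the domains `𝒰_{ε,k}` is controlled along the flow. -/
lemma exists_norm_toSd_add_momentum_le (k : ℕ) (hn : m + d ≤ n) : ∃ c : ℝ, 0 ≤ c ∧
    ∀ (q : Rn n₀) (S : Sg N n) (u₀ : Sg N d), ‖q‖ ≤ 1 → ‖S‖ ≤ 1 → ‖toSd m (fn u₀)‖ ≤ 1 →
      ‖toSd k (G q (fn u₀ + fn S))‖ + ‖momentum Dia (G q (fn u₀ + fn S))‖ ≤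
        ‖momentum Dia (fn u₀)‖ + c * (‖toSd k (fn u₀)‖ + ‖S‖) := by
  obtain ⟨c₁, hc₁, h₁⟩ := hsym.norm_movedFrame_le (n := n) (le_refl k)
  obtain ⟨c₂, hc₂, h₂⟩ := hsym.norm_pairing_le hd hn
  obtain ⟨c₃, hc₃, h₃⟩ := hsym.norm_momentum_le hd (by omega : d ≤ n)
  refine ⟨c₁ + c₂ + c₃, by positivity, fun q S u₀ hq hS hu => ?_⟩
  have e1 := h₁ q S (toSd k (fn u₀)) hq
  rw [hsym.movedFrame_toSd] at e1
  have e2 : ‖momentum Dia (G q (fn u₀ + fn S))‖ ≤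
      ‖momentum Dia (fn u₀)‖ + c₂ * ‖S‖ + c₃ * ‖S‖ := by
    rw [hsym.momentum_G, hsym.momentum_add hd hn le_rfl]
    refine (norm_add₃_le).trans ?_
    gcongr
    · refine (h₂ _ _).trans ?_
      gcongr
      exact mul_le_of_le_one_left (norm_nonneg _) hu
    · refine (h₃ _).trans ?_
      gcongr
      exact mul_le_of_le_one_left (norm_nonneg _) hS
  have p1 : 0 ≤ (c₂ + c₃) * ‖toSd k (fn u₀)‖ := by positivity
  simp only at e1
  linarith

variable (hΦ : IsSolitonFamily J Dia O Φ) (hp₀ : p₀ ∈ O) (hmd : m + d ≤ n)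
  (hnr : n ≤ r)
  {T A : ℝ → Rn n₀ → Rn n₀ → perpNeg (NgStar J Dia Φ p₀) r → Rn n₀}
  {D : ℝ → Rn n₀ → Rn n₀ → perpNeg (NgStar J Dia Φ p₀) r → Sg N r}
  {U : Set (Rn n₀ × perpNeg (NgStar J Dia Φ p₀) r)}
  {h : (Rn n₀ × Sg N n) × (Rn n₀ × Sd N m) → Rn n₀ × perpNeg (NgStar J Dia Φ p₀) r}
  (hh : ∀ q S (u₀ : Sg N d), ∀ u, u = G q (fn u₀ + fn S) →
    (h ((q, S), (momentum Dia (fn u₀), toSd m (fn u₀)))).1 =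
      momentum Dia (u - projNg J Dia Φ p₀ u) ∧
    (h ((q, S), (momentum Dia (fn u₀), toSd m (fn u₀)))).2.1 =
      toSd r (u - projNg J Dia Φ p₀ u))
  {Q : Sg N d → perp (NgStar J Dia Φ p₀) d}
  (hQb : IsBoundedLinearMap ℝ Q)
  (hQ : ∀ w, fn (Q w).1 = fn w - projNg J Dia Φ p₀ (fn w)) (hdn : d ≤ n)

include hd hΦ hp₀ hmd hh hQb hQ in
/-- The flow of the reduced system gives solutions of the original system. -/
lemma isSolution_frameFlow {B : ℝ}
    (htangent : ∀ t ∈ Ioo (-3 : ℝ) 3, ∀ R : perp (NgStar J Dia Φ p₀) d,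
      (momentum Dia (fn R.1), toPerpNeg r R) ∈ U →
      projNg J Dia Φ p₀ (fieldR J Dia A D t p₀ R) = 0)
    {z₀ : Phase n₀ (NgStar J Dia Φ p₀) d} (hz₀ : z₀.2.1 = p₀)
    (hx0 : x (0, datum Dia m z₀) = 0)
    (hx : ∀ t ∈ Icc (-2 : ℝ) 2,
      (t, x (t, datum Dia m z₀), datum Dia m z₀) ∈ reducedDomain h U ∧
      HasDerivAt (fun t => x (t, datum Dia m z₀))
        (reducedField (fun y => T y.1 p₀ y.2.1 y.2.2) (fun y => A y.1 p₀ y.2.1 y.2.2)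
          (fun y => D y.1 p₀ y.2.1 y.2.2) (fun y => hsym.gI hnr (-y.1) y.2) h
          (t, x (t, datum Dia m z₀), datum Dia m z₀)) t)
    (hB : ∀ t ∈ Icc (-2 : ℝ) 2, ‖A t p₀ (h ((x (t, datum Dia m z₀)).2, datum Dia m z₀)).1
      (h ((x (t, datum Dia m z₀)).2, datum Dia m z₀)).2‖ ≤ B) :
    IsSolution J Dia T A D U z₀ (fun t => frameFlow hsym x Q le_rfl hdn t z₀) ∧
    ∀ t ∈ Icc (-2 : ℝ) 2,
      fn (frameFlow hsym x Q le_rfl hdn t z₀).2.2.1 =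
        G (x (t, datum Dia m z₀)).2.1 (fn z₀.2.2.1 + fn (x (t, datum Dia m z₀)).2.2) ∧
      h ((x (t, datum Dia m z₀)).2, datum Dia m z₀) =
        (momentum Dia (fn (frameFlow hsym x Q le_rfl hdn t z₀).2.2.1),
          toPerpNeg r (frameFlow hsym x Q le_rfl hdn t z₀).2.2) := by
  have hkey := solution_of_reduced hsym hd hΦ hp₀ hmd hnr
    (T := fun y => T y.1 p₀ y.2.1 y.2.2) (A := fun y => A y.1 p₀ y.2.1 y.2.2)
    (D := fun y => D y.1 p₀ y.2.1 y.2.2) (U := U) hh (a := 2) (by norm_num) (by norm_num)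
    htangent z₀.2.2 (lam := datum Dia m z₀) rfl (B := B) (x := fun t => x (t, datum Dia m z₀))
    hx0 (fun t ht => (hx t ht).1.2) hB (fun t ht => (hx t ht).2.hasDerivWithinAt)
    (R := fun t => (frameFlow hsym x Q le_rfl hdn t z₀).2.2)
    (fun t => fn_frameFlow hsym hQ le_rfl hdn t z₀)
  have hcx : ContinuousOn (fun t => x (t, datum Dia m z₀)) (Icc (-2) 2) := fun t ht =>
    (hx t ht).2.continuousAt.continuousWithinAt
  have hqc : ContinuousOn (fun t => (x (t, datum Dia m z₀)).2.1) (Icc (-2) 2) :=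
    (continuous_fst.comp continuous_snd).comp_continuousOn hcx
  have hSc : ContinuousOn (fun t => (x (t, datum Dia m z₀)).2.2) (Icc (-2) 2) :=
    (continuous_snd.comp continuous_snd).comp_continuousOn hcx
  have hτc : ContinuousOn (fun t => (x (t, datum Dia m z₀)).1) (Icc (-2) 2) :=
    continuous_fst.comp_continuousOn hcx
  have hRc : ContinuousOn (fun t => (frameFlow hsym x Q le_rfl hdn t z₀).2.2) (Icc (-2) 2) := by
    have h1 := continuousOn_gI hsym (le_refl d) hqc
      (continuousOn_const (c := z₀.2.2.1) : ContinuousOn _ (Icc (-2 : ℝ) 2))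
    have h2 := continuousOn_gI hsym hdn hqc hSc
    have h3 := hQb.continuous.comp_continuousOn (h1.add h2)
    exact h3
  have hp : ∀ t, (frameFlow hsym x Q le_rfl hdn t z₀).2.1 = p₀ := fun t => hz₀
  refine ⟨⟨?_, fun t ht => ?_, ?_, fun t ht => ?_, fun t ht => ?_, fun t ht => ?_⟩,
    fun t ht => ⟨(hkey t ht).1, (hkey t ht).2.1⟩⟩
  · refine Prod.ext (by simp [frameFlow, hx0]) (Prod.ext rfl (Subtype.ext (fn_injective ?_)))
    rw [(hkey 0 (by norm_num)).1]
    simp [hx0, hsym.G_zero_apply]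
  · rw [← (hkey t ht).2.1]
    exact (hx t ht).1.2
  · have h1 : ContinuousOn (fun t => z₀.1 + (x (t, datum Dia m z₀)).1) (Icc (-2) 2) :=
      continuousOn_const.add hτc
    exact h1.prodMk (continuousOn_const.prodMk hRc)
  · have h1 := (HasDerivWithinAt.components (hx t ht).2.hasDerivWithinAt (s := Icc (-2) 2)).1
    have h2 := h1.const_add z₀.1
    simp only [(hkey t ht).2.1] at h2
    rw [hp t]
    exact h2
  · exact hasDerivWithinAt_const _ _ _
  · have h1 := (hkey t ht).2.2
    simp only [(hkey t ht).2.1] at h1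
    rw [hp t]
    exact h1

include hd hh hQ in
/-- Every solution of the original system is given by the flow of the reduced one. -/
lemma eq_frameFlow_of_isSolution
    (hA : ContinuousOn (fun y : ℝ × Rn n₀ × perpNeg (NgStar J Dia Φ p₀) r =>
      A y.1 p₀ y.2.1 y.2.2) (Ioo (-3) 3 ×ˢ U))
    (hD : ContinuousOn (fun y : ℝ × Rn n₀ × perpNeg (NgStar J Dia Φ p₀) r =>
      D y.1 p₀ y.2.1 y.2.2) (Ioo (-3) 3 ×ˢ U))
    {z₀ : Phase n₀ (NgStar J Dia Φ p₀) d} (hz₀ : z₀.2.1 = p₀)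
    (huniq : ∀ y : ℝ → Rn n₀ × Rn n₀ × Sg N n, y 0 = 0 →
      (∀ t ∈ Icc (-2 : ℝ) 2, (t, y t, datum Dia m z₀) ∈ reducedDomain h U) →
      (∀ t ∈ Icc (-2 : ℝ) 2, HasDerivWithinAt y
        (reducedField (fun y => T y.1 p₀ y.2.1 y.2.2) (fun y => A y.1 p₀ y.2.1 y.2.2)
          (fun y => D y.1 p₀ y.2.1 y.2.2) (fun y => hsym.gI hnr (-y.1) y.2) h
          (t, y t, datum Dia m z₀)) (Icc (-2) 2) t) →
      ∀ t ∈ Icc (-2 : ℝ) 2, y t = x (t, datum Dia m z₀))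
    {z : ℝ → Phase n₀ (NgStar J Dia Φ p₀) d} (hz : IsSolution J Dia T A D U z₀ z) :
    ∀ t ∈ Icc (-2 : ℝ) 2, z t = frameFlow hsym x Q le_rfl hdn t z₀ := by
  have hP : ∀ t ∈ Icc (-2 : ℝ) 2, (z t).2.1 = p₀ := by
    intro t ht
    have := (convex_Icc (-2 : ℝ) 2).norm_image_sub_le_of_norm_hasDerivWithin_le (C := 0)
      hz.deriv_Pi (by simp) (by norm_num : (0 : ℝ) ∈ Icc (-2 : ℝ) 2) ht
    rw [zero_mul, norm_le_zero_iff, sub_eq_zero] at this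
    rw [this, hz.init, hz₀]
  have hRc : ContinuousOn (fun t => (z t).2.2) (Icc (-2) 2) :=
    (continuous_snd.comp continuous_snd).comp_continuousOn hz.cont
  obtain ⟨y, hy0, hymem, hy, hform⟩ := reduced_of_solution hsym hd hnr
    (T := fun y => T y.1 p₀ y.2.1 y.2.2) (A := fun y => A y.1 p₀ y.2.1 y.2.2)
    (D := fun y => D y.1 p₀ y.2.1 y.2.2) (U := U) hh (a := 2) (by norm_num) (by norm_num)
    hA hD (R := fun t => (z t).2.2) (τ := fun t => (z t).1) (lam := datum Dia m z₀)
    (by rw [hz.init]; rfl) hRc hz.mem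
    (fun t ht => by have := hz.deriv_tau t ht; rw [hP t ht] at this; exact this)
    (fun t ht => by have := hz.deriv_R t ht; rw [hP t ht] at this; exact this)
  have hxy := huniq y hy0 hymem hy
  intro t ht
  obtain ⟨h1, h2⟩ := hform t ht
  rw [hxy t ht, hz.init] at h1 h2
  refine Prod.ext h1 (Prod.ext ((hP t ht).trans hz₀.symm) (Subtype.ext (fn_injective ?_)))
  rw [fn_frameFlow hsym hQ, ← h2, IsSolitonFamily.projNg_eq_zero (z t).2.2.2, sub_zero]

end Flow

/-! ### The decomposition of the nonlinear part and the domains of the flow -/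

section Decomposition

variable {N n₀ : ℕ} {J : Matrix (Fin (2 * N)) (Fin (2 * N)) ℝ}
  {Dia : Fin n₀ → (L2 N →ₗ.[ℝ] L2 N)} {ord : Fin n₀ → ℕ} {G : Rn n₀ → (L2 N →L[ℝ] L2 N)}
  (hsym : IsSymmetrySetup J Dia ord G) {d : ℕ} (hd : ∀ j, ord j ≤ d)

include hsym in
/-- If `S' = e^{-Jq·◇} E` and `S(0) = 0`, then `S = ∫ E + ∫ (e^{-Jq·◇} - 1) E`. -/
lemma fn_eq_integral_add_integral {n p r : ℕ} (hnr : n ≤ r) (hpr : p ≤ r) {a : ℝ} (ha : 0 ≤ a)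
    {q : ℝ → Rn n₀} {S : ℝ → Sg N n} {E : ℝ → Sg N r} (hS0 : S 0 = 0)
    (hq : ContinuousOn q (Icc (-a) a)) (hE : ContinuousOn E (Icc (-a) a))
    (hS : ∀ t ∈ Icc (-a) a, HasDerivAt S (hsym.gI hnr (-q t) (E t)) t) :
    ∀ t ∈ Icc (-a) a, fn (S t) = fn (∫ u in (0 : ℝ)..t, E u)
      + fn (∫ u in (0 : ℝ)..t, (hsym.gI hpr (-q u) (E u) - hsym.gI hpr 0 (E u))) := by
  intro t ht
  have hsub : uIcc 0 t ⊆ Icc (-a) a :=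
    ordConnected_Icc.uIcc_subset ⟨by linarith, ha⟩ ht
  have hq' : ContinuousOn (fun u => -q u) (uIcc 0 t) := (hq.mono hsub).neg
  have hE' := hE.mono hsub
  have h1 : IntervalIntegrable (fun u => hsym.gI hnr (-q u) (E u)) volume 0 t :=
    (continuousOn_gI hsym hnr hq' hE').intervalIntegrable
  have h2 : IntervalIntegrable E volume 0 t := hE'.intervalIntegrable
  have h3 : ContinuousOn (fun u => hsym.gI hpr (-q u) (E u) - hsym.gI hpr 0 (E u)) (uIcc 0 t) :=
    (continuousOn_gI hsym hpr hq' hE').sub (continuousOn_gI hsym hpr continuousOn_const hE')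
  have e1 := intervalIntegral.integral_eq_sub_of_hasDerivAt (fun u hu => hS u (hsub hu)) h1
  rw [hS0, sub_zero] at e1
  have i1 := fn.intervalIntegral_comp_comm h1
  have i2 := fn.intervalIntegral_comp_comm h2
  have h4 := h3.intervalIntegrable (μ := volume)
  have i3 := fn.intervalIntegral_comp_comm h4
  rw [← e1, ← i1, ← i2, ← i3, ← intervalIntegral.integral_add]
  · refine intervalIntegral.integral_congr fun u _ => ?_
    simp [hsym.G_zero_apply]
  · exact (fn.continuous.comp_continuousOn hE').intervalIntegrable
  · exact (fn.continuous.comp_continuousOn h3).intervalIntegrable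

include hsym hd in
lemma exists_norm_integral_gI_sub_le {p r : ℕ} (h : p + d ≤ r) : ∃ C, 0 ≤ C ∧
    ∀ {a t b e : ℝ}, 0 ≤ a → t ∈ Icc (-a) a → ∀ {q : ℝ → Rn n₀} {E : ℝ → Sg N r},
      (∀ u ∈ Icc (-a) a, ‖q u‖ ≤ 1 ∧ ‖q u‖ ≤ b ∧ ‖E u‖ ≤ e) →
      ‖∫ u in (0 : ℝ)..t, (hsym.gI (by omega : p ≤ r) (-q u) (E u)
        - hsym.gI (by omega : p ≤ r) 0 (E u))‖ ≤ C * (b * e) * a := by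
  obtain ⟨C, hC0, hC⟩ := hsym.gI_lipschitz hd h 1
  refine ⟨C, hC0, fun {a t b e} ha ht {q E} hqE => ?_⟩
  have hb : 0 ≤ b := (norm_nonneg _).trans (hqE t ht).2.1
  have he : 0 ≤ e := (norm_nonneg _).trans (hqE t ht).2.2
  have hsub : uIcc 0 t ⊆ Icc (-a) a :=
    ordConnected_Icc.uIcc_subset ⟨by linarith, ha⟩ ht
  refine (intervalIntegral.norm_integral_le_of_norm_le_const (C := C * (b * e))
    fun u hu => ?_).trans ?_
  · obtain ⟨h1, h2, h3⟩ := hqE u (hsub (uIoc_subset_uIcc hu))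
    have h4 := hC (-q u) 0 (by simpa using h1) (by simp)
    rw [sub_zero, norm_neg] at h4
    calc _ = ‖(hsym.gI (by omega : p ≤ r) (-q u) - hsym.gI (by omega : p ≤ r) 0) (E u)‖ := rfl
      _ ≤ ‖hsym.gI (by omega : p ≤ r) (-q u) - hsym.gI (by omega : p ≤ r) 0‖ * ‖E u‖ :=
        ContinuousLinearMap.le_opNorm _ _
      _ ≤ (C * ‖q u‖) * ‖E u‖ := by gcongr
      _ ≤ (C * b) * e := by gcongr
      _ = C * (b * e) := by ring
  · rw [sub_zero]
    gcongr
    exact abs_le.2 ht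

lemma sdIncl_toSd {k m : ℕ} (h : k ≤ m) (u : L2 N) : sdIncl h (toSd k u) = toSd m u := by
  ext w
  simp [sdIncl]

lemma contDiff_sdIncl {k m : ℕ} (h : k ≤ m) {l : WithTop ℕ∞} :
    ContDiff ℝ l (sdIncl h : Sd N k → Sd N m) :=
  contDiff_id.clm_comp contDiff_const

lemma norm_sdIncl_le {k m : ℕ} (h : k ≤ m) : ∃ C, 0 ≤ C ∧ ∀ R : Sd N k, ‖sdIncl h R‖ ≤ C * ‖R‖ :=
  ⟨‖(sgIncl h : Sg N m →L[ℝ] Sg N k)‖, norm_nonneg _, fun _ =>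
    (ContinuousLinearMap.opNorm_comp_le _ _).trans_eq (mul_comm _ _)⟩

lemma mem_domU_of_samePoint {K : Submodule ℝ (L2 N)} {p₀ : Rn n₀} {s s' k : ℕ} {ε : ℝ}
    {z : Phase n₀ K s} {z' : Phase n₀ K s'} (h : SamePoint z z') (hz : z' ∈ domU Dia K p₀ s' k ε) :
    z ∈ domU Dia K p₀ s k ε := by
  refine ⟨h.2.1.trans hz.1, ?_⟩
  rw [h.2.2]
  exact hz.2

lemma hasCoords_group {O : Set (Rn n₀)} {Φ : Rn n₀ → L2 N} {K : Submodule ℝ (L2 N)} {s : ℕ}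
    (hsym : IsSymmetrySetup J Dia ord G) (σ : Rn n₀) {u : L2 N} {z : Phase n₀ K s}
    (h : HasCoords J Dia G O Φ u z) :
    HasCoords J Dia G O Φ (G σ u) ((σ + z.1, z.2) : Phase n₀ K s) := by
  obtain ⟨⟨p, hp, rfl⟩, hu⟩ := h
  refine ⟨⟨p, hp, ?_⟩, (hsym.momentum_G σ _).trans hu⟩
  simp only [point, hsym.G_add_apply]

end Decomposition

end DarbouxFlow

end

set_option maxHeartbeats 1000000 in
theorem mainTheorem4 {N n₀ : ℕ}
    -- the matrix `J`, the operators `◇_j` of orders `ord j`, the group `G τ = e^{Jτ·◇}`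
    (J : Matrix (Fin (2 * N)) (Fin (2 * N)) ℝ) (Dia : Fin n₀ → (L2 N →ₗ.[ℝ] L2 N))
    (ord : Fin n₀ → ℕ) (G : Rn n₀ → (L2 N →L[ℝ] L2 N)) (hsym : IsSymmetrySetup J Dia ord G)
    (d : ℕ) (hd : d = maxOrd ord)
    -- the solitary waves, the reference parameter, and `K = N_g(𝓗_{p₀}^*)`
    (O : Set (Rn n₀)) (Φ : Rn n₀ → L2 N) (hΦ : IsSolitonFamily J Dia O Φ)
    (p₀ : Rn n₀) (hp₀ : p₀ ∈ O) (K : Submodule ℝ (L2 N)) (hK : K = NgStar J Dia Φ p₀)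
    -- the indices
    (r M M₀ l k i : ℕ) (hl : 1 ≤ l) (hlM : l ≤ M) (hM₀ : 1 ≤ M₀) (hi : i = 0 ∨ i = 1)
    (hr : (l + 1) * d ≤ r) (hk : k ≤ r - (l + 1) * d)
    -- the coefficients, as functions of `(t, Π, ϱ, R)`
    (T A : ℝ → Rn n₀ → Rn n₀ → perpNeg K r → Rn n₀)
    (D : ℝ → Rn n₀ → Rn n₀ → perpNeg K r → Sg N r)
    (U : Set (Rn n₀ × perpNeg K r)) (hU : IsOpen U) (hU₀ : (0, 0) ∈ U)
    (hT : ContDiffOn ℝ M (fun x : ℝ × Rn n₀ × perpNeg K r => T x.1 p₀ x.2.1 x.2.2)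
      (Ioo (-3) 3 ×ˢ U))
    (hA : ContDiffOn ℝ M (fun x : ℝ × Rn n₀ × perpNeg K r => A x.1 p₀ x.2.1 x.2.2)
      (Ioo (-3) 3 ×ˢ U))
    (hD : ContDiffOn ℝ M (fun x : ℝ × Rn n₀ × perpNeg K r => D x.1 p₀ x.2.1 x.2.2)
      (Ioo (-3) 3 ×ˢ U))
    (Cr : ℝ)
    (hAbound : ∀ t ∈ Ioo (-3 : ℝ) 3, ∀ ϱ R, (ϱ, R) ∈ U →
      ‖A t p₀ ϱ R‖ ≤ Cr * ‖R‖ ^ (M₀ + 1))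
    (hDbound : ∀ t ∈ Ioo (-3 : ℝ) 3, ∀ ϱ R, (ϱ, R) ∈ U →
      ‖D t p₀ ϱ R‖ ≤ Cr * (‖ϱ‖ + ‖R‖) ^ i * ‖R‖ ^ M₀)
    -- the field is annihilated by `P_{N_g}(p₀)`
    (htangent : ∀ t ∈ Ioo (-3 : ℝ) 3, ∀ R : perp K d,
      (momentum Dia (fn R.1), toPerpNeg r R) ∈ U →
      projNg J Dia Φ p₀ (fieldR J Dia A D t p₀ R) = 0) :
    ∃ ε₀ : ℝ, 0 < ε₀ ∧ ∃ F : ℝ → Phase n₀ K d → Phase n₀ K d,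
      -- the initial value problem defines the flow `F` for `t ∈ [-2, 2]` in `𝒰^𝐝_{ε₀,k}`
      (∀ z₀ ∈ domU Dia K p₀ d k ε₀,
        IsSolution J Dia T A D U z₀ (fun t => F t z₀) ∧
        ∀ z : ℝ → Phase n₀ K d, IsSolution J Dia T A D U z₀ z →
          ∀ t ∈ Icc (-2 : ℝ) 2, z t = F t z₀) ∧
      -- the form of the flow, with the regularity and the bounds of `q` and `S = S₁ + S₂`
      (∃ (B₁ : Set (Rn n₀)) (B₂ : Set (Sd N k)) (q : ℝ × Rn n₀ × Sd N k → Rn n₀)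
          (S : ℝ × Rn n₀ × Sd N k → Sg N (r - (l + 1) * d))
          (S₁ : ℝ × Rn n₀ × Sd N k → Sg N r) (S₂ : ℝ × Rn n₀ × Sd N k → Sg N (r - d)) (C : ℝ),
        IsOpen B₁ ∧ 0 ∈ B₁ ∧ IsOpen B₂ ∧ 0 ∈ B₂ ∧
        (∀ z ∈ domU Dia K p₀ d k ε₀,
          momentum Dia (fn z.2.2.1) ∈ B₁ ∧ toSd k (fn z.2.2.1) ∈ B₂ ∧
          ∀ t ∈ Ioo (-2 : ℝ) 2,
            fn (F t z).2.2.1 =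
              G (q (t, momentum Dia (fn z.2.2.1), toSd k (fn z.2.2.1)))
                (fn z.2.2.1 + fn (S (t, momentum Dia (fn z.2.2.1), toSd k (fn z.2.2.1)))) ∧
            S₁ (t, momentum Dia (fn z.2.2.1), toSd k (fn z.2.2.1)) =
              ∫ t' in (0 : ℝ)..t,
                D t' p₀ (momentum Dia (fn (F t' z).2.2.1)) (toPerpNeg r (F t' z).2.2)) ∧
        ContDiffOn ℝ l S (Ioo (-2) 2 ×ˢ B₁ ×ˢ B₂) ∧
        ContDiffOn ℝ l q (Ioo (-2) 2 ×ˢ B₁ ×ˢ B₂) ∧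
        ∀ t ∈ Ioo (-2 : ℝ) 2, ∀ ϱ ∈ B₁, ∀ R ∈ B₂,
          ‖q (t, ϱ, R)‖ ≤ C * ‖sdIncl hk R‖ ^ (M₀ + 1) ∧
          ‖S (t, ϱ, R)‖ ≤ C * (‖ϱ‖ + ‖sdIncl hk R‖) ^ i * ‖sdIncl hk R‖ ^ M₀ ∧
          fn (S (t, ϱ, R)) = fn (S₁ (t, ϱ, R)) + fn (S₂ (t, ϱ, R)) ∧
          ‖S₂ (t, ϱ, R)‖ ≤
            C * ‖sdIncl hk R‖ ^ (2 * M₀ + 1) * (‖ϱ‖ + ‖sdIncl hk R‖) ^ i) ∧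
      -- regularity of the flow between the spaces `Σ_{s'}` and `Σ_s`, and invariance of domains
      (∀ s s' : ℕ, s + l * d ≤ s' → s' ≤ r - (l + 1) * d →
        ∃ ε' : ℝ, 0 < ε' ∧ ε' ≤ ε₀ ∧ ∀ ε₁ : ℝ, 0 < ε₁ → ε₁ ≤ ε' →
          (∃ F' : ℝ × Phase n₀ K s' → Phase n₀ K s,
            ContDiffOn ℝ l F' (Ioo (-2) 2 ×ˢ domU Dia K p₀ s' k ε₁) ∧
            ∀ t ∈ Ioo (-2 : ℝ) 2, ∀ z' ∈ domU Dia K p₀ s' k ε₁, ∀ z : Phase n₀ K d,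
              SamePoint z z' → SamePoint (F' (t, z')) (F t z)) ∧
          ∃ ε₂ : ℝ, 0 < ε₂ ∧ ε₂ ≤ ε₁ ∧
            ∀ t ∈ Icc (-2 : ℝ) 2, ∀ z' ∈ domU Dia K p₀ s' k ε₂, ∀ z : Phase n₀ K d,
              SamePoint z z' → ∃ w ∈ domU Dia K p₀ s' k ε₁, SamePoint w (F t z)) ∧
      -- the flow commutes with the group `e^{Jσ·◇}`, which acts in coordinates as `τ ↦ σ + τ`
      (∀ t ∈ Icc (-2 : ℝ) 2, ∀ z ∈ domU Dia K p₀ d k ε₀, ∀ σ : Rn n₀,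
        F t (σ + z.1, z.2) = (σ + (F t z).1, (F t z).2) ∧
        ∀ u u' : L2 N, HasCoords J Dia G O Φ u z → HasCoords J Dia G O Φ u' (F t z) →
          HasCoords J Dia G O Φ (G σ u) ((σ + z.1, z.2) : Phase n₀ K d) ∧
          HasCoords J Dia G O Φ (G σ u') (F t (σ + z.1, z.2))) := by
  have hdj : ∀ j, ord j ≤ d := fun j => hd ▸ Finset.le_sup (Finset.mem_univ j)
  subst hK
  have hld : l * d + d = (l + 1) * d := by ring
  have hdl : d ≤ l * d := Nat.le_mul_of_pos_left d hl
  have hmr : r - (l + 1) * d + (l + 1) * d ≤ r := (Nat.sub_add_cancel hr).le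
  have hnl : (r - (l + 1) * d + d) + l * d ≤ r := by omega
  have hnr : r - (l + 1) * d + d ≤ r := by omega
  have hdn : d ≤ r - (l + 1) * d + d := by omega
  have hmn : r - (l + 1) * d ≤ r - (l + 1) * d + d := by omega
  have hpr : (r - d) + d ≤ r := by omega
  have hlM' : (l : WithTop ℕ∞) ≤ M := by exact_mod_cast hlM
  -- `h` gives the arguments `(Π(R), R)` in terms of `((q, S), (ϱ, R₀))`; `W` is a set of data for
  -- which the reduced system has a solution `x = (τ, q, S)` on `[-2, 2]`.
  obtain ⟨h, hhc, ⟨c₁, hc₁, hhb⟩, hh⟩ := hsym.exists_arguments hdj hΦ hp₀ hmr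
    (le_refl (r - (l + 1) * d + d))
  obtain ⟨c₂, hc₂, hgb⟩ := hsym.norm_gI_le hnr 1
  have hg : ContDiff ℝ l fun y : Rn n₀ × Sg N r => hsym.gI hnr (-y.1) y.2 := by
    have h1 := hsym.contDiff_gI_uncurry hdj l hnl hnr
    have h2 : ContDiff ℝ l fun y : Rn n₀ × Sg N r => (-y.1, y.2) := by fun_prop
    have h3 := h1.comp h2
    exact h3
  have hTl := hT.of_le hlM'
  have hAl := hA.of_le hlM'
  have hDl := hD.of_le hlM'
  have hAb : ∀ t ∈ Ioo (-3 : ℝ) 3, ∀ y ∈ U, ‖A t p₀ y.1 y.2‖ ≤ |Cr| * ‖y.2‖ ^ (M₀ + 1) :=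
    fun t ht y hy => (hAbound t ht y.1 y.2 hy).trans (by gcongr; exact le_abs_self _)
  have hDb : ∀ t ∈ Ioo (-3 : ℝ) 3, ∀ y ∈ U,
      ‖D t p₀ y.1 y.2‖ ≤ |Cr| * (‖y.1‖ + ‖y.2‖) ^ i * ‖y.2‖ ^ M₀ :=
    fun t ht y hy => (hDbound t ht y.1 y.2 hy).trans (by gcongr; exact le_abs_self _)
  have hgb' : ∀ (q : Rn n₀) (y : Sg N r), ‖q‖ ≤ 1 → ‖hsym.gI hnr (-q) y‖ ≤ (c₁ + c₂) * ‖y‖ :=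
    fun q y hq => by
      refine (ContinuousLinearMap.le_opNorm _ _).trans ?_
      gcongr
      exact (hgb (-q) (by simpa using hq)).trans (by linarith)
  have hhb' : ∀ q S ϱ R, ‖q‖ ≤ 1 → ‖S‖ ≤ 1 → ‖R‖ ≤ 1 →
      ‖(h ((q, S), (ϱ, R))).1‖ ≤ ‖ϱ‖ + (c₁ + c₂) * (‖R‖ + ‖S‖) ∧
      ‖(h ((q, S), (ϱ, R))).2‖ ≤ (c₁ + c₂) * (‖R‖ + ‖S‖) := fun q S ϱ R hq hS hR => by
    obtain ⟨b1, b2⟩ := hhb q S ϱ R hq hS hR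
    have hw : 0 ≤ ‖R‖ + ‖S‖ := by positivity
    have h1 : c₁ * (‖R‖ + ‖S‖) ≤ (c₁ + c₂) * (‖R‖ + ‖S‖) := by gcongr; linarith
    exact ⟨b1.trans (by linarith), b2.trans h1⟩
  obtain ⟨W, x, C, hW, h0W, hC, hxc, hx, hxb, huniq⟩ := exists_reduced_flow
    (T := fun y => T y.1 p₀ y.2.1 y.2.2) (A := fun y => A y.1 p₀ y.2.1 y.2.2)
    (D := fun y => D y.1 p₀ y.2.1 y.2.2) hl hU hTl hAl hDl hg hhc hU₀
    (add_nonneg hc₁ hc₂) (abs_nonneg Cr) hM₀ hAb hDb hgb' hhb'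
  -- `R₀` enters `W` through `Σ_{-k} ⊆ Σ_{-m}`, `m = r - (l + 1)d`; a ball around `0` is mapped
  -- into `W`.
  have hι : Continuous fun y : Rn n₀ × Sd N k => (y.1, sdIncl hk y.2) :=
    continuous_fst.prodMk ((contDiff_sdIncl (N := N) hk (l := 0)).continuous.comp continuous_snd)
  obtain ⟨δ, hδ, hball⟩ := Metric.isOpen_iff.1 (hW.preimage hι) 0 (by
    have : sdIncl hk (0 : Sd N k) = 0 := by ext w; rfl
    change ((0 : Rn n₀), sdIncl hk (0 : Sd N k)) ∈ W
    rw [this]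
    exact h0W)
  have hmemW : ∀ ϱ ∈ Metric.ball (0 : Rn n₀) δ, ∀ R ∈ Metric.ball (0 : Sd N k) δ,
      (ϱ, sdIncl hk R) ∈ W := fun ϱ hϱ R hR => by
    refine hball (?_ : (ϱ, R) ∈ Metric.ball (0, 0) δ)
    rw [← ball_prod_same]
    exact ⟨hϱ, hR⟩
  have hdomB : ∀ {s : ℕ} (z : Phase n₀ (NgStar J Dia Φ p₀) s),
      z ∈ domU Dia (NgStar J Dia Φ p₀) p₀ s k (δ / 2) →
      momentum Dia (fn z.2.2.1) ∈ Metric.ball (0 : Rn n₀) δ ∧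
      toSd k (fn z.2.2.1) ∈ Metric.ball (0 : Sd N k) δ := fun z hz => by
    have h1 := hz.2
    rw [mem_ball_zero_iff, mem_ball_zero_iff]
    constructor <;> linarith [norm_nonneg (toSd k (fn z.2.2.1)),
      norm_nonneg (momentum Dia (fn z.2.2.1))]
  have hdomW : ∀ {s : ℕ} (z : Phase n₀ (NgStar J Dia Φ p₀) s),
      z ∈ domU Dia (NgStar J Dia Φ p₀) p₀ s k (δ / 2) → datum Dia (r - (l + 1) * d) z ∈ W :=
    fun z hz => by
      have := hmemW _ (hdomB z hz).1 _ (hdomB z hz).2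
      rwa [sdIncl_toSd] at this
  -- The projection `Q` to `K^⊥` only gives the flow the right type: it fixes the values.
  obtain ⟨Q, hQb, hQ⟩ := hΦ.exists_proj_perp hp₀ hsym d
  have hsol := fun (z : Phase n₀ (NgStar J Dia Φ p₀) d)
      (hz : z ∈ domU Dia (NgStar J Dia Φ p₀) p₀ d k (δ / 2)) =>
    isSolution_frameFlow hsym hdj hΦ hp₀ le_rfl hnr hh hQb hQ hdn htangent hz.1
      (hx _ (hdomW z hz)).1 (hx _ (hdomW z hz)).2
      (fun t ht => (hxb _ (hdomW z hz) t ht).2.2.2.2.2.2.1)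
  refine ⟨δ / 2, by positivity, fun t z => frameFlow hsym x Q le_rfl hdn t z, fun z hz => ⟨?_, ?_⟩,
    ?_, ?_, ?_⟩
  · exact (hsol z hz).1
  · intro y hy
    exact eq_frameFlow_of_isSolution hsym hdj hnr hh hQ hdn (hA.continuousOn) (hD.continuousOn)
      hz.1 (huniq _) hy
  · obtain ⟨c₃, hc₃, hint⟩ := exists_norm_integral_gI_sub_le hsym hdj hpr
    let lam : ℝ × Rn n₀ × Sd N k → Rn n₀ × Sd N (r - (l + 1) * d) :=
      fun y => (y.2.1, sdIncl hk y.2.2)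
    -- `E` is the coefficient `𝒟` along the solution of the reduced system.
    let E : Rn n₀ × Sd N (r - (l + 1) * d) → ℝ → Sg N r := fun μ t =>
      D t p₀ (h ((x (t, μ)).2, μ)).1 (h ((x (t, μ)).2, μ)).2
    have hlam : ∀ z : Phase n₀ (NgStar J Dia Φ p₀) d, ∀ t,
        lam (t, momentum Dia (fn z.2.2.1), toSd k (fn z.2.2.1)) =
          datum Dia (r - (l + 1) * d) z := fun z t => by
      simp only [lam, sdIncl_toSd, datum]
    have hxl : ContDiffOn ℝ l (fun y => x (y.1, lam y))
        (Ioo (-2) 2 ×ˢ Metric.ball (0 : Rn n₀) δ ×ˢ Metric.ball (0 : Sd N k) δ) := by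
      have h1 : ContDiff ℝ l fun y : ℝ × Rn n₀ × Sd N k => (y.1, lam y) :=
        contDiff_fst.prodMk ((contDiff_fst.comp contDiff_snd).prodMk
          ((contDiff_sdIncl hk).comp (contDiff_snd.comp contDiff_snd)))
      exact hxc.comp h1.contDiffOn fun y hy => ⟨hy.1, hmemW _ hy.2.1 _ hy.2.2⟩
    set c₄ : ℝ := ‖(sgIncl hmn : Sg N _ →L[ℝ] Sg N (r - (l + 1) * d))‖ with hc₄
    have hc₄0 : 0 ≤ c₄ := norm_nonneg _
    refine ⟨Metric.ball 0 δ, Metric.ball 0 δ, fun y => (x (y.1, lam y)).2.1,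
      fun y => sgIncl hmn (x (y.1, lam y)).2.2, fun y => ∫ t in (0 : ℝ)..y.1, E (lam y) t,
      fun y => ∫ t in (0 : ℝ)..y.1,
        (hsym.gI (by omega : r - d ≤ r) (-(x (t, lam y)).2.1) (E (lam y) t)
          - hsym.gI (by omega : r - d ≤ r) 0 (E (lam y) t)),
      C + c₄ * C + c₃ * (C * C) * 2, Metric.isOpen_ball, Metric.mem_ball_self hδ,
      Metric.isOpen_ball, Metric.mem_ball_self hδ, fun z hz => ⟨(hdomB z hz).1, (hdomB z hz).2,
        fun t ht => ⟨?_, ?_⟩⟩, ?_, ?_, ?_⟩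
    · simp only [hlam, fn_sgIncl]
      exact ((hsol z hz).2 t (Ioo_subset_Icc_self ht)).1
    · simp only [hlam]
      refine intervalIntegral.integral_congr fun u hu => ?_
      have hu' : u ∈ Icc (-2 : ℝ) 2 :=
        ordConnected_Icc.uIcc_subset (by norm_num) (Ioo_subset_Icc_self ht) hu
      simp only [E, ((hsol z hz).2 u hu').2]
    · exact (ContinuousLinearMap.contDiff (sgIncl hmn)).comp_contDiffOn
        ((contDiff_snd.comp contDiff_snd).comp_contDiffOn hxl)
    · exact (contDiff_fst.comp contDiff_snd).comp_contDiffOn hxl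
    · intro t ht ϱ hϱ R hR
      have ht' := Ioo_subset_Icc_self ht
      have hμ : (ϱ, sdIncl hk R) ∈ W := hmemW ϱ hϱ R hR
      obtain ⟨hx0, hxd⟩ := hx _ hμ
      have hb := hxb _ hμ
      have hcx : ContinuousOn (fun t => x (t, ϱ, sdIncl hk R)) (Icc (-2) 2) := fun u hu =>
        (hxd u hu).2.continuousAt.continuousWithinAt
      have hqc : ContinuousOn (fun t => (x (t, ϱ, sdIncl hk R)).2.1) (Icc (-2) 2) :=
        (continuous_fst.comp continuous_snd).comp_continuousOn hcx
      have hEc : ContinuousOn (E (ϱ, sdIncl hk R)) (Icc (-2) 2) := by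
        have h1 : ContinuousOn (fun t => ((x (t, ϱ, sdIncl hk R)).2, (ϱ, sdIncl hk R)))
            (Icc (-2) 2) := (continuous_snd.comp_continuousOn hcx).prodMk continuousOn_const
        have h2 := hhc.continuous.comp_continuousOn h1
        have h3 := continuousOn_id.prodMk h2
        have h4 := hD.continuousOn.comp h3 fun u hu => (hxd u hu).1
        exact h4
      have hS : ∀ u ∈ Icc (-2 : ℝ) 2, HasDerivAt (fun t => (x (t, ϱ, sdIncl hk R)).2.2)
          (hsym.gI hnr (-(x (u, ϱ, sdIncl hk R)).2.1) (E (ϱ, sdIncl hk R) u)) u := by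
        intro u hu
        have h1 := (HasDerivWithinAt.components (hxd u hu).2.hasDerivWithinAt (s := univ)).2.2
        rw [hasDerivWithinAt_univ] at h1
        exact h1
      have hρ : 0 ≤ ‖ϱ‖ + ‖sdIncl hk R‖ := by positivity
      refine ⟨(hb t ht').2.2.2.1.trans ?_, ?_, ?_, ?_⟩
      · gcongr
        have : 0 ≤ c₄ * C + c₃ * (C * C) * 2 := by positivity
        linarith
      · refine (ContinuousLinearMap.le_opNorm _ _).trans ?_
        have h1 := (hb t ht').2.2.2.2.2.1
        have h2 : 0 ≤ (‖ϱ‖ + ‖sdIncl hk R‖) ^ i * ‖sdIncl hk R‖ ^ M₀ := by positivity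
        have h3 : 0 ≤ C + c₃ * (C * C) * 2 := by positivity
        calc _ ≤ c₄ * (C * (‖ϱ‖ + ‖sdIncl hk R‖) ^ i * ‖sdIncl hk R‖ ^ M₀) := by
              gcongr
          _ = c₄ * C * ((‖ϱ‖ + ‖sdIncl hk R‖) ^ i * ‖sdIncl hk R‖ ^ M₀) := by ring
          _ ≤ (C + c₄ * C + c₃ * (C * C) * 2) *
              ((‖ϱ‖ + ‖sdIncl hk R‖) ^ i * ‖sdIncl hk R‖ ^ M₀) := by gcongr; linarith
          _ = _ := by ring
      · rw [fn_sgIncl]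
        exact fn_eq_integral_add_integral hsym hnr (by omega : r - d ≤ r) zero_le_two
          (by simp only [hx0]; rfl) hqc hEc hS t ht'
      · have h1 := hint zero_le_two ht' (b := C * ‖sdIncl hk R‖ ^ (M₀ + 1))
          (e := C * (‖ϱ‖ + ‖sdIncl hk R‖) ^ i * ‖sdIncl hk R‖ ^ M₀)
          (q := fun t => (x (t, ϱ, sdIncl hk R)).2.1) (E := E (ϱ, sdIncl hk R))
          (fun u hu => ⟨(hb u hu).1, (hb u hu).2.2.2.1, (hb u hu).2.2.2.2.2.2.2⟩)
        refine h1.trans ?_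
        have h2 : 0 ≤ ‖sdIncl hk R‖ ^ (2 * M₀ + 1) * (‖ϱ‖ + ‖sdIncl hk R‖) ^ i := by positivity
        calc _ = c₃ * (C * C) * 2 *
              (‖sdIncl hk R‖ ^ (2 * M₀ + 1) * (‖ϱ‖ + ‖sdIncl hk R‖) ^ i) := by ring
          _ ≤ (C + c₄ * C + c₃ * (C * C) * 2) *
              (‖sdIncl hk R‖ ^ (2 * M₀ + 1) * (‖ϱ‖ + ‖sdIncl hk R‖) ^ i) := by
            gcongr
            have : 0 ≤ C + c₄ * C := by positivity
            linarith
          _ = _ := by ring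
  · intro s s' hss' hs'
    have hs'n : s' ≤ r - (l + 1) * d + d := by omega
    obtain ⟨Qs, hQsb, hQs⟩ := hΦ.exists_proj_perp hp₀ hsym s
    obtain ⟨Qt, -, hQt⟩ := hΦ.exists_proj_perp hp₀ hsym s'
    have hmono : ∀ {s : ℕ} {ε : ℝ}, ε ≤ δ / 2 → domU Dia (NgStar J Dia Φ p₀) p₀ s k ε ⊆
        domU Dia (NgStar J Dia Φ p₀) p₀ s k (δ / 2) := fun hε z hz => ⟨hz.1, hz.2.trans hε⟩
    refine ⟨δ / 2, by positivity, le_rfl, fun ε₁ hε₁ hε₁' => ⟨⟨fun y =>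
      frameFlow hsym x Qs (by omega : s ≤ s') (by omega : s ≤ r - (l + 1) * d + d) y.1 y.2,
      ?_, ?_⟩, ?_⟩⟩
    · exact contDiffOn_frameFlow hsym hdj hl hxc hQsb hss' (by omega) _ _
        fun z hz => hdomW z (hmono hε₁' hz)
    · intro t ht z' hz' z hzz
      exact samePoint_frameFlow hsym hQs _ _ hQ _ _ t (samePoint_symm hzz)
    · obtain ⟨c₃, hc₃, hinv⟩ := exists_norm_toSd_add_momentum_le (m := r - (l + 1) * d) hsym hdj k
        (le_refl (r - (l + 1) * d + d))
      obtain ⟨c₄, hc₄, hincl⟩ := norm_sdIncl_le (N := N) hk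
      -- `κ` bounds the growth of `‖R‖_{Σ_{-k}} + |Π(R)|` under the flow.
      set κ : ℝ := 1 + c₃ * (1 + C * c₄) with hκ
      have hκ1 : 1 ≤ κ := by
        have : 0 ≤ c₃ * (1 + C * c₄) := by positivity
        linarith
      have hε₂ : ε₁ / κ ≤ ε₁ := div_le_self hε₁.le hκ1
      refine ⟨ε₁ / κ, by positivity, hε₂, fun t ht z' hz' z hzz => ?_⟩
      have hz := mem_domU_of_samePoint hzz hz'
      have hz2 := hz.2
      have hzδ := hmono (hε₂.trans hε₁') hz
      have hw : SamePoint (frameFlow hsym x Qt le_rfl hs'n t z')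
          (frameFlow hsym x Q le_rfl hdn t z) :=
        samePoint_frameFlow hsym hQt _ _ hQ _ _ t (samePoint_symm hzz)
      refine ⟨_, mem_domU_of_samePoint hw ⟨hz.1, ?_⟩, hw⟩
      obtain ⟨b1, b2, b3, -, b5, -⟩ := hxb _ (hdomW z hzδ) t ht
      rw [((hsol z hzδ).2 t ht).1]
      refine (hinv _ _ _ b1 b2 b3).trans ?_
      have h1 : ‖(x (t, datum Dia (r - (l + 1) * d) z)).2.2‖ ≤
          C * c₄ * ‖toSd k (fn z.2.2.1)‖ := by
        refine b5.trans ?_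
        rw [mul_assoc]
        gcongr
        have := hincl (toSd k (fn z.2.2.1))
        rwa [sdIncl_toSd] at this
      calc _ ≤ ‖momentum Dia (fn z.2.2.1)‖ + c₃ * (‖toSd k (fn z.2.2.1)‖
            + C * c₄ * ‖toSd k (fn z.2.2.1)‖) := by gcongr
        _ ≤ κ * (‖toSd k (fn z.2.2.1)‖ + ‖momentum Dia (fn z.2.2.1)‖) := by
          have e1 : 0 ≤ c₃ * (1 + C * c₄) * ‖momentum Dia (fn z.2.2.1)‖ := by positivity
          rw [hκ]
          linarith [norm_nonneg (toSd k (fn z.2.2.1))]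
        _ ≤ κ * (ε₁ / κ) := by gcongr
        _ = ε₁ := by field_simp
  · intro t ht z hz σ
    have hF : frameFlow hsym x Q le_rfl hdn t (σ + z.1, z.2) =
        (σ + (frameFlow hsym x Q le_rfl hdn t z).1, (frameFlow hsym x Q le_rfl hdn t z).2) :=
      Prod.ext (add_assoc _ _ _) rfl
    refine ⟨hF, fun u u' hu hu' => ⟨hasCoords_group hsym σ hu, ?_⟩⟩
    simp only [hF]
    exact hasCoords_group hsym σ hu'
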